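/- Let $N\ge 1$ be an integer, $m>N/2$ real, and $q_\star=\frac{N+2}{N+1}$. Let $H^1_m(\mathbb R^N)$ be the space of real functions $v\in H^1(\mathbb R^N)$ with $$\|v\|_m=\bigl(|v|_m^2+|\nabla v|_m^2\bigr)^{1/2}<\infty,\qquad |f|_m=\Bigl(\int_{\mathbb R^N}(1+|\xi|^{2m})\,|f(\xi)|^2\,d\xi\Bigr)^{1/2}.$$ Let $\mathcal L v=\Delta v+\frac12\,\xi\cdot\nabla v+\frac N2 v$, and let $(e^{\tau\mathcal L})_{\tau\ge0}$ be the semigroup it generates: $e^{0\mathcal L}=\mathrm{id}$ and, for $\tau>0$, $$(e^{\tau\mathcal L}w)(\xi)=\frac{1}{(4\pi a(\tau))^{N/2}}\int_{\mathbb R^N}\exp\Bigl(-\frac{|\xi-e^{-\tau/2}\eta|^2}{4a(\tau)}\Bigr)w(\eta)\,d\eta,\qquad a(\tau)=1-e^{-\tau}.$$ Fix $\chi\in C^\infty([0,\infty))$ with $0\le\chi\le1$, $\chi(r)=1$ for $r\le1$ and $\chi(r)=0$ for $r\ge4$. For $\varrho\in(0,1)$ put $F_\varrho(v)=\chi(\|v\|_m^2/\varrho^2)\,|\nabla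 v|^{q_\star}$, $v\in H^1_m(\mathbb R^N)$. Then $e^{\mathcal L}$ is a bounded linear operator on $H^1_m(\mathbb R^N)$, and there is a constant $C>0$, independent of $\varrho$ (it may depend on $N$, $m$ and $\chi$), such that for every $\varrho\in(0,1)$ the following holds. For every $v_0\in H^1_m(\mathbb R^N)$ the problem $\partial_\tau v=\mathcal L v-F_\varrho(v)$, $v(0)=v_0$, has a unique global mild solution $v\in C([0,\infty);H^1_m(\mathbb R^N))$, that is, a unique such $v$ with $$v(\tau)=e^{\tau\mathcal L}v_0-\int_0^\tau e^{(\tau-s)\mathcal L}F_\varrho(v(s))\,ds\quad\text{in }H^1_m(\mathbb R^N),\qquad \tau\ge0;$$ and, with $\varphi_\tau(v_0)=v(\tau)$, the map $\mathcal R=\varphi_1-e^{\mathcal L}$ belongs to $C^1(H^1_m(\mathbb R^N);H^1_m(\mathbb R^N))$, satisfies $\mathcal R(0)=0$ and $D\mathcal R(0)=0$, and is globally Lipschitz continuous with $$\|\mathcal R(v)-\mathcal R(w)\|_m\le C\,\varrho^{\,q_\star-1}\,\|v-w\|_m\qquad\text{for all }v,w\in H^1_m(\mathbb R^N).$$ 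-/

import Mathlib

open MeasureTheory Set
open scoped ContDiff NNReal ENNReal

noncomputable section

namespace ViscousHJ

/-- Euclidean space `ℝ^N`. -/
abbrev E (N : ℕ) : Type := EuclideanSpace ℝ (Fin N)

/-- The critical exponent `q⋆ = (N+2)/(N+1)`. -/
def qStar (N : ℕ) : ℝ := ((N : ℝ) + 2) / ((N : ℝ) + 1)

/-- The measure `(1 + |ξ|^{2m}) dξ`, so that `L²_m(ℝ^N)` is `Lp ℝ 2 (weightMeasure N m)`. -/
def weightMeasure (N : ℕ) (m : ℝ) : Measure (E N) :=
  (volume : Measure (E N)).withDensity (fun ξ => ENNReal.ofReal (1 + ‖ξ‖ ^ (2 * m)))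

/-- `g` is the weak gradient of `v` on `ℝ^N`: for every test function `ψ ∈ C_c^∞(ℝ^N)` and every
direction `e`, `∫ v ∂_e ψ = - ∫ (g · e) ψ`. -/
def IsWeakGradient {N : ℕ} (v : E N → ℝ) (g : E N → E N) : Prop :=
  ∀ ψ : E N → ℝ, ContDiff ℝ ∞ ψ → HasCompactSupport ψ → ∀ e : E N,
    ∫ ξ, v ξ * fderiv ℝ ψ ξ e = - ∫ ξ, inner ℝ (g ξ) e * ψ ξ

theorem volume_le_weightMeasure (N : ℕ) (m : ℝ) :
    (volume : Measure (E N)) ≤ weightMeasure N m := by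
  have h : (volume : Measure (E N)).withDensity (fun _ => (1 : ℝ≥0∞)) ≤ weightMeasure N m := by
    refine withDensity_mono (Filter.Eventually.of_forall fun ξ => ?_)
    simp only [ENNReal.one_le_ofReal]
    have : 0 ≤ ‖ξ‖ ^ (2 * m) := Real.rpow_nonneg (norm_nonneg _) _
    linarith
  simpa [withDensity_const] using h

theorem ae_volume_of_ae_weight {N : ℕ} {m : ℝ} {p : E N → Prop}
    (h : ∀ᵐ ξ ∂(weightMeasure N m), p ξ) : ∀ᵐ ξ, p ξ :=
  (Measure.absolutelyContinuous_of_le (volume_le_weightMeasure N m)).ae_le h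

theorem integrable_mul_fderiv {N : ℕ} {m : ℝ} (v : Lp ℝ 2 (weightMeasure N m))
    {ψ : E N → ℝ} (hψ : ContDiff ℝ ∞ ψ) (hc : HasCompactSupport ψ) (e : E N) :
    Integrable (fun ξ => v ξ * fderiv ℝ ψ ξ e) (volume : Measure (E N)) := by
  have h1 : MemLp v 2 (volume : Measure (E N)) :=
    (Lp.memLp v).mono_measure (volume_le_weightMeasure N m)
  have hcont : Continuous (fun ξ => fderiv ℝ ψ ξ e) :=
    (hψ.continuous_fderiv (by simp)).clm_apply continuous_const
  have h2 : MemLp (fun ξ => fderiv ℝ ψ ξ e) 2 (volume : Measure (E N)) :=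
    hcont.memLp_of_hasCompactSupport (hc.fderiv_apply (𝕜 := ℝ) e)
  exact h1.integrable_mul h2

theorem integrable_inner_mul {N : ℕ} {m : ℝ} (g : Lp (E N) 2 (weightMeasure N m))
    {ψ : E N → ℝ} (hψ : ContDiff ℝ ∞ ψ) (hc : HasCompactSupport ψ) (e : E N) :
    Integrable (fun ξ => inner ℝ (g ξ) e * ψ ξ) (volume : Measure (E N)) := by
  have h1 : MemLp (fun ξ => inner ℝ (g ξ) e) 2 (volume : Measure (E N)) :=
    ((Lp.memLp g).mono_measure (volume_le_weightMeasure N m)).inner_const e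
  have h2 : MemLp ψ 2 (volume : Measure (E N)) := hψ.continuous.memLp_of_hasCompactSupport hc
  exact h1.integrable_mul h2

/-- The weighted Sobolev space `H¹_m(ℝ^N)` of real functions: an element is the pair `(v, ∇v)`
with `v` and its weak gradient `∇v` in the weighted space `L²_m`. The weak gradient is determined
by `v`. The norm is the one of the `ℓ²`-product, `‖v‖_m = (|v|_m² + |∇v|_m²)^{1/2}`. -/
def H1m (N : ℕ) (m : ℝ) :
    Submodule ℝ (WithLp 2 (Lp ℝ 2 (weightMeasure N m) × Lp (E N) 2 (weightMeasure N m))) where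
  carrier := {u | IsWeakGradient (fun ξ => u.fst ξ) (fun ξ => u.snd ξ)}
  zero_mem' := by
    intro ψ _ _ e
    have h1 := ae_volume_of_ae_weight (Lp.coeFn_zero ℝ 2 (weightMeasure N m))
    have h2 := ae_volume_of_ae_weight (Lp.coeFn_zero (E N) 2 (weightMeasure N m))
    have i1 := integral_congr_ae (g := fun _ => (0 : ℝ)) (h1.mono fun ξ h => by
      show (0 : Lp ℝ 2 (weightMeasure N m)) ξ * fderiv ℝ ψ ξ e = 0
      rw [h, Pi.zero_apply, zero_mul])
    have i2 := integral_congr_ae (g := fun _ => (0 : ℝ)) (h2.mono fun ξ h => by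
      show inner ℝ ((0 : Lp (E N) 2 (weightMeasure N m)) ξ) e * ψ ξ = 0
      rw [h, Pi.zero_apply, inner_zero_left, zero_mul])
    simp only [WithLp.zero_fst, WithLp.zero_snd]
    rw [i1, i2, integral_zero, neg_zero]
  add_mem' := by
    intro u w hu hw ψ hψ hc e
    have h1 := ae_volume_of_ae_weight (Lp.coeFn_add u.fst w.fst)
    have h2 := ae_volume_of_ae_weight (Lp.coeFn_add u.snd w.snd)
    have i1 := integral_congr_ae
      (g := fun ξ => u.fst ξ * fderiv ℝ ψ ξ e + w.fst ξ * fderiv ℝ ψ ξ e) (h1.mono fun ξ h => by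
        show (u.fst + w.fst) ξ * fderiv ℝ ψ ξ e = _
        rw [h, Pi.add_apply, add_mul])
    have i2 := integral_congr_ae
      (g := fun ξ => inner ℝ (u.snd ξ) e * ψ ξ + inner ℝ (w.snd ξ) e * ψ ξ) (h2.mono fun ξ h => by
        show inner ℝ ((u.snd + w.snd) ξ) e * ψ ξ = _
        rw [h, Pi.add_apply, inner_add_left, add_mul])
    simp only [WithLp.add_fst, WithLp.add_snd]
    rw [i1, i2, integral_add (integrable_mul_fderiv _ hψ hc e) (integrable_mul_fderiv _ hψ hc e),
      integral_add (integrable_inner_mul _ hψ hc e) (integrable_inner_mul _ hψ hc e),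
      hu ψ hψ hc e, hw ψ hψ hc e, neg_add]
  smul_mem' := by
    intro c u hu ψ hψ hc e
    have h1 := ae_volume_of_ae_weight (Lp.coeFn_smul c u.fst)
    have h2 := ae_volume_of_ae_weight (Lp.coeFn_smul c u.snd)
    have i1 := integral_congr_ae
      (g := fun ξ => c * (u.fst ξ * fderiv ℝ ψ ξ e)) (h1.mono fun ξ h => by
        show (c • u.fst) ξ * fderiv ℝ ψ ξ e = _
        rw [h, Pi.smul_apply, smul_eq_mul, mul_assoc])
    have i2 := integral_congr_ae
      (g := fun ξ => c * (inner ℝ (u.snd ξ) e * ψ ξ)) (h2.mono fun ξ h => by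
        show inner ℝ ((c • u.snd) ξ) e * ψ ξ = _
        rw [h, Pi.smul_apply, real_inner_smul_left, mul_assoc])
    simp only [WithLp.smul_fst, WithLp.smul_snd]
    rw [i1, i2, integral_const_mul, integral_const_mul, hu ψ hψ hc e, mul_neg]

/-- The function underlying an element of `H¹_m` (a representative of its a.e. class). -/
def fn {N : ℕ} {m : ℝ} (u : H1m N m) : E N → ℝ := fun ξ => u.1.fst ξ

/-- The weak gradient of an element of `H¹_m` (a representative of its a.e. class). -/
def grad {N : ℕ} {m : ℝ} (u : H1m N m) : E N → E N := fun ξ => u.1.snd ξ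

/-- `u ∈ H¹_m` is the (a.e. class of the) function `f`. -/
def Represents {N : ℕ} {m : ℝ} (u : H1m N m) (f : E N → ℝ) : Prop :=
  ∀ᵐ ξ : E N, fn u ξ = f ξ

/-- The operator `𝓛 v = Δ v + ½ ξ · ∇v + (N/2) v`. -/
def opL {N : ℕ} (f : E N → ℝ) (ξ : E N) : ℝ :=
  Laplacian.laplacian f ξ + 1 / 2 * fderiv ℝ f ξ ξ + (N : ℝ) / 2 * f ξ

/-- The integral kernel of `e^{τ𝓛}`, `τ > 0`: with `a(τ) = 1 - e^{-τ}`,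
`k(τ, ξ, η) = (4π a(τ))^{-N/2} exp(-|ξ - e^{-τ/2} η|² / (4 a(τ)))`. -/
def kernelL {N : ℕ} (τ : ℝ) (ξ η : E N) : ℝ :=
  (4 * Real.pi * (1 - Real.exp (-τ))) ^ (-(N : ℝ) / 2) *
    Real.exp (-‖ξ - Real.exp (-τ / 2) • η‖ ^ 2 / (4 * (1 - Real.exp (-τ))))

/-- The kernel solves the linear equation: `∂_τ k = 𝓛 k` in the variables `(τ, ξ)`. -/
theorem hasDerivAt_kernelL {N : ℕ} {τ : ℝ} (hτ : 0 < τ) (ξ η : E N) :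
    HasDerivAt (fun t => kernelL t ξ η) (opL (fun x => kernelL τ x η) ξ) τ := by
  have ha : 0 < 1 - Real.exp (-τ) := by
    have : Real.exp (-τ) < 1 := Real.exp_lt_one_iff.mpr (by linarith)
    linarith
  obtain ⟨B, hB⟩ : ∃ B : E N →L[ℝ] E N →L[ℝ] ℝ, ∀ u v, B u v = inner ℝ u v :=
    ⟨innerSL ℝ, fun _ _ => rfl⟩
  set y : E N := Real.exp (-τ / 2) • η with hy
  set a : ℝ := 1 - Real.exp (-τ) with hadef
  set A : ℝ := (4 * Real.pi * a) ^ (-(N : ℝ) / 2) with hA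
  have hk : ∀ x : E N, kernelL τ x η = A * Real.exp (-‖x - y‖ ^ 2 * (4 * a)⁻¹) := by
    intro x
    rw [← div_eq_mul_inv]
    rfl
  have hf : ∀ x : E N, HasFDerivAt (fun x => kernelL τ x η)
      ((-(1 / (2 * a)) * kernelL τ x η) • B (x - y)) x := by
    intro x
    have h1 : HasFDerivAt (fun x : E N => ‖x - y‖ ^ 2) ((2 : ℝ) • B (x - y)) x := by
      refine (((hasFDerivAt_id x).sub_const y).norm_sq).congr_fderiv ?_
      ext v
      simp [hB]
    have h2 := (((h1.fun_neg.mul_const (4 * a)⁻¹).exp).const_mul A)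
    rw [funext hk]
    refine h2.congr_fderiv ?_
    ext v
    simp only [FunLike.coe_smul, Pi.smul_apply, FunLike.coe_neg, Pi.neg_apply, smul_eq_mul, hk]
    field_simp
    ring
  have hfd : fderiv ℝ (fun x => kernelL τ x η) =
      fun x => (-(1 / (2 * a)) * kernelL τ x η) • B (x - y) :=
    funext fun x => (hf x).fderiv
  have hlap : Laplacian.laplacian (fun x => kernelL τ x η) ξ =
      kernelL τ ξ η * (‖ξ - y‖ ^ 2 / (4 * a ^ 2) - N / (2 * a)) := by
    have h2 : HasFDerivAt (fun x => (-(1 / (2 * a)) * kernelL τ x η) • B (x - y))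
        ((-(1 / (2 * a)) * kernelL τ ξ η) • B +
          ((-(1 / (2 * a))) • ((-(1 / (2 * a)) * kernelL τ ξ η) • B (ξ - y))).smulRight
            (B (ξ - y))) ξ := by
      have h3 : HasFDerivAt (fun x : E N => B (x - y)) B ξ :=
        (B.hasFDerivAt (x := ξ - y)).comp ξ ((hasFDerivAt_id ξ).sub_const y)
      exact ((hf ξ).const_mul _).smul h3
    have hn : ‖ξ - y‖ ^ 2 = ∑ i, (ξ - y) i * (ξ - y) i := by
      rw [EuclideanSpace.norm_sq_eq]
      exact Finset.sum_congr rfl fun i _ => by rw [Real.norm_eq_abs, sq_abs, sq]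
    rw [InnerProductSpace.laplacian_eq_iteratedFDeriv_orthonormalBasis _
      (EuclideanSpace.basisFun (Fin N) ℝ)]
    simp only [iteratedFDeriv_two_apply, hfd, h2.fderiv]
    have hterm : ∀ i : Fin N, (((-(1 / (2 * a)) * kernelL τ ξ η) • B +
        ((-(1 / (2 * a))) • ((-(1 / (2 * a)) * kernelL τ ξ η) • B (ξ - y))).smulRight
            (B (ξ - y))) (EuclideanSpace.basisFun (Fin N) ℝ i))
              (EuclideanSpace.basisFun (Fin N) ℝ i) =
        kernelL τ ξ η / (4 * a ^ 2) * ((ξ - y) i * (ξ - y) i) -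
          kernelL τ ξ η / (2 * a) := by
      intro i
      simp [hB, EuclideanSpace.inner_single_right]
      field_simp
      ring
    refine (Finset.sum_congr rfl fun i _ => hterm i).trans ?_
    rw [Finset.sum_sub_distrib, ← Finset.mul_sum, ← hn]
    simp
    ring
  have ha' : HasDerivAt (fun t : ℝ => 1 - Real.exp (-t)) (1 - a) τ := by
    have h := ((hasDerivAt_neg τ).exp).const_sub 1
    simpa [hadef] using h
  have hy' : HasDerivAt (fun t : ℝ => ξ - Real.exp (-t / 2) • η) ((1 / 2 : ℝ) • y) τ := by
    have h := ((((hasDerivAt_id τ).neg.div_const 2).exp).smul_const η).const_sub ξ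
    refine h.congr_deriv ?_
    simp only [hy, smul_smul, ← neg_smul]
    congr 1
    simp
    ring
  have hA' := (ha'.const_mul (4 * Real.pi)).rpow_const (p := -(N : ℝ) / 2)
    (Or.inl (by positivity))
  have hE := (hy'.norm_sq.fun_neg.fun_div (ha'.const_mul 4) (by positivity)).exp
  refine (hA'.fun_mul hE).congr_deriv ?_
  have hpow : (4 * Real.pi * a) ^ (-(N : ℝ) / 2 - 1) = A / (4 * Real.pi * a) := by
    rw [hA, Real.rpow_sub_one (by positivity)]
  have hin : inner ℝ (ξ - y) ξ = ‖ξ - y‖ ^ 2 + inner ℝ (ξ - y) y := by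
    rw [← real_inner_self_eq_norm_sq, ← inner_add_right, sub_add_cancel]
  simp only [opL, hlap, hfd, FunLike.coe_smul, Pi.smul_apply, smul_eq_mul, hB, hin]
  simp only [← hadef, ← hy, hpow, ← hA, hk, inner_smul_right, ← div_eq_mul_inv]
  have hpi := Real.pi_pos
  field_simp
  ring

/-- The semigroup `e^{τ𝓛}`, `τ ≥ 0`, generated by `𝓛`. It acts on all integrable functions (the
Duhamel formula below applies it to functions that need not lie in `L²_m`). -/
def expL {N : ℕ} (τ : ℝ) (f : E N → ℝ) (ξ : E N) : ℝ :=
  if τ ≤ 0 then f ξ else ∫ η, kernelL τ ξ η * f η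

/-- The truncated nonlinearity `F_ϱ(v) = χ(‖v‖_m² / ϱ²) |∇v|^{q⋆}`. -/
def truncF {N : ℕ} {m : ℝ} (χ : ℝ → ℝ) (ϱ : ℝ) (v : H1m N m) (ξ : E N) : ℝ :=
  χ (‖v‖ ^ 2 / ϱ ^ 2) * ‖grad v ξ‖ ^ qStar N

/-- `v` is a global (mild) solution in `C([0,∞); H¹_m)` of `∂_τ v = 𝓛 v - F_ϱ(v)`, `v(0) = v₀`:
`v(τ) = e^{τ𝓛} v₀ - ∫₀^τ e^{(τ-s)𝓛} F_ϱ(v(s)) ds` for all `τ ≥ 0`, where the integral is a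
(convergent) Bochner integral in `H¹_m`. Here `w` is `e^{τ𝓛} v₀` and `g s` is
`e^{(τ-s)𝓛} F_ϱ(v(s))`, as elements of `H¹_m`. Only the values of `v` on `[0,∞)` matter. -/
structure IsGlobalSolution {N : ℕ} {m : ℝ} (χ : ℝ → ℝ) (ϱ : ℝ) (v₀ : H1m N m)
    (v : ℝ → H1m N m) : Prop where
  continuousOn : ContinuousOn v (Ici 0)
  duhamel : ∀ τ : ℝ, 0 ≤ τ → ∃ (w : H1m N m) (g : ℝ → H1m N m),
    Represents w (expL τ (fn v₀)) ∧
    (∀ s ∈ Ico 0 τ, Represents (g s) (expL (τ - s) (truncF χ ϱ (v s)))) ∧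
    IntervalIntegrable g volume 0 τ ∧
    v τ = w - ∫ s in (0 : ℝ)..τ, g s

/-- `φ` is the semiflow of the truncated equation on `H¹_m`: for each initial datum `v₀` the
equation has the global solution `τ ↦ φ τ v₀`, and no other one. -/
def IsSemiflow {N : ℕ} {m : ℝ} (χ : ℝ → ℝ) (ϱ : ℝ) (φ : ℝ → H1m N m → H1m N m) : Prop :=
  ∀ v₀ : H1m N m, IsGlobalSolution χ ϱ v₀ (fun τ => φ τ v₀) ∧
    ∀ v : ℝ → H1m N m, IsGlobalSolution χ ϱ v₀ v → ∀ τ : ℝ, 0 ≤ τ → v τ = φ τ v₀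

/-- A cut-off function: `χ ∈ C^∞([0,∞))`, `0 ≤ χ ≤ 1`, `χ = 1` on `[0,1]`, `χ = 0` on `[4,∞)`. -/
structure IsCutoff (χ : ℝ → ℝ) : Prop where
  smooth : ContDiffOn ℝ ∞ χ (Ici 0)
  nonneg : ∀ r, 0 ≤ r → 0 ≤ χ r
  le_one : ∀ r, 0 ≤ r → χ r ≤ 1
  eq_one : ∀ r, 0 ≤ r → r ≤ 1 → χ r = 1
  eq_zero : ∀ r, 4 ≤ r → χ r = 0

end ViscousHJ

end

noncomputable section

namespace ViscousHJ

/-! The equation is solved as a Volterra equation `v = A v₀ - K F(v)` in `C([0,a]; H¹_m)`, where `A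
v₀` is the linear orbit and `K` is convolution with the semigroup. The nonlinearity `|∇v|^q`, `q =
q⋆`, does not map `H¹_m` into itself, so the semigroup has to regain what is lost. The natural
intermediate space is `L^{2/q}` for the weighted measure.

Nonlinearity: `g ↦ |g|^q` is `C¹` from `L²` to `L^{2/q}` for `1 < q ≤ 2`
(`exists_hasFDerivAt_normPowLp`). The pointwise Taylor remainder is at most `2q|h|^q`, and the norm
of `|h|^q` in `L^{2/q}` is exactly `‖h‖^q`. The derivative has size `‖g‖^{q-1}`, so cutting off at
radius `2ϱ` gives a global Lipschitz constant of order `ϱ^{q-1}` and keeps the map `C¹`, with value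
and derivative zero at the origin (`exists_truncation_bound`).

Semigroup: after a change of variables, `e^{t𝓛} f(ξ) = e^{tN/2} ∫ G(z) f(b(ξ - c z)) dz` with a
fixed Gaussian `G`, `b = e^{t/2}` and `c = (1 - e^{-t})^{1/2}` (`expL_eq_rescaledConv`). Gaussian
decay absorbs the weight, and Young's inequality with `1/p = 1/2 + s` costs `c^{-Ns}`. Taking a
gradient by differentiating `G` costs another `c^{-1}`. Thus `e^{t𝓛} : L^p → H¹_m` has norm
`O(t^{-(Ns+1)/2})` for small `t` (`exists_smoothing`). For `p = 2/q⋆` this exponent is below `1`, so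
the singularity is integrable.

Abstract part: with an integrable kernel, the weight `e^{-lτ}` with `l` large makes `K F` a
`1/2`-Lipschitz map on all of `[0,a]`, so identity plus `K F` is a homeomorphism with `C¹` inverse
(`exists_volterra_solution`). This gives existence, uniqueness and a `C¹` Lipschitz solution map in
one stroke. Since `φ₁ - e^𝓛` is minus the Duhamel integral at time one, it carries a factor `Lip(F)
= O(ϱ^{q-1})`, and it vanishes to first order at `0` because `F` does (`exists_semiflow`). As `ϱ <
1`, all these Lipschitz constants lie below one bound, so a single `l` serves every `ϱ` and the
final constant does not depend on `ϱ`. -/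

/-- The superposition operator `f ↦ F ∘ f` on continuous functions. -/
def superpose {K X Y : Type*} [TopologicalSpace K] [TopologicalSpace X] [TopologicalSpace Y]
    (F : C(X, Y)) : C(K, X) → C(K, Y) := fun f => F.comp f

@[simp]
theorem superpose_apply {K X Y : Type*} [TopologicalSpace K] [TopologicalSpace X]
    [TopologicalSpace Y] (F : C(X, Y)) (f : C(K, X)) (k : K) : superpose F f k = F (f k) := rfl

theorem lipschitzWith_superpose {K X Y : Type*} [TopologicalSpace K] [CompactSpace K]
    [PseudoMetricSpace X] [PseudoMetricSpace Y] (F : C(X, Y)) {L : ℝ≥0} (hF : LipschitzWith L F) :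
    LipschitzWith L (superpose F : C(K, X) → C(K, Y)) := by
  refine LipschitzWith.of_dist_le_mul fun f g => ?_
  rw [ContinuousMap.dist_le (by positivity)]
  intro k
  exact (hF.dist_le_mul _ _).trans (by gcongr; exact ContinuousMap.dist_apply_le_dist k)

/-! ### Inversion near the identity and superposition operators on `C(K, X)` -/

section Superposition

variable {K X Y Z : Type*} [TopologicalSpace K] [CompactSpace K]
  [NormedAddCommGroup X] [NormedSpace ℝ X] [NormedAddCommGroup Y] [NormedSpace ℝ Y]
  [NormedAddCommGroup Z] [NormedSpace ℝ Z]

/-- A Lipschitz perturbation of the identity with constant `1/2` is a homeomorphism with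
`2`-Lipschitz inverse, and the inverse is `C¹` if the perturbation is. -/
theorem exists_homeomorph_id_add [CompleteSpace Z] {P : Z → Z}
    (hP : LipschitzWith (1 / 2) P) :
    ∃ Φ : Z ≃ₜ Z, (∀ z, Φ z = z + P z) ∧ LipschitzWith 2 Φ.symm ∧
      (ContDiff ℝ 1 P → ContDiff ℝ 1 Φ.symm) := by
  have happ : ApproximatesLinearOn (fun z => z + P z)
      ((ContinuousLinearEquiv.refl ℝ Z : Z ≃L[ℝ] Z) : Z →L[ℝ] Z) univ (1 / 2) := by
    rw [ApproximatesLinearOn.approximatesLinearOn_iff_lipschitzOnWith]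
    convert hP.lipschitzOnWith (s := univ) using 1
    ext z
    simp
  -- In a trivial space the identity has norm `0`, and the inverse of `0` in `ℝ≥0` is `0`, so that
  -- case has to be split off.
  have hc : Subsingleton Z ∨ (1 / 2 : ℝ≥0) <
      ‖((ContinuousLinearEquiv.refl ℝ Z).symm : Z →L[ℝ] Z)‖₊⁻¹ := by
    rcases subsingleton_or_nontrivial Z with h | h
    · exact Or.inl h
    · right
      have : ‖((ContinuousLinearEquiv.refl ℝ Z).symm : Z →L[ℝ] Z)‖₊ = 1 := by
        apply NNReal.eq
        simp
      rw [this, inv_one]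
      exact NNReal.half_lt_self one_ne_zero
  let Φ : Z ≃ₜ Z := happ.toHomeomorph _ hc
  have hΦ : ∀ z, Φ z = z + P z := fun z => rfl
  refine ⟨Φ, hΦ, ?_, ?_⟩
  · refine LipschitzWith.of_dist_le_mul fun a b => ?_
    obtain ⟨x, rfl⟩ := Φ.surjective a
    obtain ⟨y, rfl⟩ := Φ.surjective b
    rw [Homeomorph.symm_apply_apply, Homeomorph.symm_apply_apply, hΦ, hΦ, dist_eq_norm,
      dist_eq_norm]
    have h1 := hP.dist_le_mul x y
    rw [dist_eq_norm, dist_eq_norm] at h1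
    have h2 : ‖x - y‖ ≤ ‖x + P x - (y + P y)‖ + ‖P x - P y‖ := by
      have : x - y = (x + P x - (y + P y)) - (P x - P y) := by abel
      calc ‖x - y‖ = _ := by rw [this]
        _ ≤ _ := norm_sub_le _ _
    push_cast at h1 ⊢
    linarith
  · intro hC
    -- The derivative of a `1/2`-Lipschitz map has norm at most `1/2`, so `1 + DP = 1 - (-DP)` is
    -- invertible by the Neumann series.
    have hd : ∀ a, ‖fderiv ℝ P a‖ < 1 := fun a =>
      (norm_fderiv_le_of_lipschitz ℝ hP).trans_lt (by norm_num)
    let U : Z → Z ≃L[ℝ] Z := fun a =>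
      ContinuousLinearEquiv.unitsEquiv ℝ Z (Units.oneSub (-(fderiv ℝ P a)) (by
        rw [norm_neg]; exact hd a))
    refine Homeomorph.contDiff_symm Φ (f₀' := U) (fun a => ?_) ?_
    · have h := (hasFDerivAt_id a).add ((hC.differentiable (by simp) a).hasFDerivAt)
      refine h.congr_fderiv ?_
      ext z
      simp [U]
    · exact contDiff_id.add hC

/-- Pointwise application of a continuous family of operators, as a bounded bilinear map. -/
def pointwiseApply : C(K, X →L[ℝ] Y) →L[ℝ] C(K, X) →L[ℝ] C(K, Y) :=
  LinearMap.mkContinuous₂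
    (LinearMap.mk₂ ℝ (fun (A : C(K, X →L[ℝ] Y)) (f : C(K, X)) =>
        (⟨fun k => A k (f k), A.continuous.clm_apply f.continuous⟩ : C(K, Y)))
      (fun _ _ _ => by ext; simp) (fun _ _ _ => by ext; simp)
      (fun _ _ _ => by ext; simp) (fun _ _ _ => by ext; simp)) 1 (by
    intro A f
    rw [one_mul, ContinuousMap.norm_le _ (by positivity)]
    intro k
    exact ((A k).le_opNorm _).trans
      (by gcongr; exacts [A.norm_coe_le_norm k, f.norm_coe_le_norm k]))

@[simp]
theorem pointwiseApply_apply (A : C(K, X →L[ℝ] Y)) (f : C(K, X)) (k : K) :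
    pointwiseApply A f k = A k (f k) := rfl

/-- `F'` need not be uniformly continuous on `X`, but `g ↦ F' ∘ g` is continuous for the sup norm
because `K` is compact. This gives one `δ` valid at every point `f k`, and the mean value inequality
on the balls of radius `δ` bounds the remainder uniformly in `k`. -/
theorem hasFDerivAt_superpose (F : C(X, Y)) (F' : C(X, X →L[ℝ] Y))
    (hF : ∀ x, HasFDerivAt F (F' x) x) (f : C(K, X)) :
    HasFDerivAt (superpose F : C(K, X) → C(K, Y)) (pointwiseApply (F'.comp f)) f := by
  rw [hasFDerivAt_iff_isLittleO_nhds_zero, Asymptotics.isLittleO_iff]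
  intro ε hε
  have hcont : Continuous fun g : C(K, X) => F'.comp g := ContinuousMap.continuous_postcomp F'
  obtain ⟨δ, hδ, H⟩ := Metric.continuous_iff (f := fun g : C(K, X) => F'.comp g).1 hcont f ε hε
  filter_upwards [Metric.ball_mem_nhds (0 : C(K, X)) hδ] with h hh
  rw [mem_ball_zero_iff] at hh
  rw [ContinuousMap.norm_le _ (by positivity)]
  intro k
  have hb : ∀ x ∈ Metric.ball (f k) δ, ‖F' x - F' (f k)‖ ≤ ε := by
    intro x hx
    -- Shifting `f` by a constant produces a function within `δ` of `f` that takes the value `x` at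
    -- `k`; this turns closeness of functions into closeness of points.
    have h1 : dist (f + ContinuousMap.const K (x - f k)) f < δ := by
      rw [dist_eq_norm, add_sub_cancel_left]
      refine lt_of_le_of_lt ((ContinuousMap.norm_le _ (norm_nonneg (x - f k))).2 fun _ => le_rfl) ?_
      rwa [← dist_eq_norm]
    have h2 := (ContinuousMap.dist_apply_le_dist k).trans_lt (H _ h1)
    simp only [ContinuousMap.comp_apply, ContinuousMap.add_apply, ContinuousMap.const_apply,
      add_sub_cancel] at h2
    rw [dist_eq_norm] at h2
    exact h2.le
  have hk : ‖h k‖ ≤ ‖h‖ := h.norm_coe_le_norm k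
  have hmv := (convex_ball (f k) δ).norm_image_sub_le_of_norm_hasFDerivWithin_le'
    (f := F) (f' := F') (φ := F' (f k)) (fun x _ => (hF x).hasFDerivWithinAt) hb
    (Metric.mem_ball_self hδ) (y := f k + h k) (by
      rw [Metric.mem_ball, dist_eq_norm, add_sub_cancel_left]; exact hk.trans_lt hh)
  simp only [add_sub_cancel_left] at hmv
  simp only [ContinuousMap.sub_apply, superpose_apply, ContinuousMap.add_apply,
    pointwiseApply_apply, ContinuousMap.comp_apply]
  exact hmv.trans (by gcongr)

theorem contDiff_superpose (F : C(X, Y)) (hF : ContDiff ℝ 1 F) :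
    ContDiff ℝ 1 (superpose F : C(K, X) → C(K, Y)) := by
  obtain ⟨F', hc, hd⟩ := contDiff_one_iff_hasFDerivAt.1 hF
  refine contDiff_one_iff_hasFDerivAt.2 ⟨
    fun f => pointwiseApply ((⟨F', hc⟩ : C(X, X →L[ℝ] Y)).comp f), ?_,
    hasFDerivAt_superpose F ⟨F', hc⟩ hd⟩
  exact pointwiseApply.continuous.comp (ContinuousMap.continuous_postcomp _)

end Superposition

/-! ### Volterra operators with an integrable singularity at time zero -/

section Volterra

variable {X Y : Type*} [NormedAddCommGroup X] [NormedSpace ℝ X] [NormedAddCommGroup Y]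
  [NormedSpace ℝ Y]

/-- A strongly continuous family of bounded operators on `(0, a]` whose norms are dominated by an
integrable function that is continuous on `(0, a]`. -/
structure IsSingularKernel (T : ℝ → Y →L[ℝ] X) (a : ℝ) (β : ℝ → ℝ) : Prop where
  cont : ∀ y, ContinuousOn (fun t => T t y) (Ioc 0 a)
  bound : ∀ t ∈ Ioc 0 a, ‖T t‖ ≤ β t
  contBound : ContinuousOn β (Ioc 0 a)
  integrable : IntegrableOn β (Ioc 0 a)

variable {T : ℝ → Y →L[ℝ] X} {a : ℝ} {β : ℝ → ℝ}

theorem IsSingularKernel.nonneg (hT : IsSingularKernel T a β) {t : ℝ} (ht : t ∈ Ioc 0 a) :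
    0 ≤ β t := (norm_nonneg _).trans (hT.bound t ht)

theorem IsSingularKernel.integral_nonneg (hT : IsSingularKernel T a β) :
    0 ≤ ∫ t in Ioc 0 a, β t :=
  setIntegral_nonneg measurableSet_Ioc fun _ ht => hT.nonneg ht

/-- Strong continuity handles a fixed vector; the moving vector is handled by the local boundedness
of `‖T s‖`, which is why `β` is required to be continuous away from `0`. -/
theorem IsSingularKernel.continuousOn_apply (hT : IsSingularKernel T a β) {h : ℝ → Y}
    (hh : Continuous h) : ContinuousOn (fun s => T s (h s)) (Ioc 0 a) := by
  intro s₀ hs₀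
  have h1 : Filter.Tendsto (fun s => β s * ‖h s - h s₀‖ + ‖T s (h s₀) - T s₀ (h s₀)‖)
      (nhdsWithin s₀ (Ioc 0 a)) (nhds 0) := by
    have e1 : Filter.Tendsto (fun s => ‖h s - h s₀‖) (nhdsWithin s₀ (Ioc 0 a)) (nhds 0) := by
      have : ContinuousWithinAt (fun s => ‖h s - h s₀‖) (Ioc 0 a) s₀ :=
        Continuous.continuousWithinAt (by fun_prop)
      simpa [ContinuousWithinAt] using this
    have e2 := (((hT.cont (h s₀)) s₀ hs₀).tendsto.sub_const (T s₀ (h s₀))).norm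
    simpa using ((hT.contBound s₀ hs₀).tendsto.mul e1).add e2
  refine tendsto_iff_norm_sub_tendsto_zero.2 (squeeze_zero' (.of_forall fun _ => norm_nonneg _)
    ?_ h1)
  filter_upwards [self_mem_nhdsWithin] with s hs
  have : T s (h s) - T s₀ (h s₀) = T s (h s - h s₀) + (T s (h s₀) - T s₀ (h s₀)) := by
    rw [map_sub]; abel
  rw [this]
  refine (norm_add_le _ _).trans ?_
  gcongr
  exact ((T s).le_opNorm _).trans (by gcongr; exact hT.bound s hs)

theorem IsSingularKernel.integrableOn_apply (hT : IsSingularKernel T a β) {h : ℝ → Y}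
    (hh : Continuous h) {B : ℝ} (hB : ∀ s, ‖h s‖ ≤ B) {τ : ℝ} (hτ : τ ≤ a) :
    IntegrableOn (fun s => T s (h s)) (Ioc 0 τ) := by
  have hsub : Ioc 0 τ ⊆ Ioc 0 a := Ioc_subset_Ioc_right hτ
  refine ((hT.integrable.mono_set hsub).mul_const B).mono'
    (((hT.continuousOn_apply hh).mono hsub).aestronglyMeasurable measurableSet_Ioc) ?_
  filter_upwards [ae_restrict_mem measurableSet_Ioc] with s hs
  have h0 := hT.nonneg (hsub hs)
  exact ((T s).le_opNorm _).trans (by gcongr; exacts [hT.bound s (hsub hs), hB s])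

/-- The convolution `τ ↦ ∫₀^τ T(τ - s) h(s) ds`. -/
def volterra (T : ℝ → Y →L[ℝ] X) (h : ℝ → Y) (τ : ℝ) : X := ∫ s in (0 : ℝ)..τ, T (τ - s) (h s)

/-- Moves the singularity from the moving endpoint `s = τ` to the fixed point `s = 0`, where the
same `β` dominates for all `τ`. -/
theorem volterra_eq_comp_sub (T : ℝ → Y →L[ℝ] X) (h : ℝ → Y) (τ : ℝ) :
    volterra T h τ = ∫ s in (0 : ℝ)..τ, T s (h (τ - s)) := by
  have := intervalIntegral.integral_comp_sub_left (a := 0) (b := τ)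
    (fun s => T s (h (τ - s))) τ
  simpa [volterra] using this

theorem IsSingularKernel.intervalIntegrable (hT : IsSingularKernel T a β) {h : ℝ → Y}
    (hh : Continuous h) {B : ℝ} (hB : ∀ s, ‖h s‖ ≤ B) {τ : ℝ} (hτ : τ ∈ Icc 0 a) :
    IntervalIntegrable (fun s => T (τ - s) (h s)) volume 0 τ := by
  have h1 : IntervalIntegrable (fun s => T s (h (τ - s))) volume 0 τ := by
    rw [intervalIntegrable_iff_integrableOn_Ioc_of_le hτ.1]
    exact hT.integrableOn_apply (h := fun s => h (τ - s)) (by fun_prop) (fun s => hB _) hτ.2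
  have := (h1.comp_sub_left τ).symm
  simpa using this

theorem IsSingularKernel.norm_volterra_le (hT : IsSingularKernel T a β) {h : ℝ → Y}
    {B : ℝ} (hB : ∀ s, ‖h s‖ ≤ B) {τ : ℝ} (hτ : τ ∈ Icc 0 a) :
    ‖volterra T h τ‖ ≤ (∫ t in Ioc 0 a, β t) * B := by
  have hB0 : 0 ≤ B := (norm_nonneg _).trans (hB 0)
  have hsub : Ioc 0 τ ⊆ Ioc 0 a := Ioc_subset_Ioc_right hτ.2
  rw [volterra_eq_comp_sub, intervalIntegral.integral_of_le hτ.1]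
  calc ‖∫ s in Ioc 0 τ, T s (h (τ - s))‖ ≤ ∫ s in Ioc 0 τ, β s * B := by
        refine norm_integral_le_of_norm_le ((hT.integrable.mono_set hsub).mul_const B) ?_
        filter_upwards [ae_restrict_mem measurableSet_Ioc] with s hs
        have h0 := hT.nonneg (hsub hs)
        exact ((T s).le_opNorm _).trans (by gcongr; exacts [hT.bound s (hsub hs), hB _])
    _ ≤ ∫ s in Ioc 0 a, β s * B := by
        refine setIntegral_mono_set (hT.integrable.mul_const B) ?_ hsub.eventuallyLE
        filter_upwards [ae_restrict_mem measurableSet_Ioc] with s hs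
        exact mul_nonneg (hT.nonneg hs) hB0
    _ = _ := integral_mul_const _ _

/-- With the singularity at `s = 0` and the upper limit replaced by a cut-off `s < τ`, dominated
convergence applies with bound `β B`. For each `s ≠ τ₀` the integrand is continuous in `τ` at `τ₀`:
there `T s` is a fixed operator and only `h` moves. -/
theorem IsSingularKernel.continuousOn_volterra (hT : IsSingularKernel T a β) {h : ℝ → Y}
    (hh : Continuous h) {B : ℝ} (hB : ∀ s, ‖h s‖ ≤ B) :
    ContinuousOn (volterra T h) (Icc 0 a) := by
  let G : ℝ → ℝ → X := fun τ s => if s < τ then T s (h (τ - s)) else 0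
  have hG : ∀ τ ∈ Icc 0 a, volterra T h τ = ∫ s in Ioc 0 a, G τ s := by
    intro τ hτ
    rw [volterra_eq_comp_sub, intervalIntegral.integral_of_le hτ.1, integral_Ioc_eq_integral_Ioo]
    have : ∀ s, G τ s = (Iio τ).indicator (fun s => T s (h (τ - s))) s := fun s => by
      simp [G, indicator_apply]
    simp_rw [this]
    rw [setIntegral_indicator measurableSet_Iio]
    congr 2
    ext s
    simp only [mem_Ioo, mem_inter_iff, mem_Ioc, mem_Iio]
    exact ⟨fun h => ⟨⟨h.1, h.2.le.trans hτ.2⟩, h.2⟩, fun h => ⟨h.1.1, h.2⟩⟩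
  refine ContinuousOn.congr (f := fun τ => ∫ s in Ioc 0 a, G τ s) ?_ hG
  refine Continuous.continuousOn (continuous_iff_continuousAt.2 fun τ₀ => ?_)
  refine continuousAt_of_dominated (bound := fun s => β s * B) ?_ ?_ (hT.integrable.mul_const B) ?_
  · refine .of_forall fun τ => ?_
    have : G τ = (Iio τ).indicator (fun s => T s (h (τ - s))) := by
      ext s; simp [G, indicator_apply]
    rw [this]
    exact ((hT.continuousOn_apply (h := fun s => h (τ - s)) (by fun_prop)).aestronglyMeasurable
      measurableSet_Ioc).indicator measurableSet_Iio
  · refine .of_forall fun τ => ?_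
    filter_upwards [ae_restrict_mem measurableSet_Ioc] with s hs
    have h0 := hT.nonneg hs
    have hB0 : 0 ≤ B := (norm_nonneg _).trans (hB 0)
    by_cases hlt : s < τ
    · simp only [G, if_pos hlt]
      exact ((T s).le_opNorm _).trans (by gcongr; exacts [hT.bound s hs, hB _])
    · simp only [G, if_neg hlt, norm_zero]
      positivity
  · have : ∀ᵐ s ∂(volume.restrict (Ioc 0 a)), s ≠ τ₀ :=
      ae_restrict_of_ae (by simp [ae_iff])
    filter_upwards [this] with s hs
    rcases lt_or_gt_of_ne hs with hlt | hgt
    · have : (fun τ => T s (h (τ - s))) =ᶠ[nhds τ₀] fun τ => G τ s := by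
        filter_upwards [lt_mem_nhds hlt] with τ hτ
        simp [G, hτ]
      refine ContinuousAt.congr ?_ this
      exact Continuous.continuousAt (by fun_prop)
    · have : (fun _ => 0) =ᶠ[nhds τ₀] fun τ => G τ s := by
        filter_upwards [gt_mem_nhds hgt] with τ hτ
        simp [G, not_lt.2 hτ.le]
      exact continuousAt_const.congr this

/-- The Volterra operator on `C([0, a])` with a singular kernel. -/
def volterraOp (hT : IsSingularKernel T a β) (ha : 0 ≤ a) : C(Icc 0 a, Y) →L[ℝ] C(Icc 0 a, X) :=
  LinearMap.mkContinuous
    { toFun := fun f => ⟨fun τ => volterra T (IccExtend ha f) τ,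
        (hT.continuousOn_volterra (f.continuous.Icc_extend' (h := ha)) (B := ‖f‖)
          (fun s => f.norm_coe_le_norm _)).domRestrict⟩
      map_add' := fun f g => by
        ext τ
        simp only [ContinuousMap.coe_mk, ContinuousMap.add_apply, volterra]
        rw [← intervalIntegral.integral_add
          (hT.intervalIntegrable (f.continuous.Icc_extend' (h := ha)) (B := ‖f‖)
            (fun s => f.norm_coe_le_norm _) τ.2)
          (hT.intervalIntegrable (g.continuous.Icc_extend' (h := ha)) (B := ‖g‖)
            (fun s => g.norm_coe_le_norm _) τ.2)]
        simp [IccExtend]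
      map_smul' := fun c f => by
        ext τ
        simp only [ContinuousMap.coe_mk, ContinuousMap.smul_apply, volterra, RingHom.id_apply]
        rw [← intervalIntegral.integral_smul]
        simp [IccExtend] }
    (∫ t in Ioc 0 a, β t) (fun f => by
      rw [ContinuousMap.norm_le _ (mul_nonneg hT.integral_nonneg (norm_nonneg _))]
      intro τ
      exact hT.norm_volterra_le (fun s => f.norm_coe_le_norm _) τ.2)

theorem volterraOp_apply (hT : IsSingularKernel T a β) (ha : 0 ≤ a) (f : C(Icc 0 a, Y))
    (τ : Icc 0 a) : volterraOp hT ha f τ = volterra T (IccExtend ha f) τ := rfl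

theorem norm_volterraOp_le (hT : IsSingularKernel T a β) (ha : 0 ≤ a) :
    ‖volterraOp hT ha‖ ≤ ∫ t in Ioc 0 a, β t :=
  LinearMap.mkContinuous_norm_le _ hT.integral_nonneg _

theorem IsSingularKernel.exp_smul (hT : IsSingularKernel T a β) (l : ℝ) :
    IsSingularKernel (fun t => Real.exp (-l * t) • T t) a (fun t => Real.exp (-l * t) * β t) where
  cont y := by
    have h : Continuous fun t : ℝ => Real.exp (-l * t) := by fun_prop
    exact h.continuousOn.smul (hT.cont y)
  bound t ht := by
    rw [norm_smul, Real.norm_eq_abs, Real.abs_exp]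
    gcongr
    exact hT.bound t ht
  contBound := by
    have h : Continuous fun t : ℝ => Real.exp (-l * t) := by fun_prop
    exact h.continuousOn.mul hT.contBound
  integrable := by
    have h : Continuous fun t : ℝ => Real.exp (-l * t) := by fun_prop
    have hi : IntegrableOn (fun t : ℝ => β t) (Ioc 0 a) := hT.integrable
    refine Integrable.bdd_mul (c := Real.exp (|l| * |a|)) hi h.aestronglyMeasurable ?_
    filter_upwards [ae_restrict_mem measurableSet_Ioc] with t ht
    rw [Real.norm_eq_abs, Real.abs_exp, Real.exp_le_exp]
    calc -l * t ≤ |-l * t| := le_abs_self _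
      _ = |l| * |t| := by rw [abs_mul, abs_neg]
      _ ≤ |l| * |a| := by
        refine mul_le_mul_of_nonneg_left ?_ (abs_nonneg l)
        rw [abs_of_pos ht.1]
        exact ht.2.trans (le_abs_self a)

/-- The smallness that drives the contraction: a large exponential weight makes the Volterra
operator small on the whole of `[0, a]`, so no splitting into short time intervals is needed. -/
theorem IsSingularKernel.tendsto_integral_exp_mul (hT : IsSingularKernel T a β) :
    Filter.Tendsto (fun n : ℕ => ∫ t in Ioc 0 a, Real.exp (-(n : ℝ) * t) * β t)
      Filter.atTop (nhds 0) := by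
  have : Filter.Tendsto (fun n : ℕ => ∫ t in Ioc 0 a, Real.exp (-(n : ℝ) * t) * β t)
      Filter.atTop (nhds (∫ t in Ioc 0 a, (0 : ℝ))) := by
    refine tendsto_integral_of_dominated_convergence β (fun n => (hT.exp_smul n).integrable.1)
      hT.integrable (fun n => ?_) ?_
    · filter_upwards [ae_restrict_mem measurableSet_Ioc] with t ht
      have h0 := hT.nonneg ht
      rw [Real.norm_eq_abs, abs_mul, Real.abs_exp, abs_of_nonneg h0]
      refine mul_le_of_le_one_left h0 (Real.exp_le_one_iff.2 ?_)
      have := mul_nonneg (Nat.cast_nonneg (α := ℝ) n) ht.1.le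
      linarith
    · filter_upwards [ae_restrict_mem measurableSet_Ioc] with t ht
      have : Filter.Tendsto (fun n : ℕ => Real.exp (-(n : ℝ) * t)) Filter.atTop (nhds 0) := by
        refine Real.tendsto_exp_atBot.comp ?_
        simp_rw [neg_mul]
        exact Filter.tendsto_neg_atTop_atBot.comp
          (tendsto_natCast_atTop_atTop.atTop_mul_const ht.1)
      simpa using this.mul_const (β t)
  simpa using this

end Volterra

/-! ### Abstract mild solutions: well-posedness and the time-one map -/

section MildSolutions

variable {X Y : Type*} [NormedAddCommGroup X] [NormedSpace ℝ X] [NormedAddCommGroup Y]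
  [NormedSpace ℝ Y] {T : ℝ → Y →L[ℝ] X} {a : ℝ} {β : ℝ → ℝ}

/-- Multiplication by `e^{lτ}` on `C([0, a])`. -/
def expMul (X : Type*) [NormedAddCommGroup X] [NormedSpace ℝ X] (a l : ℝ) :
    C(Icc 0 a, X) →L[ℝ] C(Icc 0 a, X) :=
  pointwiseApply ⟨fun τ => Real.exp (l * τ) • ContinuousLinearMap.id ℝ X, by fun_prop⟩

@[simp]
theorem expMul_apply (l : ℝ) (f : C(Icc 0 a, X)) (τ : Icc 0 a) :
    expMul X a l f τ = Real.exp (l * τ) • f τ := rfl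

theorem expMul_neg_expMul (l : ℝ) (f : C(Icc 0 a, X)) : expMul X a (-l) (expMul X a l f) = f := by
  ext τ
  simp [smul_smul, ← Real.exp_add]

theorem expMul_expMul_neg (l : ℝ) (f : C(Icc 0 a, X)) : expMul X a l (expMul X a (-l) f) = f := by
  ext τ
  simp [smul_smul, ← Real.exp_add]

/-- `e^{-lτ} = e^{-l(τ-s)} e^{-ls}`: the weight splits between the kernel and the argument, so
conjugation keeps the Volterra form and only damps the kernel. -/
theorem expMul_volterraOp (hT : IsSingularKernel T a β) (ha : 0 ≤ a) (l : ℝ) (f : C(Icc 0 a, Y)) :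
    expMul X a (-l) (volterraOp hT ha f) = volterraOp (hT.exp_smul l) ha (expMul Y a (-l) f) := by
  ext τ
  rw [expMul_apply, volterraOp_apply, volterraOp_apply, volterra, volterra,
    ← intervalIntegral.integral_smul]
  refine intervalIntegral.integral_congr fun s hs => ?_
  rw [uIcc_of_le τ.2.1] at hs
  have hs' : s ∈ Icc 0 a := ⟨hs.1, hs.2.trans τ.2.2⟩
  simp only [IccExtend_of_mem ha _ hs', expMul_apply, FunLike.coe_smul, Pi.smul_apply,
    map_smul, smul_smul, ← Real.exp_add]
  congr 2
  ring

/-- A strongly continuous bounded family of operators, as an operator into `C([0, a])`. -/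
def orbitMap (S : ℝ → X →L[ℝ] X) (hc : ∀ x, ContinuousOn (fun t => S t x) (Icc 0 a)) {M : ℝ}
    (hM : 0 ≤ M) (hS : ∀ t ∈ Icc 0 a, ‖S t‖ ≤ M) : X →L[ℝ] C(Icc 0 a, X) :=
  LinearMap.mkContinuous
    { toFun := fun x => ⟨fun τ => S τ x, (hc x).domRestrict⟩
      map_add' := fun x y => by ext τ; exact map_add (S τ) x y
      map_smul' := fun c x => by ext τ; exact map_smul (S τ) c x } M (fun x => by
    rw [ContinuousMap.norm_le _ (by positivity)]
    intro τ
    exact ((S τ).le_opNorm x).trans (by gcongr; exact hS τ τ.2))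

/-- Unique solvability of `v = A v₀ - K F(v)` in `C([0, a])`, with `K` a singular Volterra operator,
and regularity of the solution map. The Lipschitz constant of the solution map is uniform for
nonlinearities with Lipschitz constant at most `L₀`. -/
theorem exists_volterra_solution [CompleteSpace X] (hT : IsSingularKernel T a β) (ha : 0 ≤ a)
    (A : X →L[ℝ] C(Icc 0 a, X)) (L₀ : ℝ≥0) :
    ∃ C : ℝ≥0, ∀ (F : C(X, Y)) (L : ℝ≥0), L ≤ L₀ → LipschitzWith L F →
      ∃ sol : X → C(Icc 0 a, X),
        (∀ x, sol x = A x - volterraOp hT ha (superpose F (sol x))) ∧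
        (∀ x u, u = A x - volterraOp hT ha (superpose F u) → u = sol x) ∧
        LipschitzWith C sol ∧ (ContDiff ℝ 1 F → ContDiff ℝ 1 sol) := by
  -- The weight is chosen from `L₀` alone, so that it serves all nonlinearities at once. The `+ 1`
  -- keeps the threshold meaningful when `L₀ = 0`.
  obtain ⟨n, hn⟩ : ∃ n : ℕ, ∫ t in Ioc 0 a, Real.exp (-(n : ℝ) * t) * β t < 1 / (2 * (L₀ + 1)) :=
    (hT.tendsto_integral_exp_mul.eventually (gt_mem_nhds (by positivity))).exists
  set l : ℝ := (n : ℝ)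
  set Kl := volterraOp (hT.exp_smul l) ha
  have hKl : ‖Kl‖ * L₀ ≤ 1 / 2 := by
    have h1 : ‖Kl‖ ≤ 1 / (2 * (L₀ + 1)) := (norm_volterraOp_le (hT.exp_smul l) ha).trans hn.le
    calc ‖Kl‖ * L₀ ≤ 1 / (2 * (L₀ + 1)) * (L₀ + 1) := by gcongr; linarith
      _ = 1 / 2 := by field_simp
  -- The solution is `e^{lτ} Φ⁻¹(e^{-lτ} A x)` with `Φ⁻¹` being `2`-Lipschitz; none of these factors
  -- depends on `F` beyond `L₀`.
  refine ⟨‖expMul X a l‖₊ * (2 * ‖(expMul X a (-l)).comp A‖₊), fun F L hL hF => ?_⟩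
  -- The nonlinearity in the unknown `e^{-lτ} v`. The two exponentials cancel pointwise, so its
  -- Lipschitz constant is still `L`.
  let Ft : C(Icc 0 a, X) → C(Icc 0 a, Y) := fun u =>
    expMul Y a (-l) (superpose F (expMul X a l u))
  have hFt : LipschitzWith L Ft := by
    refine LipschitzWith.of_dist_le_mul fun u w => ?_
    rw [ContinuousMap.dist_le (by positivity)]
    intro τ
    simp only [Ft, expMul_apply, superpose_apply, dist_eq_norm, ← smul_sub, norm_smul,
      Real.norm_eq_abs, Real.abs_exp]
    have h1 := hF.norm_sub_le (Real.exp (l * τ) • u τ) (Real.exp (l * τ) • w τ)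
    rw [← smul_sub, norm_smul, Real.norm_eq_abs, Real.abs_exp] at h1
    have h2 : ‖u τ - w τ‖ ≤ ‖u - w‖ := (u - w).norm_coe_le_norm τ
    calc Real.exp (-l * τ) * ‖F (Real.exp (l * τ) • u τ) - F (Real.exp (l * τ) • w τ)‖
        ≤ Real.exp (-l * τ) * (L * (Real.exp (l * τ) * ‖u τ - w τ‖)) := by gcongr
      _ = (Real.exp (-l * τ) * Real.exp (l * τ)) * (L * ‖u τ - w τ‖) := by ring
      _ = L * ‖u τ - w τ‖ := by rw [← Real.exp_add]; simp
      _ ≤ L * ‖u - w‖ := by gcongr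
  have hP : LipschitzWith (1 / 2) fun u => Kl (Ft u) := by
    refine (Kl.lipschitz.comp hFt).weaken ?_
    rw [← NNReal.coe_le_coe]
    push_cast
    exact le_trans (by gcongr) hKl
  obtain ⟨Φ, hΦ, hΦL, hΦC⟩ := exists_homeomorph_id_add hP
  have key : ∀ x u, u = A x - volterraOp hT ha (superpose F u) ↔
      Φ (expMul X a (-l) u) = expMul X a (-l) (A x) := by
    intro x u
    rw [hΦ]
    simp only [Ft, expMul_expMul_neg]
    rw [← expMul_volterraOp, ← map_add]
    constructor
    · intro h
      congr 1
      rw [eq_sub_iff_add_eq] at h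
      exact h
    · intro h
      have := congrArg (expMul X a l) h
      rw [expMul_expMul_neg, expMul_expMul_neg] at this
      exact eq_sub_of_add_eq this
  refine ⟨fun x => expMul X a l (Φ.symm (((expMul X a (-l)).comp A) x)), ?_, ?_, ?_, ?_⟩
  · intro x
    rw [key, expMul_neg_expMul, Homeomorph.apply_symm_apply]
    rfl
  · intro x u h
    rw [key] at h
    simp only [ContinuousLinearMap.comp_apply]
    rw [← h, Homeomorph.symm_apply_apply, expMul_expMul_neg]
  · exact (expMul X a l).lipschitz.comp (hΦL.comp ((expMul X a (-l)).comp A).lipschitz)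
  · intro hFC
    have h1 : ContDiff ℝ 1 fun u => Kl (Ft u) :=
      Kl.contDiff.comp ((expMul Y a (-l)).contDiff.comp
        ((contDiff_superpose F hFC).comp (expMul X a l).contDiff))
    exact (expMul X a l).contDiff.comp
      ((hΦC h1).comp ((expMul X a (-l)).comp A).contDiff)

/-- `v` is a mild solution on `[0, a]`. -/
structure IsMildSolution (S : ℝ → X →L[ℝ] X) (T : ℝ → Y →L[ℝ] X) (F : X → Y) (a : ℝ) (x : X)
    (v : ℝ → X) : Prop where
  continuousOn : ContinuousOn v (Icc 0 a)
  eq : ∀ τ ∈ Icc 0 a, v τ = S τ x - volterra T (fun s => F (v s)) τ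

theorem IsMildSolution.mono {S : ℝ → X →L[ℝ] X} {F : X → Y} {b : ℝ} {x : X} {v : ℝ → X}
    (h : IsMildSolution S T F b x v) (hab : a ≤ b) : IsMildSolution S T F a x v :=
  ⟨h.continuousOn.mono (Icc_subset_Icc_right hab), fun τ hτ => h.eq τ ⟨hτ.1, hτ.2.trans hab⟩⟩

theorem volterra_congr {h h' : ℝ → Y} {τ : ℝ} (hτ : 0 ≤ τ) (hh : ∀ s ∈ Icc 0 τ, h s = h' s) :
    volterra T h τ = volterra T h' τ := by
  refine intervalIntegral.integral_congr fun s hs => ?_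
  rw [uIcc_of_le hτ] at hs
  simp only [hh s hs]

theorem isMildSolution_iff (S : ℝ → X →L[ℝ] X) (hT : IsSingularKernel T a β) (ha : 0 ≤ a)
    (hc : ∀ x, ContinuousOn (fun t => S t x) (Icc 0 a)) {M : ℝ}
    (hM : 0 ≤ M) (hS : ∀ t ∈ Icc 0 a, ‖S t‖ ≤ M) (F : C(X, Y)) (x : X) (u : C(Icc 0 a, X))
    {v : ℝ → X} (hv : ∀ τ : Icc 0 a, v τ = u τ) :
    IsMildSolution S T F a x v ↔
      u = orbitMap S hc hM hS x - volterraOp hT ha (superpose F u) := by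
  have h1 : ∀ τ : Icc 0 a, volterra T (fun s => F (v s)) τ =
      volterraOp hT ha (superpose F u) τ := by
    intro τ
    rw [volterraOp_apply]
    refine volterra_congr τ.2.1 fun s hs => ?_
    have hs' : s ∈ Icc 0 a := ⟨hs.1, hs.2.trans τ.2.2⟩
    rw [IccExtend_of_mem ha _ hs', superpose_apply, ← hv]
  constructor
  · intro h
    ext τ
    rw [← hv, h.eq τ τ.2, h1]
    rfl
  · intro h
    refine ⟨?_, fun τ hτ => ?_⟩
    · rw [continuousOn_iff_continuous_domRestrict]
      have : (Icc 0 a).domRestrict v = u := funext hv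
      rw [this]
      exact u.continuous
    · have h2 := h1 ⟨τ, hτ⟩
      simp only at h2
      rw [h2, hv ⟨τ, hτ⟩]
      exact DFunLike.congr_fun h _

/-- Global well-posedness of `v(τ) = S(τ) x - ∫₀^τ T(τ - s) F(v(s)) ds` for globally Lipschitz `F`
of class `C¹` with `F(0) = 0`, `DF(0) = 0`, and regularity of the time-one map. -/
theorem exists_semiflow [CompleteSpace X] {S : ℝ → X →L[ℝ] X} {M : ℝ → ℝ} {β : ℝ → ℝ → ℝ}
    (hc : ∀ x, ContinuousOn (fun t => S t x) (Ici 0))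
    (hS : ∀ a, 0 < a → ∀ t ∈ Icc 0 a, ‖S t‖ ≤ M a)
    (hT : ∀ a, 0 < a → IsSingularKernel T a (β a)) (L₀ : ℝ≥0) :
    ∃ C : ℝ≥0, ∀ (F : X → Y) (L : ℝ≥0), L ≤ L₀ → LipschitzWith L F → ContDiff ℝ 1 F → F 0 = 0 →
      fderiv ℝ F 0 = 0 → ∃ φ : ℝ → X → X,
        (∀ x a, 0 < a → IsMildSolution S T F a x (fun τ => φ τ x)) ∧
        (∀ x a v, 0 < a → IsMildSolution S T F a x v → ∀ τ ∈ Icc 0 a, v τ = φ τ x) ∧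
        ContDiff ℝ 1 (fun x => φ 1 x - S 1 x) ∧ φ 1 0 - S 1 0 = 0 ∧
        fderiv ℝ (fun x => φ 1 x - S 1 x) 0 = 0 ∧
        LipschitzWith (C * L) (fun x => φ 1 x - S 1 x) := by
  have hcI : ∀ a x, ContinuousOn (fun t => S t x) (Icc 0 a) := fun a x =>
    (hc x).mono Icc_subset_Ici_self
  have hM : ∀ a, 0 < a → 0 ≤ M a := fun a ha =>
    (norm_nonneg _).trans (hS a ha a ⟨ha.le, le_rfl⟩)
  let A : ∀ a : ℝ, 0 < a → X →L[ℝ] C(Icc 0 a, X) := fun a ha =>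
    orbitMap S (hcI a) (hM a ha) (hS a ha)
  choose C hC using fun (a : ℝ) (ha : 0 < a) =>
    exists_volterra_solution (hT a ha) ha.le (A a ha) L₀
  let K₁ := volterraOp (hT 1 one_pos) zero_le_one
  -- The time-one remainder is minus evaluation after `K₁`, after `F`, after the solution map; only
  -- the middle factor depends on `F`, through `L`.
  refine ⟨‖K₁‖₊ * C 1 one_pos, fun F L hL hF hFC hF0 hF0' => ?_⟩
  let Fc : C(X, Y) := ⟨F, hF.continuous⟩
  choose sol hsol huniq hLip hsmooth using fun (a : ℝ) (ha : 0 < a) => hC a ha Fc L hL hF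
  let w : ∀ a : ℝ, 0 < a → X → ℝ → X := fun a ha x => IccExtend ha.le (sol a ha x)
  have hw : ∀ a ha x, ∀ τ : Icc 0 a, w a ha x τ = sol a ha x τ := fun a ha x τ => by
    simp [w]
  have hwm : ∀ a ha x, IsMildSolution S T F a x (w a ha x) := fun a ha x =>
    (isMildSolution_iff S (hT a ha) ha.le (hcI a) (hM a ha) (hS a ha) Fc x _ (hw a ha x)).2
      (hsol a ha x)
  have hun : ∀ a ha x v, IsMildSolution S T F a x v → ∀ τ ∈ Icc 0 a, v τ = w a ha x τ := by
    intro a ha x v hv τ hτ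
    let u : C(Icc 0 a, X) := ⟨fun τ => v τ, hv.continuousOn.domRestrict⟩
    have h := (isMildSolution_iff S (hT a ha) ha.le (hcI a) (hM a ha) (hS a ha) Fc x u
      (fun _ => rfl)).1 hv
    have h2 := DFunLike.congr_fun (huniq a ha x u h) ⟨τ, hτ⟩
    have h3 := hw a ha x ⟨τ, hτ⟩
    simp only at h3
    rw [h3, ← h2]
    rfl
  -- The value at `τ` of the solution on `[0, max τ 1]`, an interval of positive length containing
  -- `τ`. By uniqueness, any other interval `[0, a]` containing `τ` gives the same value.
  let φ : ℝ → X → X := fun τ x => w (max τ 1) (by positivity) x τ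
  have hφ : ∀ a ha x, ∀ τ ∈ Icc 0 a, w a ha x τ = φ τ x := by
    intro a ha x τ hτ
    rcases le_total a (max τ 1) with h | h
    · exact (hun a ha x _ ((hwm (max τ 1) (by positivity) x).mono h) τ hτ).symm
    · exact hun (max τ 1) (by positivity) x _ ((hwm a ha x).mono h) τ ⟨hτ.1, le_max_left _ _⟩
  have hφm : ∀ x a, 0 < a → IsMildSolution S T F a x (fun τ => φ τ x) := by
    intro x a ha
    refine ⟨(hwm a ha x).continuousOn.congr fun τ hτ => (hφ a ha x τ hτ).symm, fun τ hτ => ?_⟩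
    rw [← hφ a ha x τ hτ, (hwm a ha x).eq τ hτ]
    congr 1
    refine volterra_congr hτ.1 fun s hs => ?_
    rw [hφ a ha x s ⟨hs.1, hs.2.trans hτ.2⟩]
  let ev : C(Icc (0 : ℝ) 1, X) →L[ℝ] X := ContinuousMap.evalCLM ℝ ⟨1, by simp⟩
  have h1 : (1 : ℝ) ∈ Icc (0 : ℝ) 1 := by simp
  have hR1 : (fun x => φ 1 x - S 1 x) = fun x => ev (sol 1 one_pos x) - S 1 x := by
    ext x
    rw [← hφ 1 one_pos x 1 h1]
    exact congrArg (· - S 1 x) (hw 1 one_pos x ⟨1, h1⟩)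
  -- Once the linear part is removed only the Duhamel integral remains. This form shows the factor
  -- `Lip(F)` and the vanishing at `0`, while `hR1` gives the `C¹` regularity.
  have hR2 : (fun x => φ 1 x - S 1 x) =
      fun x => -(ev (K₁ (superpose Fc (sol 1 one_pos x)))) := by
    rw [hR1]
    ext x
    rw [sub_eq_iff_eq_add]
    conv_lhs => rw [hsol 1 one_pos x]
    rw [map_sub, sub_eq_neg_add]
    rfl
  have hs0 : sol 1 one_pos 0 = 0 := by
    refine (huniq 1 one_pos 0 0 ?_).symm
    have : superpose Fc (0 : C(Icc (0 : ℝ) 1, X)) = 0 := by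
      ext τ
      exact hF0
    rw [this, map_zero, map_zero, sub_zero]
  have hsp0 : superpose Fc (0 : C(Icc (0 : ℝ) 1, X)) = 0 := by
    ext τ
    exact hF0
  refine ⟨φ, hφm, ?_, ?_, ?_, ?_, ?_⟩
  · intro x a v ha hv τ hτ
    rw [hun a ha x v hv τ hτ, hφ a ha x τ hτ]
  · rw [hR1]
    exact (ev.contDiff.comp (hsmooth 1 one_pos hFC)).sub (S 1).contDiff
  · have := congrFun hR2 0
    simp only [hs0, hsp0, map_zero, neg_zero] at this
    simpa using this
  · rw [hR2]
    obtain ⟨F', hF'c, hF'⟩ := contDiff_one_iff_hasFDerivAt.1 hFC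
    have hz : F' 0 = 0 := by rw [← hF0', (hF' 0).fderiv]
    -- The zero initial datum has the zero solution, where superposition has derivative zero because
    -- `DF(0) = 0`; the chain rule then kills the derivative of the remainder.
    have hsup : HasFDerivAt (superpose Fc) (0 : C(Icc (0 : ℝ) 1, X) →L[ℝ] C(Icc (0 : ℝ) 1, Y))
        (sol 1 one_pos 0) := by
      refine (hasFDerivAt_superpose Fc ⟨F', hF'c⟩ hF' _).congr_fderiv ?_
      ext u τ
      simp [hs0, hz]
    have hd := (((hsmooth 1 one_pos hFC).differentiable (by simp)) 0).hasFDerivAt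
    have h3 := ((ev.comp K₁).hasFDerivAt.comp (0 : X) (hsup.comp (0 : X) hd)).neg
    refine HasFDerivAt.fderiv (h3.congr_fderiv ?_)
    simp
  · rw [hR2]
    have hev : ‖ev‖₊ ≤ 1 := by
      rw [← NNReal.coe_le_coe]
      exact ContinuousLinearMap.opNorm_le_bound _ zero_le_one fun f => by
        rw [NNReal.coe_one, one_mul]
        exact f.norm_coe_le_norm _
    have := (ev.lipschitz.comp (K₁.lipschitz.comp
      ((lipschitzWith_superpose (K := Icc (0 : ℝ) 1) Fc hF).comp (hLip 1 one_pos)))).neg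
    refine this.weaken ?_
    calc ‖ev‖₊ * (‖K₁‖₊ * (L * C 1 one_pos)) ≤ 1 * (‖K₁‖₊ * (L * C 1 one_pos)) := by gcongr
      _ = _ := by ring

end MildSolutions

/-! ### Pointwise estimates for `|x|^q` and its gradient -/

section NormPow

variable {V : Type*} [NormedAddCommGroup V] [InnerProductSpace ℝ V]

theorem norm_rpow_smul_self {s : ℝ} (hs : 0 < s) (x : V) : ‖‖x‖ ^ (s - 1) • x‖ = ‖x‖ ^ s := by
  rcases eq_or_ne x 0 with rfl | hx
  · simp [Real.zero_rpow hs.ne']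
  · have hx' : 0 < ‖x‖ := norm_pos_iff.2 hx
    rw [norm_smul, Real.norm_of_nonneg (by positivity), Real.rpow_sub_one hx'.ne']
    field_simp

/-- The map `x ↦ |x|^{s-1} x` is Hölder continuous with exponent `s ∈ (0, 1]`. -/
theorem norm_rpow_smul_sub_le {s : ℝ} (hs : 0 < s) (hs1 : s ≤ 1) (x y : V) :
    ‖‖x‖ ^ (s - 1) • x - ‖y‖ ^ (s - 1) • y‖ ≤ 2 * ‖x - y‖ ^ s := by
  wlog hxy : ‖y‖ ≤ ‖x‖ generalizing x y
  · rw [norm_sub_rev, norm_sub_rev x y]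
    exact this y x (le_of_not_ge hxy)
  -- If `|x - y|` is at least the larger norm, the triangle inequality suffices. Otherwise the
  -- difference splits into two terms, each at most `|x|^{s-1} |x - y| ≤ |x - y|^s` since `s - 1 ≤
  -- 0`.
  rcases le_or_gt ‖x‖ ‖x - y‖ with h | h
  · calc ‖‖x‖ ^ (s - 1) • x - ‖y‖ ^ (s - 1) • y‖ ≤ ‖x‖ ^ s + ‖y‖ ^ s := by
          refine (norm_sub_le _ _).trans_eq ?_
          rw [norm_rpow_smul_self hs, norm_rpow_smul_self hs]
      _ ≤ ‖x - y‖ ^ s + ‖x - y‖ ^ s := by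
          gcongr
          exact hxy.trans h
      _ = _ := by ring
  · have hy : y ≠ 0 := by rintro rfl; simp at h
    have hy0 : 0 < ‖y‖ := norm_pos_iff.2 hy
    have hx0 : 0 < ‖x‖ := hy0.trans_le hxy
    have e : ‖x‖ ^ (s - 1) • x - ‖y‖ ^ (s - 1) • y =
        ‖x‖ ^ (s - 1) • (x - y) - (‖y‖ ^ (s - 1) - ‖x‖ ^ (s - 1)) • y := by
      rw [smul_sub, sub_smul]; abel
    have hmono : ‖x‖ ^ (s - 1) ≤ ‖y‖ ^ (s - 1) :=
      Real.rpow_le_rpow_of_nonpos hy0 hxy (by linarith)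
    have h2 : (‖y‖ ^ (s - 1) - ‖x‖ ^ (s - 1)) * ‖y‖ ≤ ‖x‖ ^ (s - 1) * ‖x - y‖ := by
      have h3 : ‖y‖ ^ s ≤ ‖x‖ ^ s := by gcongr
      have h4 : ‖y‖ ^ (s - 1) * ‖y‖ = ‖y‖ ^ s := by
        rw [Real.rpow_sub_one hy0.ne']; field_simp
      have h5 : ‖x‖ ^ (s - 1) * ‖x‖ = ‖x‖ ^ s := by
        rw [Real.rpow_sub_one hx0.ne']; field_simp
      have h6 : ‖x‖ - ‖y‖ ≤ ‖x - y‖ := norm_sub_norm_le x y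
      have h7 : ‖x‖ ^ (s - 1) * (‖x‖ - ‖y‖) ≤ ‖x‖ ^ (s - 1) * ‖x - y‖ := by gcongr
      nlinarith
    have h8 : ‖x‖ ^ (s - 1) * ‖x - y‖ ≤ ‖x - y‖ ^ s := by
      rcases (norm_nonneg (x - y)).eq_or_lt with h0 | h0
      · rw [← h0, Real.zero_rpow hs.ne', mul_zero]
      · calc ‖x‖ ^ (s - 1) * ‖x - y‖ ≤ ‖x - y‖ ^ (s - 1) * ‖x - y‖ := by
              exact mul_le_mul_of_nonneg_right
                (Real.rpow_le_rpow_of_nonpos h0 h.le (by linarith)) h0.le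
          _ = _ := by rw [Real.rpow_sub_one h0.ne']; field_simp
    rw [e]
    refine (norm_sub_le _ _).trans ?_
    rw [norm_smul, norm_smul, Real.norm_of_nonneg (by positivity),
      Real.norm_of_nonneg (sub_nonneg.2 hmono)]
    linarith

/-- The gradient of `|x|^q`. -/
def gradNormPow (q : ℝ) (x : V) : V := q • ‖x‖ ^ (q - 1 - 1) • x

theorem norm_gradNormPow_sub_le {q : ℝ} (hq : 1 < q) (hq2 : q ≤ 2) (x y : V) :
    ‖gradNormPow q x - gradNormPow q y‖ ≤ 2 * q * ‖x - y‖ ^ (q - 1) := by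
  rw [gradNormPow, gradNormPow, ← smul_sub, norm_smul, Real.norm_of_nonneg (by linarith)]
  calc q * ‖‖x‖ ^ (q - 1 - 1) • x - ‖y‖ ^ (q - 1 - 1) • y‖ ≤ q * (2 * ‖x - y‖ ^ (q - 1)) := by
        gcongr
        exact norm_rpow_smul_sub_le (by linarith) (by linarith) x y
    _ = _ := by ring

theorem hasFDerivAt_normPow {q : ℝ} (hq : 1 < q) (x : V) :
    HasFDerivAt (fun x : V => ‖x‖ ^ q) (innerSL ℝ (gradNormPow q x)) x := by
  refine (hasFDerivAt_norm_rpow x hq).congr_fderiv ?_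
  rw [gradNormPow, map_smul, map_smul, smul_smul]
  congr 3
  ring

/-- The gradient varies by at most `2q|h|^{q-1}` on the ball of radius `|h|` about `x`; the mean
value inequality supplies the last factor `|h|`. The bound holds for every `h`, not only small ones,
so it can be integrated over functions `h ∈ L²`. -/
theorem norm_normPow_taylor_le {q : ℝ} (hq : 1 < q) (hq2 : q ≤ 2) (x h : V) :
    ‖‖x + h‖ ^ q - ‖x‖ ^ q - inner ℝ (gradNormPow q x) h‖ ≤ 2 * q * ‖h‖ ^ q := by
  have hb : ∀ y ∈ Metric.closedBall x ‖h‖,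
      ‖innerSL ℝ (gradNormPow q y) - innerSL ℝ (gradNormPow q x)‖ ≤ 2 * q * ‖h‖ ^ (q - 1) := by
    intro y hy
    rw [← map_sub, innerSL_apply_norm]
    refine (norm_gradNormPow_sub_le hq hq2 y x).trans ?_
    rw [Metric.mem_closedBall, dist_eq_norm] at hy
    have : 0 < q := by linarith
    gcongr
  have := (convex_closedBall x ‖h‖).norm_image_sub_le_of_norm_hasFDerivWithin_le'
    (f := fun x : V => ‖x‖ ^ q) (fun y _ => (hasFDerivAt_normPow hq y).hasFDerivWithinAt) hb
    (Metric.mem_closedBall_self (norm_nonneg h)) (y := x + h) (by simp)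
  simp only [add_sub_cancel_left, innerSL_apply_apply] at this
  refine this.trans_eq ?_
  rcases (norm_nonneg h).eq_or_lt with h0 | h0
  · rw [← h0, Real.zero_rpow (show q ≠ 0 by linarith), mul_zero, mul_zero]
  · rw [Real.rpow_sub_one h0.ne']; field_simp

end NormPow

/-! ### The Nemytskii operator `g ↦ |g|^q` from `L²` to `L^{2/q}` -/

section Nemytskii

variable {α V W : Type*} [MeasurableSpace α] {μ : Measure α} [NormedAddCommGroup V]
  [NormedAddCommGroup W]

theorem eLpNorm_norm_rpow_two {s : ℝ} (hs : 0 < s) (f : α → V) :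
    eLpNorm (fun x => ‖f x‖ ^ s) (ENNReal.ofReal (2 / s)) μ = eLpNorm f 2 μ ^ s := by
  rw [eLpNorm_norm_rpow f hs, ← ENNReal.ofReal_mul (by positivity), div_mul_cancel₀ _ hs.ne']
  norm_num

theorem memLp_of_norm_le_rpow {s c : ℝ} (hs : 0 < s) {f : α → W} {g : α → V}
    (hf : AEStronglyMeasurable f μ) (hg : MemLp g 2 μ) (h : ∀ x, ‖f x‖ ≤ c * ‖g x‖ ^ s) :
    MemLp f (ENNReal.ofReal (2 / s)) μ := by
  refine ⟨hf, lt_of_le_of_lt (eLpNorm_le_mul_eLpNorm_of_ae_le_mul (c := c)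
    (g := fun x => ‖g x‖ ^ s) (.of_forall fun x => ?_) _) ?_⟩
  · rw [Real.norm_of_nonneg (by positivity)]
    exact h x
  · rw [eLpNorm_norm_rpow_two hs]
    exact ENNReal.mul_lt_top ENNReal.ofReal_lt_top (ENNReal.rpow_lt_top_of_nonneg hs.le hg.2.ne)

/-- Turns pointwise Hölder bounds into bounds between Lebesgue norms without loss, since taking
`s`-th powers carries `L²` to `L^{2/s}` with norm exactly the `s`-th power. It serves `s = q` for
the Taylor remainder and `s = q - 1` for the gradient. -/
theorem norm_le_mul_rpow {s c : ℝ} (hs : 0 < s) (hc : 0 ≤ c)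
    {f : Lp W (ENNReal.ofReal (2 / s)) μ} {g : Lp V 2 μ}
    (h : ∀ᵐ x ∂μ, ‖f x‖ ≤ c * ‖g x‖ ^ s) : ‖f‖ ≤ c * ‖g‖ ^ s := by
  have h1 := eLpNorm_le_mul_eLpNorm_of_ae_le_mul (c := c) (f := f) (g := fun x => ‖g x‖ ^ s)
    (h.mono fun x hx => by rwa [Real.norm_of_nonneg (by positivity)])
    (ENNReal.ofReal (2 / s))
  rw [eLpNorm_norm_rpow_two hs] at h1
  rw [Lp.norm_def, Lp.norm_def, ENNReal.toReal_rpow]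
  refine (ENNReal.toReal_mono ?_ h1).trans_eq ?_
  · exact (ENNReal.mul_lt_top ENNReal.ofReal_lt_top
      (ENNReal.rpow_lt_top_of_nonneg hs.le (Lp.eLpNorm_ne_top g))).ne
  · rw [ENNReal.toReal_mul, ENNReal.toReal_ofReal hc]

theorem memLp_normPow {q : ℝ} (hq : 0 < q) {g : α → V} (hg : MemLp g 2 μ) :
    MemLp (fun x => ‖g x‖ ^ q) (ENNReal.ofReal (2 / q)) μ :=
  memLp_of_norm_le_rpow hq
    ((Real.continuous_rpow_const hq.le).comp_aestronglyMeasurable hg.1.norm) hg (c := 1)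
    (fun x => by rw [one_mul, Real.norm_of_nonneg (by positivity)])

/-- The Nemytskii operator `g ↦ |g|^q` from `L²` to `L^{2/q}`. -/
def normPowLp {q : ℝ} (hq : 0 < q) (g : Lp V 2 μ) : Lp ℝ (ENNReal.ofReal (2 / q)) μ :=
  (memLp_normPow hq (Lp.memLp g)).toLp

theorem coeFn_normPowLp {q : ℝ} (hq : 0 < q) (g : Lp V 2 μ) :
    normPowLp hq g =ᵐ[μ] fun x => ‖g x‖ ^ q := MemLp.coeFn_toLp _

theorem norm_normPowLp_le {q : ℝ} (hq : 0 < q) (g : Lp V 2 μ) : ‖normPowLp hq g‖ ≤ ‖g‖ ^ q := by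
  have := norm_le_mul_rpow hq zero_le_one (f := normPowLp hq g) (g := g)
    ((coeFn_normPowLp hq g).mono fun x hx => by
      rw [hx, one_mul, Real.norm_of_nonneg (by positivity)])
  simpa using this

variable [InnerProductSpace ℝ V]

theorem norm_gradNormPow {q : ℝ} (hq : 1 < q) (x : V) :
    ‖gradNormPow q x‖ = q * ‖x‖ ^ (q - 1) := by
  rw [gradNormPow, norm_smul, norm_rpow_smul_self (by linarith), Real.norm_of_nonneg (by linarith)]

theorem continuous_gradNormPow {q : ℝ} (hq : 1 < q) (hq2 : q ≤ 2) :
    Continuous (gradNormPow q : V → V) := by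
  refine continuous_iff_continuousAt.2 fun y => ?_
  refine tendsto_iff_norm_sub_tendsto_zero.2 (squeeze_zero (fun _ => norm_nonneg _)
    (fun x => norm_gradNormPow_sub_le hq hq2 x y) ?_)
  have h : ContinuousAt (fun x : V => 2 * q * ‖x - y‖ ^ (q - 1)) y := by
    have h1 : Continuous fun x : V => ‖x - y‖ ^ (q - 1) :=
      (Real.continuous_rpow_const (by linarith)).comp (by fun_prop)
    exact (continuous_const.mul h1).continuousAt
  have h2 := h.tendsto
  simpa [Real.zero_rpow (show q - 1 ≠ 0 by linarith)] using h2

theorem memLp_gradNormPow {q : ℝ} (hq : 1 < q) (hq2 : q ≤ 2) {g : α → V} (hg : MemLp g 2 μ) :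
    MemLp (fun x => gradNormPow q (g x)) (ENNReal.ofReal (2 / (q - 1))) μ :=
  memLp_of_norm_le_rpow (by linarith)
    ((continuous_gradNormPow hq hq2).comp_aestronglyMeasurable hg.1) hg
    (fun x => (norm_gradNormPow hq (g x)).le)

/-- The Nemytskii operator `|g|^q` is `C¹` from `L²` to `L^{2/q}`, `1 < q ≤ 2`, and its derivative
at `g` is bounded by `2 q ‖g‖^{q-1}`. -/
theorem exists_hasFDerivAt_normPowLp {q : ℝ} (hq : 1 < q) (hq2 : q ≤ 2)
    [Fact (1 ≤ ENNReal.ofReal (2 / q))] :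
    ∃ D : Lp V 2 μ → Lp V 2 μ →L[ℝ] Lp ℝ (ENNReal.ofReal (2 / q)) μ, Continuous D ∧
      (∀ g, HasFDerivAt (normPowLp (by linarith)) (D g) g) ∧
      ∀ g, ‖D g‖ ≤ 2 * q * ‖g‖ ^ (q - 1) := by
  have hq0 : 0 < q := by linarith
  have hq1 : 0 < q - 1 := by linarith
  have : Fact (1 ≤ ENNReal.ofReal (2 / (q - 1))) := ⟨by
    rw [ENNReal.one_le_ofReal, le_div_iff₀ hq1]; linarith⟩
  -- `(q - 1)/2 + 1/2 = q/2`: the gradient, of size `|g|^{q-1}`, lies in `L^{2/(q-1)}` and pairs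
  -- with `h ∈ L²` into `L^{2/q}`.
  have : ENNReal.HolderTriple (ENNReal.ofReal (2 / (q - 1))) 2 (ENNReal.ofReal (2 / q)) := ⟨by
    rw [← ENNReal.ofReal_inv_of_pos (by positivity), ← ENNReal.ofReal_inv_of_pos (by positivity),
      show (2 : ℝ≥0∞) = ENNReal.ofReal 2 by norm_num, ← ENNReal.ofReal_inv_of_pos (by positivity),
      ← ENNReal.ofReal_add (by positivity) (by positivity)]
    congr 1
    field_simp
    ring⟩
  let G : Lp V 2 μ → Lp V (ENNReal.ofReal (2 / (q - 1))) μ := fun g =>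
    (memLp_gradNormPow hq hq2 (Lp.memLp g)).toLp
  have hG : ∀ g, G g =ᵐ[μ] fun x => gradNormPow q (g x) := fun g => MemLp.coeFn_toLp _
  have hGsub : ∀ g g', ‖G g - G g'‖ ≤ 2 * q * ‖g - g'‖ ^ (q - 1) := by
    intro g g'
    refine norm_le_mul_rpow hq1 (by positivity) ?_
    filter_upwards [Lp.coeFn_sub (G g) (G g'), Lp.coeFn_sub g g', hG g, hG g'] with x h1 h2 h3 h4
    rw [h1, h2, Pi.sub_apply, Pi.sub_apply, h3, h4]
    exact norm_gradNormPow_sub_le hq hq2 _ _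
  have hG0 : G 0 = 0 := by
    refine Lp.ext ?_
    filter_upwards [hG 0, Lp.coeFn_zero V 2 μ,
      Lp.coeFn_zero V (ENNReal.ofReal (2 / (q - 1))) μ] with x h1 h2 h3
    rw [h1, h2, h3]
    simp [gradNormPow]
  have hGcont : Continuous G := by
    refine continuous_iff_continuousAt.2 fun g => ?_
    refine tendsto_iff_norm_sub_tendsto_zero.2 (squeeze_zero (fun _ => norm_nonneg _)
      (fun x => hGsub x g) ?_)
    have h1 : Continuous fun x : Lp V 2 μ => 2 * q * ‖x - g‖ ^ (q - 1) :=
      continuous_const.mul ((Real.continuous_rpow_const hq1.le).comp (by fun_prop))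
    have h2 := h1.tendsto g
    simpa [Real.zero_rpow hq1.ne'] using h2
  let B := (innerSL ℝ : V →L[ℝ] V →L[ℝ] ℝ).holderL μ (ENNReal.ofReal (2 / (q - 1))) 2
    (ENNReal.ofReal (2 / q))
  refine ⟨fun g => B (G g), B.continuous.comp hGcont, fun g => ?_, fun g => ?_⟩
  · rw [hasFDerivAt_iff_isLittleO_nhds_zero]
    -- The pointwise Taylor bound integrates to `2q‖h‖^q`, which is `o(‖h‖)` because `q > 1`.
    have hbd : ∀ h, ‖normPowLp hq0 (g + h) - normPowLp hq0 g - B (G g) h‖ ≤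
        2 * q * ‖h‖ ^ q := by
      intro h
      refine norm_le_mul_rpow hq0 (by positivity) ?_
      filter_upwards [Lp.coeFn_sub (normPowLp hq0 (g + h) - normPowLp hq0 g) (B (G g) h),
        Lp.coeFn_sub (normPowLp hq0 (g + h)) (normPowLp hq0 g), coeFn_normPowLp hq0 (g + h),
        coeFn_normPowLp hq0 g, Lp.coeFn_add g h, hG g,
        (innerSL ℝ : V →L[ℝ] V →L[ℝ] ℝ).coeFn_holder (r := ENNReal.ofReal (2 / q)) (G g) h]
        with x h1 h2 h3 h4 h5 h6 h7
      have h8 : B (G g) h x = innerSL ℝ (G g x) (h x) := h7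
      rw [h1, Pi.sub_apply, h2, Pi.sub_apply, h3, h4, h5, Pi.add_apply, h8, h6, innerSL_apply_apply]
      exact norm_normPow_taylor_le hq hq2 _ _
    refine (Asymptotics.isBigO_of_le' (c := 2 * q) _ (g := fun h : Lp V 2 μ => ‖h‖ ^ q)
      fun h => ?_).trans_isLittleO ?_
    · rw [Real.norm_of_nonneg (r := ‖h‖ ^ q) (by positivity)]
      exact hbd h
    · have h1 : (fun x : Lp V 2 μ => ‖x‖ ^ q) = fun x : Lp V 2 μ => ‖x‖ ^ (q - 1) * ‖x‖ := by
        ext x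
        rcases (norm_nonneg x).eq_or_lt with h0 | h0
        · rw [← h0, Real.zero_rpow hq0.ne', mul_zero]
        · rw [Real.rpow_sub_one h0.ne']; field_simp
      rw [h1]
      have h2 : Filter.Tendsto (fun x : Lp V 2 μ => ‖x‖ ^ (q - 1)) (nhds 0) (nhds 0) := by
        have h1 : Continuous fun x : Lp V 2 μ => ‖x‖ ^ (q - 1) :=
          (Real.continuous_rpow_const hq1.le).comp continuous_norm
        simpa [Real.zero_rpow hq1.ne'] using h1.tendsto 0
      have h3 := ((Asymptotics.isLittleO_one_iff ℝ).2 h2).mul_isBigO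
        (Asymptotics.isBigO_refl (fun x : Lp V 2 μ => ‖x‖) (nhds 0))
      exact h3.norm_right.congr_right (by simp) |>.of_norm_right
  · refine ContinuousLinearMap.opNorm_le_bound _ (by positivity) fun h => ?_
    have h1 := (innerSL ℝ : V →L[ℝ] V →L[ℝ] ℝ).norm_holder_apply_apply_le
      (r := ENNReal.ofReal (2 / q)) (G g) h
    have h2 := hGsub g 0
    rw [hG0, sub_zero, sub_zero] at h2
    calc ‖B (G g) h‖ ≤ ‖(innerSL ℝ : V →L[ℝ] V →L[ℝ] ℝ)‖ * ‖G g‖ * ‖h‖ := h1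
      _ ≤ 1 * (2 * q * ‖g‖ ^ (q - 1)) * ‖h‖ := by
        gcongr
        exact norm_innerSL_le ℝ
      _ = _ := by rw [one_mul]

end Nemytskii

/-! ### Truncation of the nonlinearity near the origin -/

section Truncation

/-- `χ` is only controlled on `[0, ∞)`. Freezing the argument at `0` on the left costs no
smoothness, because the result is constantly `1` for `r < 1`. -/
theorem IsCutoff.contDiff_comp_max {χ : ℝ → ℝ} (hχ : IsCutoff χ) :
    ContDiff ℝ 1 fun r => χ (max r 0) := by
  refine contDiff_iff_contDiffAt.2 fun r => ?_
  rcases lt_or_ge r 1 with h | h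
  · refine (contDiffAt_const (c := (1 : ℝ))).congr_of_eventuallyEq ?_
    filter_upwards [gt_mem_nhds h] with x hx
    exact hχ.eq_one _ (le_max_right _ _) (max_le hx.le zero_le_one)
  · have h0 : 0 < r := by linarith
    have h1 : ContDiffAt ℝ 1 χ r :=
      ((hχ.smooth r h0.le).contDiffAt (Ici_mem_nhds h0)).of_le (by exact_mod_cast le_top)
    refine h1.congr_of_eventuallyEq ?_
    filter_upwards [lt_mem_nhds h0] with x hx
    rw [max_eq_left hx.le]

/-- Clear for `r > 4`; the endpoint `r = 4` follows from continuity of the derivative, as its zero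
set is closed. -/
theorem IsCutoff.deriv_eq_zero_of_four_le {χ : ℝ → ℝ} (hχ : IsCutoff χ) {r : ℝ} (hr : 4 ≤ r) :
    deriv (fun r => χ (max r 0)) r = 0 := by
  have hc : Continuous (deriv fun r => χ (max r 0)) := hχ.contDiff_comp_max.continuous_deriv le_rfl
  have hclosed : IsClosed {r : ℝ | deriv (fun r => χ (max r 0)) r = 0} :=
    isClosed_eq hc continuous_const
  have hsub : Ioi (4 : ℝ) ⊆ {r : ℝ | deriv (fun r => χ (max r 0)) r = 0} := by
    intro r hr
    have : (fun r => χ (max r 0)) =ᶠ[nhds r] fun _ => 0 := by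
      filter_upwards [lt_mem_nhds (show (4 : ℝ) < r from hr)] with x hx
      exact hχ.eq_zero _ (hx.le.trans (le_max_left _ _))
    simp [this.deriv_eq]
  have := closure_minimal hsub hclosed
  rw [closure_Ioi] at this
  exact this hr

theorem IsCutoff.exists_deriv_bound {χ : ℝ → ℝ} (hχ : IsCutoff χ) :
    ∃ B : ℝ, 0 ≤ B ∧ ∀ r, 0 ≤ r → |deriv (fun r => χ (max r 0)) r| ≤ B := by
  have hc : Continuous (deriv fun r => χ (max r 0)) := hχ.contDiff_comp_max.continuous_deriv le_rfl
  obtain ⟨B, hB⟩ := (isCompact_Icc (a := (0 : ℝ)) (b := 4)).exists_bound_of_continuousOn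
    hc.continuousOn
  refine ⟨max B 0, le_max_right _ _, fun r hr => ?_⟩
  rcases le_total r 4 with h | h
  · exact (hB r ⟨hr, h⟩).trans (le_max_left _ _)
  · rw [hχ.deriv_eq_zero_of_four_le h, abs_zero]
    exact le_max_right _ _

variable {X Y : Type*} [NormedAddCommGroup X] [InnerProductSpace ℝ X] [NormedAddCommGroup Y]
  [NormedSpace ℝ Y]

/-- Truncation of a `C¹` map `G` with `|G(v)| ≤ |v|^q`, `|DG(v)| ≤ c |v|^{q-1}` to a ball of radius
comparable to `ϱ`: the result is `C¹`, vanishes to first order at `0`, and is globally Lipschitz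
with constant of order `ϱ^{q-1}`. -/
theorem exists_truncation_bound {χ : ℝ → ℝ} (hχ : IsCutoff χ) {q c : ℝ} (hq : 1 < q) (hc : 0 ≤ c)
    {G : X → Y} {D : X → X →L[ℝ] Y} (hDc : Continuous D) (hD : ∀ v, HasFDerivAt G (D v) v)
    (hDb : ∀ v, ‖D v‖ ≤ c * ‖v‖ ^ (q - 1)) (hGb : ∀ v, ‖G v‖ ≤ ‖v‖ ^ q) :
    ∃ C : ℝ, 0 < C ∧ ∀ ϱ : ℝ, 0 < ϱ →
      ContDiff ℝ 1 (fun v => χ (‖v‖ ^ 2 / ϱ ^ 2) • G v) ∧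
      χ (‖(0 : X)‖ ^ 2 / ϱ ^ 2) • G 0 = 0 ∧
      fderiv ℝ (fun v => χ (‖v‖ ^ 2 / ϱ ^ 2) • G v) 0 = 0 ∧
      LipschitzWith (C * ϱ ^ (q - 1)).toNNReal (fun v => χ (‖v‖ ^ 2 / ϱ ^ 2) • G v) := by
  obtain ⟨B, hB0, hB⟩ := hχ.exists_deriv_bound
  have hq0 : 0 < q := by linarith
  have hq1 : 0 < q - 1 := by linarith
  -- On `‖v‖ ≤ 2ϱ` the term with `DG` gives `c (2ϱ)^{q-1}`, and the derivative of the cut-off gives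
  -- `B · 2‖v‖ϱ⁻² · ‖v‖^q ≤ 8B (2ϱ)^{q-1}`. The `+ 1` only ensures positivity.
  refine ⟨(c + 8 * B + 1) * 2 ^ (q - 1), by positivity, fun ϱ hϱ => ?_⟩
  set χt : ℝ → ℝ := fun r => χ (max r 0) with hχt
  have hG : ContDiff ℝ 1 G := contDiff_one_iff_hasFDerivAt.2 ⟨D, hDc, hD⟩
  have heq : (fun v : X => χ (‖v‖ ^ 2 / ϱ ^ 2) • G v) =
      fun v : X => χt (‖v‖ ^ 2 / ϱ ^ 2) • G v := by
    ext v
    simp only [hχt]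
    rw [max_eq_left (by positivity)]
  have hG0 : G 0 = 0 := by
    have := hGb 0
    rw [norm_zero, Real.zero_rpow hq0.ne'] at this
    simpa using this
  have hD0 : D 0 = 0 := by
    have := hDb 0
    rw [norm_zero, Real.zero_rpow hq1.ne', mul_zero] at this
    simpa using this
  have hCD : ContDiff ℝ 1 fun v : X => χt (‖v‖ ^ 2 / ϱ ^ 2) • G v :=
    (hχ.contDiff_comp_max.comp ((contDiff_norm_sq ℝ).div_const _)).smul hG
  have hder : ∀ v : X, HasFDerivAt (fun v : X => χt (‖v‖ ^ 2 / ϱ ^ 2) • G v)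
      (χt (‖v‖ ^ 2 / ϱ ^ 2) • D v + (deriv χt (‖v‖ ^ 2 / ϱ ^ 2) •
        ((ϱ ^ 2)⁻¹ • (2 : ℝ) • innerSL ℝ v)).smulRight (G v)) v := by
    intro v
    have h1 : HasFDerivAt (fun v : X => ‖v‖ ^ 2 / ϱ ^ 2)
        ((ϱ ^ 2)⁻¹ • (2 : ℝ) • innerSL ℝ v) v := by
      simp_rw [div_eq_inv_mul]
      have := (hasStrictFDerivAt_norm_sq v).hasFDerivAt.const_mul ((ϱ ^ 2)⁻¹)
      refine this.congr_fderiv ?_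
      ext w
      simp
    have h2 : HasDerivAt χt (deriv χt (‖v‖ ^ 2 / ϱ ^ 2)) (‖v‖ ^ 2 / ϱ ^ 2) :=
      (hχ.contDiff_comp_max.differentiable one_ne_zero _).hasDerivAt
    exact (h2.comp_hasFDerivAt v h1).smul (hD v)
  rw [heq]
  refine ⟨hCD, ?_, ?_, ?_⟩
  · rw [hG0, smul_zero]
  · rw [(hder 0).fderiv, hG0, hD0]
    ext w
    simp
  · refine lipschitzWith_of_nnnorm_fderiv_le (hCD.differentiable one_ne_zero) fun v => ?_
    rw [← NNReal.coe_le_coe, Real.coe_toNNReal _ (by positivity), coe_nnnorm, (hder v).fderiv]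
    -- For `‖v‖ ≥ 2ϱ` the argument of the cut-off is at least `4`, so both the cut-off and its
    -- derivative vanish.
    rcases le_total (2 * ϱ) ‖v‖ with hv | hv
    · have h4 : 4 ≤ ‖v‖ ^ 2 / ϱ ^ 2 := by
        rw [le_div_iff₀ (by positivity)]
        nlinarith
      have e1 : χt (‖v‖ ^ 2 / ϱ ^ 2) = 0 := hχ.eq_zero _ (h4.trans (le_max_left _ _))
      have e2 : deriv χt (‖v‖ ^ 2 / ϱ ^ 2) = 0 := hχ.deriv_eq_zero_of_four_le h4
      rw [e1, e2]
      simp only [zero_smul, ContinuousLinearMap.zero_smulRight, add_zero, norm_zero]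
      positivity
    · have hr : 0 ≤ ‖v‖ ^ 2 / ϱ ^ 2 := by positivity
      have e1 : |χt (‖v‖ ^ 2 / ϱ ^ 2)| ≤ 1 := by
        rw [abs_of_nonneg (hχ.nonneg _ (le_max_right _ _))]
        exact hχ.le_one _ (le_max_right _ _)
      have e2 := hB _ hr
      have e3 : ‖v‖ ^ (q - 1) ≤ 2 ^ (q - 1) * ϱ ^ (q - 1) := by
        rw [← Real.mul_rpow (by norm_num) hϱ.le]
        gcongr
      have e4 : ‖v‖ * ‖v‖ ^ q ≤ 4 * ϱ ^ 2 * (2 ^ (q - 1) * ϱ ^ (q - 1)) := by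
        rcases (norm_nonneg v).eq_or_lt with h0 | h0
        · rw [← h0, zero_mul]; positivity
        · have : ‖v‖ * ‖v‖ ^ q = ‖v‖ ^ 2 * ‖v‖ ^ (q - 1) := by
            rw [Real.rpow_sub_one h0.ne']; field_simp
          rw [this]
          gcongr
          nlinarith
      calc _ ≤ ‖χt (‖v‖ ^ 2 / ϱ ^ 2) • D v‖ + ‖(deriv χt (‖v‖ ^ 2 / ϱ ^ 2) •
            ((ϱ ^ 2)⁻¹ • (2 : ℝ) • innerSL ℝ v)).smulRight (G v)‖ := norm_add_le _ _
        _ ≤ 1 * (c * ‖v‖ ^ (q - 1)) + B * ((ϱ ^ 2)⁻¹ * (2 * ‖v‖)) * ‖v‖ ^ q := by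
          rw [ContinuousLinearMap.norm_smulRight_apply, norm_smul, norm_smul, norm_smul, norm_smul,
            innerSL_apply_norm, Real.norm_eq_abs, Real.norm_eq_abs,
            Real.norm_of_nonneg (r := (ϱ ^ 2)⁻¹) (by positivity),
            Real.norm_of_nonneg (r := (2 : ℝ)) (by positivity)]
          gcongr
          · exact hDb v
          · exact hGb v
        _ = c * ‖v‖ ^ (q - 1) + 2 * B * (ϱ ^ 2)⁻¹ * (‖v‖ * ‖v‖ ^ q) := by ring
        _ ≤ c * (2 ^ (q - 1) * ϱ ^ (q - 1)) +
            2 * B * (ϱ ^ 2)⁻¹ * (4 * ϱ ^ 2 * (2 ^ (q - 1) * ϱ ^ (q - 1))) := by gcongr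
        _ = (c + 8 * B) * (2 ^ (q - 1) * ϱ ^ (q - 1)) := by field_simp; ring
        _ ≤ (c + 8 * B + 1) * (2 ^ (q - 1) * ϱ ^ (q - 1)) :=
          mul_le_mul_of_nonneg_right (by linarith) (by positivity)
        _ = _ := by ring

end Truncation

/-! ### The weight `1 + |ξ|^{2m}` -/

section Weight

variable {N : ℕ} {m : ℝ}

/-- The weight `1 + |ξ|^{2m}`. -/
def wt (m : ℝ) (ξ : E N) : ℝ := 1 + ‖ξ‖ ^ (2 * m)

theorem one_le_wt (m : ℝ) (ξ : E N) : 1 ≤ wt m ξ := by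
  have : 0 ≤ ‖ξ‖ ^ (2 * m) := Real.rpow_nonneg (norm_nonneg _) _
  simp only [wt]; linarith

theorem wt_pos (m : ℝ) (ξ : E N) : 0 < wt m ξ := one_pos.trans_le (one_le_wt m ξ)

theorem continuous_wt (hm : 0 < m) : Continuous (wt m : E N → ℝ) :=
  continuous_const.add ((Real.continuous_rpow_const (by positivity)).comp continuous_norm)

theorem wt_le_wt (hm : 0 < m) {x y : E N} (h : ‖x‖ ≤ ‖y‖) : wt m x ≤ wt m y := by
  simp only [wt]; gcongr

/-- Submultiplicativity up to a constant lets the weight pass through a convolution: one factor goes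
to the kernel, the other to the function. -/
theorem wt_add_le (hm : 0 < m) (x y : E N) :
    wt m (x + y) ≤ 2 ^ (2 * m) * (wt m x * wt m y) := by
  have h2m : 0 < 2 * m := by positivity
  have h1 : (1 : ℝ) ≤ 2 ^ (2 * m) := Real.one_le_rpow (by norm_num) h2m.le
  have hx : 0 ≤ ‖x‖ ^ (2 * m) := by positivity
  have hy : 0 ≤ ‖y‖ ^ (2 * m) := by positivity
  have h2 : ‖x + y‖ ^ (2 * m) ≤ 2 ^ (2 * m) * (‖x‖ ^ (2 * m) + ‖y‖ ^ (2 * m)) := by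
    have hmax : ‖x + y‖ ≤ 2 * max ‖x‖ ‖y‖ := by
      have := norm_add_le x y
      have h3 := le_max_left ‖x‖ ‖y‖
      have h4 := le_max_right ‖x‖ ‖y‖
      linarith
    calc ‖x + y‖ ^ (2 * m) ≤ (2 * max ‖x‖ ‖y‖) ^ (2 * m) := by gcongr
      _ = 2 ^ (2 * m) * max ‖x‖ ‖y‖ ^ (2 * m) := Real.mul_rpow (by norm_num) (by positivity)
      _ ≤ _ := by
        gcongr
        rcases max_cases ‖x‖ ‖y‖ with h | h <;> rw [h.1] <;> linarith
  simp only [wt]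
  nlinarith [mul_nonneg hx hy]

/-- From `t ≤ (m/ε) e^{εt/m}` with `t = |z|²`, raised to the power `m`. It lets Gaussian decay
absorb the weight at an arbitrarily small cost in the rate. -/
theorem exists_wt_le_exp (hm : 0 < m) {ε : ℝ} (hε : 0 < ε) :
    ∃ C : ℝ, 0 < C ∧ ∀ z : E N, wt m z ≤ C * Real.exp (ε * ‖z‖ ^ 2) := by
  refine ⟨1 + (m / ε) ^ m, by positivity, fun z => ?_⟩
  have h1 : 1 ≤ Real.exp (ε * ‖z‖ ^ 2) := Real.one_le_exp (by positivity)
  have h2 : ‖z‖ ^ (2 * m) ≤ (m / ε) ^ m * Real.exp (ε * ‖z‖ ^ 2) := by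
    have e1 : ‖z‖ ^ (2 * m) = (‖z‖ ^ 2) ^ m := by
      rw [Real.rpow_mul (norm_nonneg _)]; norm_num
    have e2 : Real.exp (ε * ‖z‖ ^ 2) = Real.exp (ε / m * ‖z‖ ^ 2) ^ m := by
      rw [← Real.exp_mul]; congr 1; field_simp
    rw [e1, e2, ← Real.mul_rpow (by positivity) (by positivity)]
    gcongr
    have h3 := Real.add_one_le_exp (ε / m * ‖z‖ ^ 2)
    calc ‖z‖ ^ 2 = m / ε * (ε / m * ‖z‖ ^ 2) := by field_simp
      _ ≤ m / ε * Real.exp (ε / m * ‖z‖ ^ 2) := by gcongr; linarith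
  simp only [wt]
  nlinarith

theorem integrable_exp_neg_mul_sq {b : ℝ} (hb : 0 < b) :
    Integrable fun z : E N => Real.exp (-b * ‖z‖ ^ 2) := by
  refine Integrable.of_integral_ne_zero ?_
  rw [GaussianFourier.integral_rexp_neg_mul_sq_norm hb]
  positivity

theorem weightMeasure_absolutelyContinuous (N : ℕ) (m : ℝ) :
    weightMeasure N m ≪ (volume : Measure (E N)) := withDensity_absolutelyContinuous _ _

theorem measurable_wt (m : ℝ) : Measurable (wt m : E N → ℝ) := by
  unfold wt
  fun_prop

theorem lintegral_weightMeasure (f : E N → ℝ≥0∞) :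
    ∫⁻ ξ, f ξ ∂(weightMeasure N m) = ∫⁻ ξ, ENNReal.ofReal (wt m ξ) * f ξ :=
  lintegral_withDensity_eq_lintegral_mul_non_measurable _
    (measurable_wt m).ennreal_ofReal (.of_forall fun _ => ENNReal.ofReal_lt_top) f

theorem lintegral_comp_smul {b : ℝ} (hb : 0 < b) {f : E N → ℝ≥0∞} (hf : Measurable f) :
    ∫⁻ x, f (b • x) = ENNReal.ofReal (b ^ (-(N : ℝ))) * ∫⁻ x, f x := by
  have h := Measure.map_addHaar_smul (volume : Measure (E N)) hb.ne'
  rw [← lintegral_map hf (measurable_const_smul b), h, lintegral_smul_measure]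
  simp only [finrank_euclideanSpace, Fintype.card_fin, smul_eq_mul]
  rw [abs_of_pos (by positivity), Real.rpow_neg hb.le, Real.rpow_natCast]

end Weight

/-! ### Young's inequality for a rescaled convolution -/

section Young

variable {N : ℕ}

/-- Young's inequality `L^r * L^p → L²`, `1/r = 1 - s`, `1/p = 1/2 + s`, for the convolution with
the second variable rescaled by `c`. -/
theorem lintegral_rescaled_conv_sq_le {s c : ℝ} (hs : 0 ≤ s) (hs2 : s ≤ 1 / 2)
    {G H : E N → ℝ≥0∞} (hG : Measurable G) (hH : Measurable H) {J : ℝ≥0∞}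
    (hJ : ∀ ξ, (∫⁻ z, H (ξ - c • z) ^ (1 / (1 / 2 + s))) ^ (2 * s) ≤ J) :
    ∫⁻ ξ, (∫⁻ z, G z * H (ξ - c • z)) ^ (2 : ℝ) ≤
      (∫⁻ z, G z ^ (1 / (1 - s))) ^ (2 * (1 - s)) * J * ∫⁻ x, H x ^ (1 / (1 / 2 + s)) := by
  set r : ℝ := 1 / (1 - s) with hr
  set p : ℝ := 1 / (1 / 2 + s) with hp
  have hs1 : 0 < 1 - s := by linarith
  have hp0 : 0 < 1 / 2 + s := by linarith
  have hr0 : 0 < r := by positivity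
  have hpp : 0 < p := by positivity
  have hr1 : r * (1 - s) = 1 := by rw [hr]; field_simp
  have hp1 : p * (1 / 2 + s) = 1 := by rw [hp]; field_simp
  have hinner : ∀ ξ, (∫⁻ z, G z * H (ξ - c • z)) ^ (2 : ℝ) ≤
      (∫⁻ z, G z ^ r * H (ξ - c • z) ^ p) * ((∫⁻ z, G z ^ r) ^ (1 - 2 * s) * J) := by
    intro ξ
    have hHm : Measurable fun z => H (ξ - c • z) := by fun_prop
    -- Three-factor Hölder with exponents `1/2`, `1/2 - s`, `s`, applied to `G H = (G^r H^p)^{1/2}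
    -- (G^r)^{1/2-s} (H^p)^s`; the powers match because `r(1-s) = 1` and `p(1/2+s) = 1`.
    have hhold := ENNReal.lintegral_prod_norm_pow_le (μ := (volume : Measure (E N)))
      (Finset.univ : Finset (Fin 3))
      (f := ![fun z => G z ^ r * H (ξ - c • z) ^ p, fun z => G z ^ r, fun z => H (ξ - c • z) ^ p])
      (p := ![1 / 2, 1 / 2 - s, s])
      (by
        intro i _
        fin_cases i
        · exact ((hG.pow_const _).mul (hHm.pow_const _)).aemeasurable
        · exact (hG.pow_const _).aemeasurable
        · exact (hHm.pow_const _).aemeasurable)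
      (by simp [Fin.sum_univ_three]; ring)
      (by
        intro i _
        fin_cases i
        · norm_num
        · simpa using hs2
        · simpa using hs)
    simp only [Fin.prod_univ_three, Matrix.cons_val_zero, Matrix.cons_val_one,
      Matrix.cons_val] at hhold
    have hsplit : ∀ z, (G z ^ r * H (ξ - c • z) ^ p) ^ (1 / 2 : ℝ) * (G z ^ r) ^ (1 / 2 - s) *
        (H (ξ - c • z) ^ p) ^ s = G z * H (ξ - c • z) := by
      intro z
      rw [ENNReal.mul_rpow_of_nonneg _ _ (by norm_num), ← ENNReal.rpow_mul, ← ENNReal.rpow_mul,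
        ← ENNReal.rpow_mul, ← ENNReal.rpow_mul]
      have e1 : G z ^ (r * (1 / 2)) * G z ^ (r * (1 / 2 - s)) = G z := by
        rw [← ENNReal.rpow_add_of_nonneg _ _ (by positivity)
          (mul_nonneg hr0.le (by linarith)), ← mul_add,
          show (1 / 2 + (1 / 2 - s) : ℝ) = 1 - s by ring, hr1, ENNReal.rpow_one]
      have e2 : H (ξ - c • z) ^ (p * (1 / 2)) * H (ξ - c • z) ^ (p * s) = H (ξ - c • z) := by
        rw [← ENNReal.rpow_add_of_nonneg _ _ (by positivity) (by positivity), ← mul_add, hp1,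
          ENNReal.rpow_one]
      calc _ = (G z ^ (r * (1 / 2)) * G z ^ (r * (1 / 2 - s))) *
            (H (ξ - c • z) ^ (p * (1 / 2)) * H (ξ - c • z) ^ (p * s)) := by ring
        _ = _ := by rw [e1, e2]
    simp_rw [hsplit] at hhold
    calc (∫⁻ z, G z * H (ξ - c • z)) ^ (2 : ℝ)
        ≤ ((∫⁻ z, G z ^ r * H (ξ - c • z) ^ p) ^ (1 / 2 : ℝ) * (∫⁻ z, G z ^ r) ^ (1 / 2 - s) *
          (∫⁻ z, H (ξ - c • z) ^ p) ^ s) ^ (2 : ℝ) := by gcongr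
      _ = (∫⁻ z, G z ^ r * H (ξ - c • z) ^ p) * ((∫⁻ z, G z ^ r) ^ (1 - 2 * s) *
          (∫⁻ z, H (ξ - c • z) ^ p) ^ (2 * s)) := by
        rw [ENNReal.mul_rpow_of_nonneg _ _ (by norm_num),
          ENNReal.mul_rpow_of_nonneg _ _ (by norm_num), ← ENNReal.rpow_mul, ← ENNReal.rpow_mul,
          ← ENNReal.rpow_mul, show (1 / 2 * 2 : ℝ) = 1 by norm_num, ENNReal.rpow_one,
          show ((1 / 2 - s) * 2 : ℝ) = 1 - 2 * s by ring, show s * 2 = 2 * s by ring, mul_assoc]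
      _ ≤ _ := by gcongr; exact hJ ξ
  have hmeas : Measurable (Function.uncurry fun (ξ z : E N) => G z ^ r * H (ξ - c • z) ^ p) := by
    have h1 : Measurable fun x : E N × E N => x.1 - c • x.2 := by fun_prop
    exact ((hG.comp measurable_snd).pow_const _).mul ((hH.comp h1).pow_const _)
  calc ∫⁻ ξ, (∫⁻ z, G z * H (ξ - c • z)) ^ (2 : ℝ)
      ≤ ∫⁻ ξ, (∫⁻ z, G z ^ r * H (ξ - c • z) ^ p) * ((∫⁻ z, G z ^ r) ^ (1 - 2 * s) * J) :=
        lintegral_mono hinner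
    _ = (∫⁻ ξ, ∫⁻ z, G z ^ r * H (ξ - c • z) ^ p) * ((∫⁻ z, G z ^ r) ^ (1 - 2 * s) * J) :=
        lintegral_mul_const _ hmeas.lintegral_prod_right'
    _ = ((∫⁻ z, G z ^ r) * ∫⁻ x, H x ^ p) * ((∫⁻ z, G z ^ r) ^ (1 - 2 * s) * J) := by
        congr 1
        rw [lintegral_lintegral_swap hmeas.aemeasurable]
        have : ∀ z, ∫⁻ ξ, G z ^ r * H (ξ - c • z) ^ p = G z ^ r * ∫⁻ x, H x ^ p := by
          intro z
          rw [lintegral_const_mul _ (by fun_prop)]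
          congr 1
          exact lintegral_sub_right_eq_self (fun x => H x ^ p) (c • z)
        simp_rw [this]
        rw [lintegral_mul_const _ (hG.pow_const _)]
    _ = ((∫⁻ z, G z ^ r) ^ (1 : ℝ) * (∫⁻ z, G z ^ r) ^ (1 - 2 * s)) * J * ∫⁻ x, H x ^ p := by
        rw [ENNReal.rpow_one]; ring
    _ = _ := by
        rw [← ENNReal.rpow_add_of_nonneg _ _ (by norm_num) (by linarith)]
        congr 3
        ring

end Young

/-! ### Weighted `L^p → L²` bounds for rescaled Gaussian convolutions -/

section RescaledConv

variable {N : ℕ} {m : ℝ} {V V' : Type*} [NormedAddCommGroup V] [NormedSpace ℝ V]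
  [NormedAddCommGroup V'] [NormedSpace ℝ V']

/-- A continuous operator-valued kernel with Gaussian decay. -/
structure IsGaussianKernel (Γ : E N → V →L[ℝ] V') (A : ℝ) : Prop where
  continuous : Continuous Γ
  bound : ∀ z, ‖Γ z‖ ≤ A * Real.exp (-(1 / 8) * ‖z‖ ^ 2)

/-- The operator `f ↦ ∫ Γ(z) f(b (ξ - c z)) dz`. -/
def rescaledConv (Γ : E N → V →L[ℝ] V') (b c : ℝ) (f : E N → V) (ξ : E N) : V' :=
  ∫ z, Γ z (f (b • (ξ - c • z)))

variable {Γ : E N → V →L[ℝ] V'} {A : ℝ}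

theorem IsGaussianKernel.nonneg (hΓ : IsGaussianKernel Γ A) : 0 ≤ A := by
  have := (norm_nonneg _).trans (hΓ.bound 0)
  simpa using this

theorem IsGaussianKernel.stronglyMeasurable_uncurry (hΓ : IsGaussianKernel Γ A) (b c : ℝ)
    {f : E N → V} (hf : StronglyMeasurable f) :
    StronglyMeasurable fun x : E N × E N => Γ x.2 (f (b • (x.1 - c • x.2))) := by
  have h1 : StronglyMeasurable fun x : E N × E N => Γ x.2 :=
    (hΓ.continuous.comp continuous_snd).stronglyMeasurable
  have h2 : StronglyMeasurable fun x : E N × E N => f (b • (x.1 - c • x.2)) :=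
    hf.comp_measurable (by fun_prop)
  exact isBoundedBilinearMap_apply.continuous.comp_stronglyMeasurable (h1.prodMk h2)

theorem IsGaussianKernel.stronglyMeasurable_rescaledConv (hΓ : IsGaussianKernel Γ A) (b c : ℝ)
    {f : E N → V} (hf : StronglyMeasurable f) : StronglyMeasurable (rescaledConv Γ b c f) :=
  (hΓ.stronglyMeasurable_uncurry b c hf).integral_prod_right'

/-- The smoothing estimate `L^p(μ) → L²(μ)`, `1/p = 1/2 + s`, in the weighted spaces. -/
theorem IsGaussianKernel.exists_lintegral_bound (hm : 0 < m) (hΓ : IsGaussianKernel Γ A) {s : ℝ}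
    (hs : 0 ≤ s) (hs2 : s ≤ 1 / 2) :
    ∃ C : ℝ, 0 ≤ C ∧ ∀ (b c : ℝ) (f : E N → V), 1 ≤ b → 0 ≤ c → c ≤ 1 → (0 < c ∨ s = 0) →
      StronglyMeasurable f →
      (∫⁻ ξ, (∫⁻ z, ‖Γ z‖ₑ * ‖f (b • (ξ - c • z))‖ₑ) ^ (2 : ℝ) ∂(weightMeasure N m)) ^ (1 / 2 : ℝ) ≤
        ENNReal.ofReal (C * c ^ (-(N * s))) *
          eLpNorm f (ENNReal.ofReal (1 / (1 / 2 + s))) (weightMeasure N m) := by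
  obtain ⟨C₁, hC₁, hwt⟩ := exists_wt_le_exp (N := N) hm (show (0 : ℝ) < 1 / 16 by norm_num)
  have hA := hΓ.nonneg
  set K : ℝ := Real.sqrt (2 ^ (2 * m) * (C₁ + 1) ^ 2) * A with hK
  have hK0 : 0 ≤ K := by positivity
  set p : ℝ := 1 / (1 / 2 + s) with hp
  have hs1 : 0 < 1 - s := by linarith
  have hpp : 0 < 1 / 2 + s := by linarith
  have hp0 : 0 < p := by positivity
  have hp2 : p ≤ 2 := by rw [hp, div_le_iff₀ hpp]; linarith
  have hp1 : p * (1 / 2 + s) = 1 := by rw [hp]; field_simp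
  let G : E N → ℝ≥0∞ := fun z => ENNReal.ofReal (K * Real.exp (-(1 / 16) * ‖z‖ ^ 2))
  have hG : Measurable G := by fun_prop
  set r : ℝ := 1 / (1 - s) with hr
  have hr0 : 0 < r := by positivity
  have hGr : ∫⁻ z, G z ^ r ≠ ⊤ := by
    have h1 : ∀ z, G z ^ r = ENNReal.ofReal (K ^ r * Real.exp (-(r / 16) * ‖z‖ ^ 2)) := by
      intro z
      simp only [G]
      rw [ENNReal.ofReal_rpow_of_nonneg (by positivity) hr0.le, Real.mul_rpow hK0 (by positivity),
        ← Real.exp_mul]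
      congr 3
      ring
    simp_rw [h1]
    exact ((integrable_exp_neg_mul_sq (by positivity)).const_mul _).lintegral_lt_top.ne
  refine ⟨((∫⁻ z, G z ^ r) ^ (1 - s)).toReal, ENNReal.toReal_nonneg,
    fun b c f hb hc hc1 hcs hf => ?_⟩
  have hb0 : 0 < b := by linarith
  let W : E N → ℝ := fun ξ => Real.sqrt (wt m ξ)
  have hW : Measurable W := (measurable_wt m).sqrt
  have hW0 : ∀ ξ, 0 ≤ W ξ := fun ξ => Real.sqrt_nonneg _
  let H₀ : E N → ℝ≥0∞ := fun x => ENNReal.ofReal (W x) * ‖f x‖ₑ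
  have hH₀ : Measurable H₀ := hW.ennreal_ofReal.mul hf.enorm
  let H : E N → ℝ≥0∞ := fun x => H₀ (b • x)
  have hH : Measurable H := hH₀.comp (measurable_const_smul b)
  -- The weight at `ξ` is split between `c z` and `ξ - c z`; since `c ≤ 1` and `b ≥ 1` these are
  -- controlled by the weights at `z` and `b(ξ - c z)`. Of the decay rate `1/8`, one half pays for
  -- the weight at `z` and `1/16` remains.
  have hWk : ∀ ξ z, W ξ * ‖Γ z‖ ≤ K * Real.exp (-(1 / 16) * ‖z‖ ^ 2) * W (b • (ξ - c • z)) := by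
    intro ξ z
    have h1 : wt m ξ ≤ 2 ^ (2 * m) * (wt m z * wt m (b • (ξ - c • z))) := by
      have e : ξ = c • z + (ξ - c • z) := by abel
      have h2 : wt m (c • z) ≤ wt m z := wt_le_wt hm (by
        rw [norm_smul, Real.norm_of_nonneg hc]
        exact mul_le_of_le_one_left (norm_nonneg _) hc1)
      have h3 : wt m (ξ - c • z) ≤ wt m (b • (ξ - c • z)) := wt_le_wt hm (by
        rw [norm_smul, Real.norm_of_nonneg hb0.le]
        exact le_mul_of_one_le_left (norm_nonneg _) hb)
      calc wt m ξ = wt m (c • z + (ξ - c • z)) := by rw [← e]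
        _ ≤ 2 ^ (2 * m) * (wt m (c • z) * wt m (ξ - c • z)) := wt_add_le hm _ _
        _ ≤ _ := by
          have := (wt_pos m (ξ - c • z)).le
          have := (wt_pos m z).le
          gcongr
    have h4 : wt m z ≤ ((C₁ + 1) * Real.exp (1 / 16 * ‖z‖ ^ 2)) ^ 2 := by
      have h5 : 1 ≤ (C₁ + 1) * Real.exp (1 / 16 * ‖z‖ ^ 2) :=
        one_le_mul_of_one_le_of_one_le (by linarith) (Real.one_le_exp (by positivity))
      calc wt m z ≤ C₁ * Real.exp (1 / 16 * ‖z‖ ^ 2) := hwt z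
        _ ≤ (C₁ + 1) * Real.exp (1 / 16 * ‖z‖ ^ 2) := by gcongr; linarith
        _ ≤ _ := le_self_pow₀ h5 two_ne_zero
    have h6 : W ξ ≤ Real.sqrt (2 ^ (2 * m) * (C₁ + 1) ^ 2) * Real.exp (1 / 16 * ‖z‖ ^ 2) *
        W (b • (ξ - c • z)) := by
      simp only [W]
      rw [← Real.sqrt_sq (Real.exp_pos (1 / 16 * ‖z‖ ^ 2)).le, ← Real.sqrt_mul (by positivity),
        ← Real.sqrt_mul (by positivity)]
      refine Real.sqrt_le_sqrt (h1.trans ?_)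
      have := (wt_pos m (b • (ξ - c • z))).le
      calc 2 ^ (2 * m) * (wt m z * wt m (b • (ξ - c • z)))
          ≤ 2 ^ (2 * m) * (((C₁ + 1) * Real.exp (1 / 16 * ‖z‖ ^ 2)) ^ 2 *
            wt m (b • (ξ - c • z))) := by gcongr
        _ = _ := by ring
    calc W ξ * ‖Γ z‖ ≤ (Real.sqrt (2 ^ (2 * m) * (C₁ + 1) ^ 2) * Real.exp (1 / 16 * ‖z‖ ^ 2) *
        W (b • (ξ - c • z))) * (A * Real.exp (-(1 / 8) * ‖z‖ ^ 2)) := by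
          exact mul_le_mul h6 (hΓ.bound z) (norm_nonneg _) (mul_nonneg (by positivity) (hW0 _))
      _ = K * (Real.exp (1 / 16 * ‖z‖ ^ 2) * Real.exp (-(1 / 8) * ‖z‖ ^ 2)) *
          W (b • (ξ - c • z)) := by rw [hK]; ring
      _ = _ := by rw [← Real.exp_add]; congr 3; ring
  -- The square root `W` of the weight is at least `1` and `p ≤ 2`, so `W^p ≤ W²`, the full weight;
  -- the Jacobian `b^{-N}` is at most `1`.
  have hHp : ∫⁻ x, H x ^ p ≤ ∫⁻ x, ‖f x‖ₑ ^ p ∂(weightMeasure N m) := by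
    calc ∫⁻ x, H x ^ p = ENNReal.ofReal (b ^ (-(N : ℝ))) * ∫⁻ x, H₀ x ^ p :=
          lintegral_comp_smul hb0 (f := fun x => H₀ x ^ p) (hH₀.pow_const _)
      _ ≤ 1 * ∫⁻ x, H₀ x ^ p := by
          gcongr
          rw [ENNReal.ofReal_le_one]
          exact Real.rpow_le_one_of_one_le_of_nonpos hb (by simp)
      _ ≤ _ := by
          rw [one_mul, lintegral_weightMeasure]
          refine lintegral_mono fun x => ?_
          simp only [H₀]
          rw [ENNReal.mul_rpow_of_nonneg _ _ hp0.le]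
          gcongr
          rw [ENNReal.ofReal_rpow_of_nonneg (hW0 x) hp0.le]
          refine ENNReal.ofReal_le_ofReal ?_
          calc W x ^ p ≤ W x ^ (2 : ℝ) :=
                Real.rpow_le_rpow_of_exponent_le (Real.one_le_sqrt.2 (one_le_wt m x)) hp2
            _ = wt m x := by
                rw [Real.rpow_two]; exact Real.sq_sqrt (wt_pos m x).le
  -- Source of the singular factor: rescaling by `c > 0` costs `c^{-N}`, raised to the power `2s`.
  -- If `s = 0` both sides equal `1`, so `c = 0`, that is time zero, is allowed.
  have hJ : ∀ ξ, (∫⁻ z, H (ξ - c • z) ^ p) ^ (2 * s) ≤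
      ENNReal.ofReal (c ^ (-(N * s))) ^ (2 : ℝ) * (∫⁻ x, H x ^ p) ^ (2 * s) := by
    intro ξ
    rcases hcs with hc0 | hs0
    · have e : ∫⁻ z, H (ξ - c • z) ^ p =
          ENNReal.ofReal (c ^ (-(N : ℝ))) * ∫⁻ x, H x ^ p := by
        rw [lintegral_comp_smul hc0 (f := fun y => H (ξ - y) ^ p) (by fun_prop)]
        congr 1
        exact lintegral_sub_left_eq_self (fun x => H x ^ p) ξ
      rw [e, ENNReal.mul_rpow_of_nonneg _ _ (by positivity),
        ENNReal.ofReal_rpow_of_pos (by positivity), ENNReal.ofReal_rpow_of_pos (by positivity),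
        ← Real.rpow_mul hc0.le, ← Real.rpow_mul hc0.le]
      refine le_of_eq ?_
      congr 3
      ring
    · simp [hs0]
  have hmain := lintegral_rescaled_conv_sq_le (c := c) hs hs2 hG hH hJ
  have hle : ∫⁻ ξ, (∫⁻ z, ‖Γ z‖ₑ * ‖f (b • (ξ - c • z))‖ₑ) ^ (2 : ℝ) ∂(weightMeasure N m) ≤
      ∫⁻ ξ, (∫⁻ z, G z * H (ξ - c • z)) ^ (2 : ℝ) := by
    rw [lintegral_weightMeasure]
    refine lintegral_mono fun ξ => ?_
    have e1 : ENNReal.ofReal (wt m ξ) = ENNReal.ofReal (W ξ) ^ (2 : ℝ) := by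
      rw [ENNReal.ofReal_rpow_of_nonneg (hW0 ξ) (by norm_num), Real.rpow_two,
        Real.sq_sqrt (wt_pos m ξ).le]
    rw [e1, ← ENNReal.mul_rpow_of_nonneg _ _ (by norm_num)]
    gcongr
    rw [← lintegral_const_mul' _ _ ENNReal.ofReal_ne_top]
    refine lintegral_mono fun z => ?_
    simp only [G, H, H₀]
    rw [← mul_assoc, ← mul_assoc]
    refine mul_le_mul_left ?_ _
    rw [← ofReal_norm, ← ENNReal.ofReal_mul (hW0 ξ), ← ENNReal.ofReal_mul (by positivity)]
    exact ENNReal.ofReal_le_ofReal (hWk ξ z)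
  have hfin : (∫⁻ z, G z ^ r) ^ (1 - s) ≠ ⊤ := ENNReal.rpow_ne_top_of_nonneg hs1.le hGr
  have he : eLpNorm f (ENNReal.ofReal p) (weightMeasure N m) =
      (∫⁻ x, ‖f x‖ₑ ^ p ∂(weightMeasure N m)) ^ (1 / 2 + s) := by
    rw [eLpNorm_eq_lintegral_rpow_enorm_toReal (by simpa using hp0) ENNReal.ofReal_ne_top,
      ENNReal.toReal_ofReal hp0.le]
    congr 1
    rw [hp, one_div_one_div]
  calc _ ≤ ((∫⁻ z, G z ^ r) ^ (2 * (1 - s)) * (ENNReal.ofReal (c ^ (-(N * s))) ^ (2 : ℝ) *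
          (∫⁻ x, H x ^ p) ^ (2 * s)) * ∫⁻ x, H x ^ p) ^ (1 / 2 : ℝ) := by
        gcongr
        exact hle.trans hmain
    _ = (((∫⁻ z, G z ^ r) ^ (1 - s) * ENNReal.ofReal (c ^ (-(N * s))) *
          (∫⁻ x, H x ^ p) ^ (1 / 2 + s)) ^ (2 : ℝ)) ^ (1 / 2 : ℝ) := by
        congr 1
        rw [ENNReal.mul_rpow_of_nonneg _ _ (by norm_num),
          ENNReal.mul_rpow_of_nonneg _ _ (by norm_num), ← ENNReal.rpow_mul, ← ENNReal.rpow_mul,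
          show (1 / 2 + s) * 2 = 2 * s + 1 by ring,
          ENNReal.rpow_add_of_nonneg (2 * s) 1 (by positivity) (by norm_num), ENNReal.rpow_one,
          mul_comm (1 - s) 2]
        ring
    _ = (∫⁻ z, G z ^ r) ^ (1 - s) * ENNReal.ofReal (c ^ (-(N * s))) *
          (∫⁻ x, H x ^ p) ^ (1 / 2 + s) := by
        rw [← ENNReal.rpow_mul]; norm_num
    _ ≤ _ := by
        rw [ENNReal.ofReal_mul ENNReal.toReal_nonneg, ENNReal.ofReal_toReal hfin, he]
        gcongr

end RescaledConv

/-! ### Rescaled convolutions as bounded operators on Lebesgue classes -/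

section ConvOperator

variable {N : ℕ} {m : ℝ} {V V' : Type*} [NormedAddCommGroup V] [NormedSpace ℝ V]
  [NormedAddCommGroup V'] [NormedSpace ℝ V'] {Γ : E N → V →L[ℝ] V'} {A : ℝ}

/-- Parameters `(b, c)` of the rescaled convolution acting from `L^p` to `L²`, `1/p = 1/2 + s`. -/
def convParams (s : ℝ) : Set (ℝ × ℝ) := {x | 1 ≤ x.1 ∧ 0 ≤ x.2 ∧ x.2 ≤ 1 ∧ (0 < x.2 ∨ s = 0)}

theorem enorm_rescaledConv_le (b c : ℝ) (f : E N → V) (ξ : E N) :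
    ‖rescaledConv Γ b c f ξ‖ₑ ≤ ∫⁻ z, ‖Γ z‖ₑ * ‖f (b • (ξ - c • z))‖ₑ := by
  refine (enorm_integral_le_lintegral_enorm _).trans (lintegral_mono fun z => ?_)
  exact (Γ z).le_opENorm _

/-- The bound is proved for the convolution of absolute values, so besides the norm estimate it
gives absolute convergence for almost every `ξ`, which additivity of the integral requires. -/
theorem IsGaussianKernel.memLp_and_integrable (hm : 0 < m) (hΓ : IsGaussianKernel Γ A) {s : ℝ}
    (hs : 0 ≤ s) (hs2 : s ≤ 1 / 2) :
    ∃ C : ℝ, 0 ≤ C ∧ ∀ x ∈ convParams s, ∀ f : E N → V, StronglyMeasurable f →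
      MemLp f (ENNReal.ofReal (1 / (1 / 2 + s))) (weightMeasure N m) →
      MemLp (rescaledConv Γ x.1 x.2 f) 2 (weightMeasure N m) ∧
      eLpNorm (rescaledConv Γ x.1 x.2 f) 2 (weightMeasure N m) ≤
        ENNReal.ofReal (C * x.2 ^ (-(N * s))) *
          eLpNorm f (ENNReal.ofReal (1 / (1 / 2 + s))) (weightMeasure N m) ∧
      ∀ᵐ ξ : E N, Integrable fun z => Γ z (f (x.1 • (ξ - x.2 • z))) := by
  obtain ⟨C, hC, hbd⟩ := hΓ.exists_lintegral_bound hm hs hs2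
  refine ⟨C, hC, ?_⟩
  rintro ⟨b, c⟩ ⟨hb, hc, hc1, hcs⟩ f hf hfp
  have h1 := hbd b c f hb hc hc1 hcs hf
  have h2 : eLpNorm (rescaledConv Γ b c f) 2 (weightMeasure N m) ≤
      (∫⁻ ξ, (∫⁻ z, ‖Γ z‖ₑ * ‖f (b • (ξ - c • z))‖ₑ) ^ (2 : ℝ) ∂(weightMeasure N m)) ^
        (1 / 2 : ℝ) := by
    rw [eLpNorm_eq_lintegral_rpow_enorm_toReal (by norm_num) (by norm_num)]
    simp only [ENNReal.toReal_ofNat]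
    gcongr with ξ
    exact enorm_rescaledConv_le b c f ξ
  have hlt : (∫⁻ ξ, (∫⁻ z, ‖Γ z‖ₑ * ‖f (b • (ξ - c • z))‖ₑ) ^ (2 : ℝ) ∂(weightMeasure N m)) ^
      (1 / 2 : ℝ) < ⊤ := h1.trans_lt (ENNReal.mul_lt_top ENNReal.ofReal_lt_top hfp.2)
  refine ⟨⟨(hΓ.stronglyMeasurable_rescaledConv b c hf).aestronglyMeasurable, h2.trans_lt hlt⟩,
    h2.trans h1, ?_⟩
  have hmeas : Measurable fun ξ : E N => ∫⁻ z, ‖Γ z‖ₑ * ‖f (b • (ξ - c • z))‖ₑ := by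
    have h3 : Measurable fun x : E N × E N => ‖Γ x.2‖ₑ * ‖f (b • (x.1 - c • x.2))‖ₑ := by
      have h4 : Measurable fun x : E N × E N => ‖Γ x.2‖ₑ :=
        (hΓ.continuous.comp continuous_snd).enorm.measurable
      have h5 : Measurable fun x : E N × E N => ‖f (b • (x.1 - c • x.2))‖ₑ :=
        (hf.comp_measurable (by fun_prop)).enorm
      exact h4.mul h5
    exact h3.lintegral_prod_right'
  have hae := ae_lt_top (μ := weightMeasure N m) (hmeas.pow_const (2 : ℝ))
    (fun h => by rw [h] at hlt; simp at hlt)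
  filter_upwards [ae_volume_of_ae_weight hae] with ξ hξ
  refine ⟨((hΓ.stronglyMeasurable_uncurry b c hf).comp_measurable
    measurable_prodMk_left).aestronglyMeasurable, ?_⟩
  refine lt_of_le_of_lt (lintegral_mono fun z => (Γ z).le_opENorm _) ?_
  by_contra h
  rw [not_lt, top_le_iff] at h
  rw [h] at hξ
  simp at hξ

theorem rescaledConv_add {b c : ℝ} {f g : E N → V} {ξ : E N}
    (hf : Integrable fun z => Γ z (f (b • (ξ - c • z))))
    (hg : Integrable fun z => Γ z (g (b • (ξ - c • z)))) :
    rescaledConv Γ b c (fun x => f x + g x) ξ = rescaledConv Γ b c f ξ + rescaledConv Γ b c g ξ := by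
  simp only [rescaledConv, map_add]
  exact integral_add hf hg

theorem rescaledConv_smul {b c : ℝ} {f : E N → V} {ξ : E N} (k : ℝ) :
    rescaledConv Γ b c (fun x => k • f x) ξ = k • rescaledConv Γ b c f ξ := by
  simp only [rescaledConv, map_smul]
  exact integral_smul k _

/-- The rescaled convolutions define bounded operators `L^p(μ) → L²(μ)`. -/
theorem IsGaussianKernel.exists_operator (hm : 0 < m) (hΓ : IsGaussianKernel Γ A) {s : ℝ}
    (hs : 0 ≤ s) (hs2 : s ≤ 1 / 2) {p : ℝ≥0∞} [Fact (1 ≤ p)]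
    (hp : p = ENNReal.ofReal (1 / (1 / 2 + s))) :
    ∃ C : ℝ, 0 ≤ C ∧ ∃ Op : ℝ × ℝ → Lp V p (weightMeasure N m) →L[ℝ] Lp V' 2 (weightMeasure N m),
      ∀ x ∈ convParams s, ‖Op x‖ ≤ C * x.2 ^ (-(N * s)) ∧
        ∀ (f : Lp V p (weightMeasure N m)) (g : E N → V), StronglyMeasurable g →
          f =ᵐ[weightMeasure N m] g → Op x f =ᵐ[weightMeasure N m] rescaledConv Γ x.1 x.2 g := by
  obtain ⟨C, hC, H⟩ := hΓ.memLp_and_integrable hm hs hs2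
  rw [← hp] at H
  refine ⟨C, hC, ?_⟩
  -- Independence of the representative, obtained by applying the norm bound to the difference. This
  -- covers `c = 0` too, where the convolution evaluates the function at the single point `b ξ`.
  have key : ∀ x ∈ convParams s, ∀ f g : E N → V, StronglyMeasurable f → StronglyMeasurable g →
      MemLp f p (weightMeasure N m) → f =ᵐ[weightMeasure N m] g →
      rescaledConv Γ x.1 x.2 f =ᵐ[weightMeasure N m] rescaledConv Γ x.1 x.2 g := by
    intro x hx f g hf hg hfp hfg
    have hgp : MemLp g p (weightMeasure N m) := (memLp_congr_ae hfg).1 hfp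
    have hdm : StronglyMeasurable fun y => f y + (-1 : ℝ) • g y := hf.add (hg.const_smul _)
    have hd : MemLp (fun y => f y + (-1 : ℝ) • g y) p (weightMeasure N m) :=
      hfp.add (hgp.const_smul _)
    have h0 : eLpNorm (fun y => f y + (-1 : ℝ) • g y) p (weightMeasure N m) = 0 := by
      have : (fun y => f y + (-1 : ℝ) • g y) =ᵐ[weightMeasure N m] fun _ => (0 : V) := by
        filter_upwards [hfg] with y hy
        simp [hy]
      rw [eLpNorm_congr_ae this, eLpNorm_zero']
    have h1 := (H x hx _ hdm hd).2.1
    rw [h0, mul_zero, nonpos_iff_eq_zero, eLpNorm_eq_zero_iff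
      (hΓ.stronglyMeasurable_rescaledConv _ _ hdm).aestronglyMeasurable (by norm_num)] at h1
    have hac := weightMeasure_absolutelyContinuous N m
    filter_upwards [h1, hac.ae_le (H x hx f hf hfp).2.2, hac.ae_le
      (H x hx (fun y => (-1 : ℝ) • g y) (hg.const_smul _) (hgp.const_smul _)).2.2] with ξ h2 h3 h4
    rw [rescaledConv_add h3 h4, rescaledConv_smul] at h2
    simp only [Pi.zero_apply, neg_smul, one_smul] at h2
    rwa [← sub_eq_add_neg, sub_eq_zero] at h2
  have hex : ∀ x : ℝ × ℝ, ∃ T : Lp V p (weightMeasure N m) →L[ℝ] Lp V' 2 (weightMeasure N m),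
      x ∈ convParams s → ‖T‖ ≤ C * x.2 ^ (-(N * s)) ∧
        ∀ (f : Lp V p (weightMeasure N m)) (g : E N → V), StronglyMeasurable g →
          f =ᵐ[weightMeasure N m] g → T f =ᵐ[weightMeasure N m] rescaledConv Γ x.1 x.2 g := by
    intro x
    by_cases hx : x ∈ convParams s
    swap
    · exact ⟨0, fun h => absurd h hx⟩
    have hK : 0 ≤ C * x.2 ^ (-(N * s)) := mul_nonneg hC (Real.rpow_nonneg hx.2.1 _)
    have hmem : ∀ f : Lp V p (weightMeasure N m),
        MemLp (rescaledConv Γ x.1 x.2 f) 2 (weightMeasure N m) := fun f =>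
      (H x hx f (Lp.stronglyMeasurable f) (Lp.memLp f)).1
    have hac := weightMeasure_absolutelyContinuous N m
    let T₀ : Lp V p (weightMeasure N m) →ₗ[ℝ] Lp V' 2 (weightMeasure N m) :=
      { toFun := fun f => (hmem f).toLp
        map_add' := fun f g => by
          rw [← MemLp.toLp_add, MemLp.toLp_eq_toLp_iff]
          have h1 := key x hx (f + g : Lp V p (weightMeasure N m)) (fun y => f y + g y)
            (Lp.stronglyMeasurable _)
            ((Lp.stronglyMeasurable f).add (Lp.stronglyMeasurable g)) (Lp.memLp _)
            (Lp.coeFn_add f g)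
          refine h1.trans ?_
          filter_upwards [hac.ae_le (H x hx f (Lp.stronglyMeasurable f) (Lp.memLp f)).2.2,
            hac.ae_le (H x hx g (Lp.stronglyMeasurable g) (Lp.memLp g)).2.2] with ξ h2 h3
          exact rescaledConv_add h2 h3
        map_smul' := fun k f => by
          rw [RingHom.id_apply, ← MemLp.toLp_const_smul, MemLp.toLp_eq_toLp_iff]
          have h1 := key x hx (k • f : Lp V p (weightMeasure N m)) (fun y => k • f y)
            (Lp.stronglyMeasurable _) ((Lp.stronglyMeasurable f).const_smul k) (Lp.memLp _)
            (Lp.coeFn_smul k f)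
          exact h1.trans (.of_forall fun ξ => rescaledConv_smul k) }
    refine ⟨T₀.mkContinuous (C * x.2 ^ (-(N * s))) fun f => ?_, fun _ => ⟨?_, ?_⟩⟩
    · change ‖(hmem f).toLp‖ ≤ _
      rw [Lp.norm_toLp, Lp.norm_def, ← ENNReal.toReal_ofReal hK, ← ENNReal.toReal_mul]
      exact ENNReal.toReal_mono (ENNReal.mul_ne_top ENNReal.ofReal_ne_top (Lp.eLpNorm_ne_top f))
        (H x hx f (Lp.stronglyMeasurable f) (Lp.memLp f)).2.1
    · exact LinearMap.mkContinuous_norm_le _ hK _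
    · intro f g hg hfg
      exact (MemLp.coeFn_toLp (hmem f)).trans
        (key x hx f g (Lp.stronglyMeasurable f) hg (Lp.memLp f) hfg)
  choose Op hOp using hex
  exact ⟨Op, hOp⟩

end ConvOperator

/-! ### Strong continuity in the dilation parameters -/

section StrongContinuity

/-- The `ε/3` argument: continuity of `K` makes the operator norms locally bounded, so continuity on
a dense set of vectors extends to all of them. -/
theorem continuousOn_apply_of_dense {X Y P : Type*} [NormedAddCommGroup X] [NormedSpace ℝ X]
    [NormedAddCommGroup Y] [NormedSpace ℝ Y] [TopologicalSpace P] {Op : P → Y →L[ℝ] X} {D : Set P}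
    {K : P → ℝ} (hK : ContinuousOn K D) (hOp : ∀ x ∈ D, ‖Op x‖ ≤ K x) {S : Set Y} (hS : Dense S)
    (hc : ∀ y ∈ S, ContinuousOn (fun x => Op x y) D) (y : Y) :
    ContinuousOn (fun x => Op x y) D := by
  intro x₀ hx₀
  have hK0 : 0 ≤ K x₀ := (norm_nonneg _).trans (hOp x₀ hx₀)
  rw [ContinuousWithinAt, Metric.tendsto_nhds]
  intro ε hε
  obtain ⟨y', hy', hd⟩ := hS.exists_dist_lt y (ε := ε / (3 * (K x₀ + 1))) (by positivity)
  rw [dist_eq_norm, lt_div_iff₀ (by positivity)] at hd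
  have h1 := (Metric.tendsto_nhds.1 (hc y' hy' x₀ hx₀)) (ε / 3) (by positivity)
  have h2 : ∀ᶠ x in nhdsWithin x₀ D, K x < K x₀ + 1 :=
    (hK x₀ hx₀).eventually (gt_mem_nhds (by linarith))
  filter_upwards [h1, h2, self_mem_nhdsWithin] with x h3 h4 hx
  rw [dist_eq_norm] at h3 ⊢
  have e : Op x y - Op x₀ y = Op x (y - y') + (Op x y' - Op x₀ y') - Op x₀ (y - y') := by
    simp only [map_sub]; abel
  have b1 : ‖Op x (y - y')‖ ≤ (K x₀ + 1) * ‖y - y'‖ :=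
    ((Op x).le_opNorm _).trans (by gcongr; exact (hOp x hx).trans h4.le)
  have b2 : ‖Op x₀ (y - y')‖ ≤ (K x₀ + 1) * ‖y - y'‖ :=
    ((Op x₀).le_opNorm _).trans (by gcongr; linarith [hOp x₀ hx₀])
  rw [e]
  have b3 := norm_sub_le (Op x (y - y') + (Op x y' - Op x₀ y')) (Op x₀ (y - y'))
  have b4 := norm_add_le (Op x (y - y')) (Op x y' - Op x₀ y')
  nlinarith

variable {N : ℕ} {m : ℝ} {V V' : Type*} [NormedAddCommGroup V] [NormedSpace ℝ V]
  [NormedAddCommGroup V'] [NormedSpace ℝ V'] {Γ : E N → V →L[ℝ] V'} {A : ℝ}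

theorem IsGaussianKernel.continuous_rescaledConv (hΓ : IsGaussianKernel Γ A) {g : E N → V}
    (hg : Continuous g) {B : ℝ} (hB : ∀ x, ‖g x‖ ≤ B) (ξ : E N) :
    Continuous fun x : ℝ × ℝ => rescaledConv Γ x.1 x.2 g ξ := by
  have hA := hΓ.nonneg
  refine continuous_of_dominated (bound := fun z => A * Real.exp (-(1 / 8) * ‖z‖ ^ 2) * B)
    (fun x => ?_) (fun x => .of_forall fun z => ?_) ?_ (.of_forall fun z => ?_)
  · have : Continuous fun z => Γ z (g (x.1 • (ξ - x.2 • z))) :=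
      hΓ.continuous.clm_apply (by fun_prop)
    exact this.aestronglyMeasurable
  · exact ((Γ z).le_opNorm _).trans (by gcongr; exacts [hΓ.bound z, hB _])
  · exact ((integrable_exp_neg_mul_sq (by norm_num)).const_mul _).mul_const _
  · fun_prop

/-- If `g` lives in the ball of radius `R`, only `z` with `|ξ| ≤ R + |z|` contribute, so half of the
decay in `z` becomes decay in `ξ`. The bound is uniform in `b` and `c` and serves as the dominating
function for continuity in the parameters. -/
theorem IsGaussianKernel.exists_rescaledConv_le (hΓ : IsGaussianKernel Γ A) {g : E N → V}
    (hg : HasCompactSupport g) {B : ℝ} (hB : ∀ x, ‖g x‖ ≤ B) :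
    ∃ C : ℝ, 0 ≤ C ∧ ∀ b c : ℝ, 1 ≤ b → 0 ≤ c → c ≤ 1 → ∀ ξ,
      ‖rescaledConv Γ b c g ξ‖ ≤ C * Real.exp (-(1 / 32) * ‖ξ‖ ^ 2) := by
  have hA := hΓ.nonneg
  have hB0 : 0 ≤ B := (norm_nonneg _).trans (hB 0)
  obtain ⟨R, hR⟩ := hg.isCompact.isBounded.exists_norm_le
  have hi : Integrable fun z : E N => A * Real.exp (R ^ 2 / 16) * B *
      Real.exp (-(1 / 16) * ‖z‖ ^ 2) :=
    (integrable_exp_neg_mul_sq (by norm_num)).const_mul _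
  refine ⟨∫ z : E N, A * Real.exp (R ^ 2 / 16) * B * Real.exp (-(1 / 16) * ‖z‖ ^ 2),
    integral_nonneg fun z => by positivity, fun b c hb hc hc1 ξ => ?_⟩
  rw [rescaledConv, ← integral_mul_const]
  refine norm_integral_le_of_norm_le (hi.mul_const _) (.of_forall fun z => ?_)
  by_cases h : g (b • (ξ - c • z)) = 0
  · rw [h, map_zero, norm_zero]; positivity
  have h1 : ‖b • (ξ - c • z)‖ ≤ R := hR _ (subset_tsupport _ h)
  have h2 : ‖ξ - c • z‖ ≤ R := by
    refine le_trans ?_ h1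
    rw [norm_smul, Real.norm_of_nonneg (by linarith)]
    exact le_mul_of_one_le_left (norm_nonneg _) hb
  have h3 : ‖ξ‖ ≤ R + ‖z‖ := by
    have e : ξ = (ξ - c • z) + c • z := by abel
    have h4 : ‖c • z‖ ≤ ‖z‖ := by
      rw [norm_smul, Real.norm_of_nonneg hc]
      exact mul_le_of_le_one_left (norm_nonneg _) hc1
    calc ‖ξ‖ = ‖(ξ - c • z) + c • z‖ := by rw [← e]
      _ ≤ _ := (norm_add_le _ _).trans (add_le_add h2 h4)
  have h5 : ‖ξ‖ ^ 2 ≤ 2 * R ^ 2 + 2 * ‖z‖ ^ 2 := by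
    nlinarith [norm_nonneg ξ, norm_nonneg z, sq_nonneg (R - ‖z‖)]
  calc ‖Γ z (g (b • (ξ - c • z)))‖ ≤ A * Real.exp (-(1 / 8) * ‖z‖ ^ 2) * B :=
        ((Γ z).le_opNorm _).trans (by gcongr; exacts [hΓ.bound z, hB _])
    _ ≤ A * (Real.exp (R ^ 2 / 16) * Real.exp (-(1 / 16) * ‖z‖ ^ 2) *
        Real.exp (-(1 / 32) * ‖ξ‖ ^ 2)) * B := by
        gcongr
        rw [← Real.exp_add, ← Real.exp_add, Real.exp_le_exp]
        linarith
    _ = _ := by ring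

theorem isLocallyFiniteMeasure_weightMeasure (hm : 0 < m) :
    IsLocallyFiniteMeasure (weightMeasure N m) :=
  IsLocallyFiniteMeasure.withDensity_ofReal (continuous_wt hm)

theorem dense_hasCompactSupport_Lp (hm : 0 < m) {p : ℝ≥0∞} [Fact (1 ≤ p)] (hp : p ≠ ⊤) :
    Dense {f : Lp V p (weightMeasure N m) | ∃ g : E N → V, Continuous g ∧ HasCompactSupport g ∧
      f =ᵐ[weightMeasure N m] g} := by
  have := isLocallyFiniteMeasure_weightMeasure (N := N) hm
  rw [Metric.dense_iff]
  intro f ε hε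
  obtain ⟨g, hgc, hd, hg, hgp⟩ := (Lp.memLp f).exists_hasCompactSupport_eLpNorm_sub_le hp
    (ε := ENNReal.ofReal (ε / 2)) (by simpa using hε)
  refine ⟨hgp.toLp, ?_, g, hg, hgc, hgp.coeFn_toLp⟩
  rw [Metric.mem_ball, dist_comm, Lp.dist_def, eLpNorm_congr_ae
    ((Filter.EventuallyEq.refl _ _).sub hgp.coeFn_toLp)]
  refine lt_of_le_of_lt (ENNReal.toReal_mono ENNReal.ofReal_ne_top hd) ?_
  rw [ENNReal.toReal_ofReal (by positivity)]
  linarith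

/-- Strong continuity of the rescaled convolutions in the parameters. -/
theorem IsGaussianKernel.continuousOn_operator (hm : 0 < m) (hΓ : IsGaussianKernel Γ A) {s : ℝ}
    {p : ℝ≥0∞} [Fact (1 ≤ p)] (hp : p ≠ ⊤) {C : ℝ}
    {Op : ℝ × ℝ → Lp V p (weightMeasure N m) →L[ℝ] Lp V' 2 (weightMeasure N m)}
    (hOp : ∀ x ∈ convParams s, ‖Op x‖ ≤ C * x.2 ^ (-(N * s)) ∧
        ∀ (f : Lp V p (weightMeasure N m)) (g : E N → V), StronglyMeasurable g →
          f =ᵐ[weightMeasure N m] g → Op x f =ᵐ[weightMeasure N m] rescaledConv Γ x.1 x.2 g)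
    (f : Lp V p (weightMeasure N m)) :
    ContinuousOn (fun x => Op x f) (convParams s) := by
  refine continuousOn_apply_of_dense (K := fun x => C * x.2 ^ (-(N * s))) ?_
    (fun x hx => (hOp x hx).1) (dense_hasCompactSupport_Lp hm hp) ?_ f
  · intro x hx
    rcases hx.2.2.2 with h | h
    · have h1 : ContinuousAt (fun x : ℝ × ℝ => x.2 ^ (-(N * s))) x :=
        continuousAt_snd.rpow_const (Or.inl h.ne')
      exact (continuousAt_const.mul h1).continuousWithinAt
    · simp only [h, mul_zero, neg_zero, Real.rpow_zero]
      exact continuousWithinAt_const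
  rintro f ⟨g, hg, hgc, hfg⟩ x₀ hx₀
  obtain ⟨B, hB⟩ := hg.bounded_above_of_compact_support hgc
  obtain ⟨C', hC', hbd⟩ := hΓ.exists_rescaledConv_le hgc hB
  have hgm : StronglyMeasurable g := hg.stronglyMeasurable
  rw [ContinuousWithinAt, Lp.tendsto_Lp_iff_tendsto_eLpNorm']
  obtain ⟨C₁, hC₁, hwt⟩ := exists_wt_le_exp (N := N) hm (show (0 : ℝ) < 1 / 32 by norm_num)
  have hlim : Filter.Tendsto (fun x : ℝ × ℝ => ∫⁻ ξ, ‖rescaledConv Γ x.1 x.2 g ξ -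
      rescaledConv Γ x₀.1 x₀.2 g ξ‖ₑ ^ (2 : ℝ) ∂(weightMeasure N m)) (nhdsWithin x₀ (convParams s))
      (nhds (∫⁻ _, 0 ∂(weightMeasure N m))) := by
    refine tendsto_lintegral_filter_of_dominated_convergence
      (fun ξ => ENNReal.ofReal (2 * C' * Real.exp (-(1 / 32) * ‖ξ‖ ^ 2)) ^ (2 : ℝ)) ?_ ?_ ?_ ?_
    · refine .of_forall fun x => ?_
      exact (((hΓ.stronglyMeasurable_rescaledConv _ _ hgm).sub
        (hΓ.stronglyMeasurable_rescaledConv _ _ hgm)).enorm).pow_const _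
    · filter_upwards [self_mem_nhdsWithin] with x hx
      refine .of_forall fun ξ => ?_
      gcongr
      rw [← ofReal_norm]
      refine ENNReal.ofReal_le_ofReal ((norm_sub_le _ _).trans ?_)
      have h1 := hbd x.1 x.2 hx.1 hx.2.1 hx.2.2.1 ξ
      have h2 := hbd x₀.1 x₀.2 hx₀.1 hx₀.2.1 hx₀.2.2.1 ξ
      linarith
    · rw [lintegral_weightMeasure]
      have hi : Integrable fun ξ : E N =>
          C₁ * (2 * C') ^ 2 * Real.exp (-(1 / 32) * ‖ξ‖ ^ 2) :=
        (integrable_exp_neg_mul_sq (by norm_num)).const_mul _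
      refine ne_top_of_le_ne_top hi.lintegral_lt_top.ne (lintegral_mono fun ξ => ?_)
      rw [ENNReal.ofReal_rpow_of_nonneg (by positivity) (by norm_num),
        ← ENNReal.ofReal_mul (wt_pos m ξ).le]
      refine ENNReal.ofReal_le_ofReal ?_
      rw [Real.rpow_two]
      calc wt m ξ * (2 * C' * Real.exp (-(1 / 32) * ‖ξ‖ ^ 2)) ^ 2
          ≤ C₁ * Real.exp (1 / 32 * ‖ξ‖ ^ 2) *
            (2 * C' * Real.exp (-(1 / 32) * ‖ξ‖ ^ 2)) ^ 2 := by gcongr; exact hwt ξ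
        _ = C₁ * (2 * C') ^ 2 * Real.exp (-(1 / 32) * ‖ξ‖ ^ 2) *
            (Real.exp (1 / 32 * ‖ξ‖ ^ 2) * Real.exp (-(1 / 32) * ‖ξ‖ ^ 2)) := by ring
        _ = _ := by rw [← Real.exp_add]; simp
    · refine .of_forall fun ξ => ?_
      have h1 : Continuous fun x : ℝ × ℝ =>
          ‖rescaledConv Γ x.1 x.2 g ξ - rescaledConv Γ x₀.1 x₀.2 g ξ‖ₑ ^ (2 : ℝ) :=
        (ENNReal.continuous_rpow_const).comp
          (((hΓ.continuous_rescaledConv hg hB ξ).sub continuous_const).enorm)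
      have h2 := (h1.tendsto x₀).mono_left (nhdsWithin_le_nhds (s := convParams s))
      simpa using h2
  have h3 : Filter.Tendsto (fun x : ℝ × ℝ => (∫⁻ ξ, ‖rescaledConv Γ x.1 x.2 g ξ -
      rescaledConv Γ x₀.1 x₀.2 g ξ‖ₑ ^ (2 : ℝ) ∂(weightMeasure N m)) ^ (1 / 2 : ℝ))
      (nhdsWithin x₀ (convParams s)) (nhds 0) := by
    rw [lintegral_zero] at hlim
    have := (ENNReal.continuous_rpow_const (y := 1 / 2)).tendsto 0 |>.comp hlim
    simpa [Function.comp_def] using this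
  refine h3.congr' ?_
  filter_upwards [self_mem_nhdsWithin] with x hx
  rw [eLpNorm_congr_ae (((hOp x hx).2 f g hgm hfg).sub ((hOp x₀ hx₀).2 f g hgm hfg)),
    eLpNorm_eq_lintegral_rpow_enorm_toReal (by norm_num) (by norm_num)]
  simp

end StrongContinuity

/-! ### Completeness of `H¹_m` and uniqueness of the weak gradient -/

section SobolevSpace

variable {N : ℕ} {m : ℝ}

theorem IsWeakGradient.congr_ae {v v' : E N → ℝ} {g g' : E N → E N} (h : IsWeakGradient v g)
    (hv : v =ᵐ[volume] v') (hg : g =ᵐ[volume] g') : IsWeakGradient v' g' := by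
  intro ψ hψ hc e
  have h1 : ∫ ξ, v' ξ * fderiv ℝ ψ ξ e = ∫ ξ, v ξ * fderiv ℝ ψ ξ e :=
    integral_congr_ae (hv.mono fun ξ hξ => by simp only [hξ])
  have h2 : ∫ ξ, inner ℝ (g' ξ) e * ψ ξ = ∫ ξ, inner ℝ (g ξ) e * ψ ξ :=
    integral_congr_ae (hg.mono fun ξ hξ => by simp only [hξ])
  rw [h1, h2]
  exact h ψ hψ hc e

theorem IsWeakGradient.const_mul {v : E N → ℝ} {g : E N → E N} (h : IsWeakGradient v g) (k : ℝ) :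
    IsWeakGradient (fun ξ => k * v ξ) (fun ξ => k • g ξ) := by
  intro ψ hψ hc e
  simp only [mul_assoc, real_inner_smul_left]
  rw [integral_const_mul, integral_const_mul, h ψ hψ hc e, mul_neg]

/-- The embedding of the weighted space `L²_m` into `L²`. -/
def toVolume (V : Type*) [NormedAddCommGroup V] [NormedSpace ℝ V] (N : ℕ) (m : ℝ) :
    Lp V 2 (weightMeasure N m) →L[ℝ] Lp V 2 (volume : Measure (E N)) :=
  LinearMap.mkContinuous
    { toFun := fun f => ((Lp.memLp f).mono_measure (volume_le_weightMeasure N m)).toLp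
      map_add' := fun f g => by
        rw [← MemLp.toLp_add, MemLp.toLp_eq_toLp_iff]
        exact ae_volume_of_ae_weight (Lp.coeFn_add f g)
      map_smul' := fun k f => by
        rw [RingHom.id_apply, ← MemLp.toLp_const_smul, MemLp.toLp_eq_toLp_iff]
        exact ae_volume_of_ae_weight (Lp.coeFn_smul k f) } 1 (fun f => by
    rw [one_mul, LinearMap.coe_mk, AddHom.coe_mk, Lp.norm_toLp, Lp.norm_def]
    exact ENNReal.toReal_mono (Lp.eLpNorm_ne_top f)
      (eLpNorm_mono_measure _ (volume_le_weightMeasure N m)))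

theorem coeFn_toVolume {V : Type*} [NormedAddCommGroup V] [NormedSpace ℝ V]
    (f : Lp V 2 (weightMeasure N m)) : toVolume V N m f =ᵐ[volume] f :=
  MemLp.coeFn_toLp ((Lp.memLp f).mono_measure (volume_le_weightMeasure N m))

/-- For each test function and direction, both sides of the weak gradient identity are inner
products in `L²` with a fixed compactly supported function, hence continuous; the space is an
intersection of closed sets. -/
theorem isClosed_H1m (N : ℕ) (m : ℝ) : IsClosed (H1m N m :
    Set (WithLp 2 (Lp ℝ 2 (weightMeasure N m) × Lp (E N) 2 (weightMeasure N m)))) := by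
  have hset : (H1m N m :
      Set (WithLp 2 (Lp ℝ 2 (weightMeasure N m) × Lp (E N) 2 (weightMeasure N m)))) =
      ⋂ (ψ : E N → ℝ) (_ : ContDiff ℝ ∞ ψ) (_ : HasCompactSupport ψ) (e : E N),
        {u | ∫ ξ, u.fst ξ * fderiv ℝ ψ ξ e = - ∫ ξ, inner ℝ (u.snd ξ) e * ψ ξ} := by
    ext u
    simp only [mem_iInter]
    rfl
  rw [hset]
  refine isClosed_iInter fun ψ => isClosed_iInter fun hψ => isClosed_iInter fun hc =>
    isClosed_iInter fun e => ?_
  have hd : MemLp (fun ξ => fderiv ℝ ψ ξ e) 2 (volume : Measure (E N)) :=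
    ((hψ.continuous_fderiv (by simp)).clm_apply continuous_const).memLp_of_hasCompactSupport
      (hc.fderiv_apply (𝕜 := ℝ) e)
  have hs : MemLp (fun ξ => ψ ξ • e) 2 (volume : Measure (E N)) :=
    (hψ.continuous.smul continuous_const).memLp_of_hasCompactSupport hc.smul_right
  have h1 : ∀ v : Lp ℝ 2 (weightMeasure N m), ∫ ξ, v ξ * fderiv ℝ ψ ξ e =
      inner ℝ hd.toLp (toVolume ℝ N m v) := by
    intro v
    rw [L2.inner_def]
    refine integral_congr_ae ?_
    filter_upwards [hd.coeFn_toLp, coeFn_toVolume v] with ξ h1 h2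
    rw [h1, h2]
    simp
  have h2 : ∀ g : Lp (E N) 2 (weightMeasure N m), ∫ ξ, inner ℝ (g ξ) e * ψ ξ =
      inner ℝ hs.toLp (toVolume (E N) N m g) := by
    intro v
    rw [L2.inner_def]
    refine integral_congr_ae ?_
    filter_upwards [hs.coeFn_toLp, coeFn_toVolume v] with ξ h1 h2
    rw [h1, h2, real_inner_smul_left, real_inner_comm, mul_comm]
  simp_rw [h1, h2]
  refine isClosed_eq ?_ ?_
  · exact continuous_const.inner ((toVolume ℝ N m).continuous.comp
      (WithLp.prod_continuous_ofLp 2 _ _).fst)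
  · exact (continuous_const.inner ((toVolume (E N) N m).continuous.comp
      (WithLp.prod_continuous_ofLp 2 _ _).snd)).neg

instance : CompleteSpace (H1m N m) := (isClosed_H1m N m).completeSpace_coe

/-- The difference has zero function part, so its gradient integrates to zero against every test
function and vanishes. This is what identifies the elements `w` and `g s` in the definition of a
solution with values of the operators. -/
theorem Represents.unique {u u' : H1m N m} {f : E N → ℝ} (h : Represents u f)
    (h' : Represents u' f) : u = u' := by
  rw [← sub_eq_zero]
  set w := u - u' with hw
  have h1 : w.1.fst = 0 := by
    have : u.1.fst = u'.1.fst := by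
      refine Lp.ext ((weightMeasure_absolutelyContinuous N m).ae_le ?_)
      filter_upwards [h, h'] with ξ a b
      exact a.trans b.symm
    change u.1.fst - u'.1.fst = 0
    rw [this, sub_self]
  have hg : MemLp w.1.snd 2 (volume : Measure (E N)) :=
    (Lp.memLp w.1.snd).mono_measure (volume_le_weightMeasure N m)
  have h2 : ∀ e : E N, ∀ᵐ ξ : E N, inner ℝ (w.1.snd ξ) e = 0 := by
    intro e
    refine ae_eq_zero_of_integral_contDiff_smul_eq_zero
      ((hg.inner_const e).locallyIntegrable (by norm_num)) fun ψ hψ hc => ?_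
    have h3 : ∫ ξ, w.1.fst ξ * fderiv ℝ ψ ξ e = - ∫ ξ, inner ℝ (w.1.snd ξ) e * ψ ξ :=
      w.2 ψ hψ hc e
    have h4 : ∫ ξ, w.1.fst ξ * fderiv ℝ ψ ξ e = 0 := by
      rw [h1]
      refine integral_eq_zero_of_ae ?_
      filter_upwards [ae_volume_of_ae_weight (Lp.coeFn_zero ℝ 2 (weightMeasure N m))] with ξ hξ
      change (0 : Lp ℝ 2 (weightMeasure N m)) ξ * _ = 0
      rw [hξ, Pi.zero_apply, zero_mul]
    rw [h4, eq_comm, neg_eq_zero] at h3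
    simpa [mul_comm] using h3
  have h5 : w.1.snd = 0 := by
    refine Lp.ext ((weightMeasure_absolutelyContinuous N m).ae_le ?_)
    have h6 : ∀ᵐ ξ : E N, ∀ i, inner ℝ (w.1.snd ξ) (EuclideanSpace.basisFun (Fin N) ℝ i) = 0 :=
      ae_all_iff.2 fun i => h2 _
    filter_upwards [h6, ae_volume_of_ae_weight (Lp.coeFn_zero (E N) 2 (weightMeasure N m))]
      with ξ h7 h8
    rw [h8]
    ext i
    simpa [EuclideanSpace.inner_single_right] using h7 i
  refine Subtype.ext (WithLp.ofLp_injective 2 (Prod.ext h1 h5))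

end SobolevSpace

/-! ### Exchanging convolution and duality with test functions -/

section Fubini

variable {N : ℕ}

theorem le_one_add_rpow {p : ℝ} (hp : 1 ≤ p) (x : ℝ≥0∞) : x ≤ 1 + x ^ p := by
  rcases le_total x 1 with h | h
  · exact h.trans le_self_add
  · calc x = x ^ (1 : ℝ) := (ENNReal.rpow_one x).symm
      _ ≤ x ^ p := ENNReal.rpow_le_rpow_of_exponent_le h hp
      _ ≤ _ := le_add_self

/-- `|f| ≤ 1 + |f|^p` replaces Hölder: the `1` is integrated against `φ`, and `|f|^p` against the
supremum of `φ`. The two shifts `α`, `β` cover the integrand before and after the translation by `c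
z`. -/
theorem integrable_prod_mul_mul {κ f φ : E N → ℝ} {p b : ℝ} (hp : 1 ≤ p) (hb : 0 < b)
    (hκ : Integrable κ) (hκc : Continuous κ) (hf : StronglyMeasurable f)
    (hfp : ∫⁻ x, ‖f x‖ₑ ^ p ≠ ⊤) (hφ : Continuous φ) (hφc : HasCompactSupport φ) (α β : ℝ) :
    Integrable (fun x : E N × E N => κ x.2 * (f (b • (x.1 + α • x.2)) * φ (x.1 + β • x.2)))
      (volume.prod volume) := by
  obtain ⟨B, hB⟩ := hφ.bounded_above_of_compact_support hφc
  have hm1 : StronglyMeasurable fun x : E N × E N => f (b • (x.1 + α • x.2)) :=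
    hf.comp_measurable (by fun_prop)
  have hm2 : Continuous fun x : E N × E N => φ (x.1 + β • x.2) := by fun_prop
  have hm : StronglyMeasurable fun x : E N × E N =>
      κ x.2 * (f (b • (x.1 + α • x.2)) * φ (x.1 + β • x.2)) :=
    (hκc.comp continuous_snd).stronglyMeasurable.mul (hm1.mul hm2.stronglyMeasurable)
  refine ⟨hm.aestronglyMeasurable, ?_⟩
  rw [HasFiniteIntegral, lintegral_prod_symm _ hm.enorm.aemeasurable]
  set M : ℝ≥0∞ := (∫⁻ x, ‖φ x‖ₑ) + (ENNReal.ofReal (b ^ (-(N : ℝ))) * ∫⁻ x, ‖f x‖ₑ ^ p) *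
    ENNReal.ofReal B with hM
  have hMfin : M < ⊤ := by
    refine ENNReal.add_lt_top.2 ⟨(hφ.integrable_of_hasCompactSupport hφc).2, ?_⟩
    exact ENNReal.mul_lt_top (ENNReal.mul_lt_top ENNReal.ofReal_lt_top hfp.lt_top)
      ENNReal.ofReal_lt_top
  have hle : ∀ z, ∫⁻ x, ‖κ z * (f (b • (x + α • z)) * φ (x + β • z))‖ₑ ≤ ‖κ z‖ₑ * M := by
    intro z
    simp only [enorm_mul]
    rw [lintegral_const_mul' _ _ enorm_ne_top]
    gcongr
    calc ∫⁻ x, ‖f (b • (x + α • z))‖ₑ * ‖φ (x + β • z)‖ₑ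
        ≤ ∫⁻ x, (‖φ (x + β • z)‖ₑ + ‖f (b • (x + α • z))‖ₑ ^ p * ENNReal.ofReal B) := by
          refine lintegral_mono fun x => ?_
          calc ‖f (b • (x + α • z))‖ₑ * ‖φ (x + β • z)‖ₑ
              ≤ (1 + ‖f (b • (x + α • z))‖ₑ ^ p) * ‖φ (x + β • z)‖ₑ := by
                gcongr
                exact le_one_add_rpow hp _
            _ = ‖φ (x + β • z)‖ₑ + ‖f (b • (x + α • z))‖ₑ ^ p * ‖φ (x + β • z)‖ₑ := by ring
            _ ≤ _ := by
                gcongr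
                rw [← ofReal_norm]
                exact ENNReal.ofReal_le_ofReal (hB _)
      _ = M := by
          have hφm : Measurable fun x => ‖φ (x + β • z)‖ₑ := by
            have : Continuous fun x => φ (x + β • z) := by fun_prop
            exact this.enorm.measurable
          rw [lintegral_add_left hφm, lintegral_mul_const' _ _ ENNReal.ofReal_ne_top,
            lintegral_add_right_eq_self (fun x => ‖φ x‖ₑ) (β • z),
            lintegral_add_right_eq_self (fun x => ‖f (b • x)‖ₑ ^ p) (α • z),
            lintegral_comp_smul hb (f := fun x => ‖f x‖ₑ ^ p) (hf.enorm.pow_const _)]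
  refine (lintegral_mono hle).trans_lt ?_
  rw [lintegral_mul_const' _ _ hMfin.ne]
  exact ENNReal.mul_lt_top hκ.2 hMfin

/-- The adjoint of the rescaled convolution. -/
theorem integral_conv_mul_eq {κ f φ : E N → ℝ} {p b : ℝ} (hp : 1 ≤ p) (hb : 0 < b)
    (hκ : Integrable κ) (hκc : Continuous κ) (hf : StronglyMeasurable f)
    (hfp : ∫⁻ x, ‖f x‖ₑ ^ p ≠ ⊤) (hφ : Continuous φ) (hφc : HasCompactSupport φ) (c : ℝ) :
    ∫ ξ, (∫ z, κ z * f (b • (ξ - c • z))) * φ ξ = ∫ z, κ z * ∫ x, f (b • x) * φ (x + c • z) := by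
  have h1 := integrable_prod_mul_mul hp hb hκ hκc hf hfp hφ hφc (-c) 0
  simp only [zero_smul, add_zero, neg_smul, ← sub_eq_add_neg] at h1
  calc ∫ ξ, (∫ z, κ z * f (b • (ξ - c • z))) * φ ξ
      = ∫ ξ, ∫ z, κ z * (f (b • (ξ - c • z)) * φ ξ) := by
        refine integral_congr_ae (.of_forall fun ξ => ?_)
        simp only
        rw [← integral_mul_const]
        simp only [mul_assoc]
    _ = ∫ z, ∫ ξ, κ z * (f (b • (ξ - c • z)) * φ ξ) := integral_integral_swap h1
    _ = _ := by
        refine integral_congr_ae (.of_forall fun z => ?_)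
        simp only
        rw [integral_const_mul]
        congr 1
        rw [← integral_add_right_eq_self (fun ξ => f (b • (ξ - c • z)) * φ ξ) (c • z)]
        simp

theorem integral_conv_mul_eq_swap {κ f φ : E N → ℝ} {p b : ℝ} (hp : 1 ≤ p) (hb : 0 < b)
    (hκ : Integrable κ) (hκc : Continuous κ) (hf : StronglyMeasurable f)
    (hfp : ∫⁻ x, ‖f x‖ₑ ^ p ≠ ⊤) (hφ : Continuous φ) (hφc : HasCompactSupport φ) (c : ℝ) :
    ∫ ξ, (∫ z, κ z * f (b • (ξ - c • z))) * φ ξ = ∫ x, f (b • x) * ∫ z, κ z * φ (x + c • z) := by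
  rw [integral_conv_mul_eq hp hb hκ hκc hf hfp hφ hφc]
  have h1 := integrable_prod_mul_mul hp hb hκ hκc hf hfp hφ hφc 0 c
  simp only [zero_smul, add_zero] at h1
  calc ∫ z, κ z * ∫ x, f (b • x) * φ (x + c • z)
      = ∫ z, ∫ x, κ z * (f (b • x) * φ (x + c • z)) := by simp only [integral_const_mul]
    _ = ∫ x, ∫ z, κ z * (f (b • x) * φ (x + c • z)) := (integral_integral_swap h1).symm
    _ = _ := by
        refine integral_congr_ae (.of_forall fun x => ?_)
        simp only
        rw [← integral_const_mul]
        refine integral_congr_ae (.of_forall fun z => ?_)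
        simp only
        ring

end Fubini

/-! ### The Gaussian kernel and weak gradients of its convolutions -/

section Gaussian

variable {N : ℕ} {m : ℝ}

/-- The Gaussian `(4π)^{-N/2} e^{-|z|²/4}`. -/
def gauss (z : E N) : ℝ := (4 * Real.pi) ^ (-(N : ℝ) / 2) * Real.exp (-(1 / 4) * ‖z‖ ^ 2)

/-- The gradient of the Gaussian. -/
def gaussGrad (z : E N) : E N := (-(1 / 2) * gauss z) • z

theorem gauss_pos (z : E N) : 0 < gauss z := by
  have := Real.pi_pos
  unfold gauss; positivity

theorem contDiff_gauss : ContDiff ℝ ∞ (gauss : E N → ℝ) := by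
  unfold gauss
  exact contDiff_const.mul (contDiff_const.mul (contDiff_norm_sq ℝ)).exp

theorem continuous_gauss : Continuous (gauss : E N → ℝ) := contDiff_gauss.continuous

theorem continuous_gaussGrad : Continuous (gaussGrad : E N → E N) := by
  have := continuous_gauss (N := N)
  unfold gaussGrad
  fun_prop

theorem integrable_gauss : Integrable (gauss : E N → ℝ) :=
  (integrable_exp_neg_mul_sq (by norm_num)).const_mul _

theorem integral_gauss : ∫ z : E N, gauss z = 1 := by
  simp only [gauss]
  rw [integral_const_mul, GaussianFourier.integral_rexp_neg_mul_sq_norm (by norm_num)]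
  simp only [finrank_euclideanSpace, Fintype.card_fin]
  have hpi := Real.pi_pos
  rw [show Real.pi / (1 / 4) = 4 * Real.pi by ring, ← Real.rpow_add (by positivity)]
  rw [show -(N : ℝ) / 2 + N / 2 = 0 by ring, Real.rpow_zero]

theorem fderiv_gauss (z e : E N) : fderiv ℝ gauss z e = inner ℝ (gaussGrad z) e := by
  have h1 : HasFDerivAt (gauss : E N → ℝ) ((4 * Real.pi) ^ (-(N : ℝ) / 2) •
      (Real.exp (-(1 / 4) * ‖z‖ ^ 2) • ((-(1 / 4) : ℝ) • (2 • innerSL ℝ z)))) z := by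
    unfold gauss
    exact (((hasStrictFDerivAt_norm_sq z).hasFDerivAt.const_mul (-(1 / 4))).exp).const_mul _
  rw [h1.fderiv, gaussGrad, real_inner_smul_left, gauss]
  simp
  ring

theorem norm_gauss_le (z : E N) :
    ‖gauss z‖ ≤ (4 * Real.pi) ^ (-(N : ℝ) / 2) * Real.exp (-(1 / 8) * ‖z‖ ^ 2) := by
  have := Real.pi_pos
  rw [Real.norm_of_nonneg (gauss_pos z).le, gauss]
  gcongr
  norm_num

theorem norm_gaussGrad_le (z : E N) :
    ‖gaussGrad z‖ ≤ 2 * (4 * Real.pi) ^ (-(N : ℝ) / 2) * Real.exp (-(1 / 8) * ‖z‖ ^ 2) := by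
  have := Real.pi_pos
  have h1 : ‖z‖ ≤ 4 * Real.exp (1 / 8 * ‖z‖ ^ 2) := by
    have := Real.add_one_le_exp (1 / 8 * ‖z‖ ^ 2)
    nlinarith [sq_nonneg (‖z‖ - 1)]
  rw [gaussGrad, norm_smul, norm_mul, Real.norm_of_nonneg (gauss_pos z).le, gauss]
  have h2 : Real.exp (-(1 / 4) * ‖z‖ ^ 2) * Real.exp (1 / 8 * ‖z‖ ^ 2) =
      Real.exp (-(1 / 8) * ‖z‖ ^ 2) := by
    rw [← Real.exp_add]; congr 1; ring
  calc ‖(-(1 / 2) : ℝ)‖ * ((4 * Real.pi) ^ (-(N : ℝ) / 2) * Real.exp (-(1 / 4) * ‖z‖ ^ 2)) * ‖z‖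
      ≤ 1 / 2 * ((4 * Real.pi) ^ (-(N : ℝ) / 2) * Real.exp (-(1 / 4) * ‖z‖ ^ 2)) *
        (4 * Real.exp (1 / 8 * ‖z‖ ^ 2)) := by
        gcongr
        norm_num
    _ = 2 * (4 * Real.pi) ^ (-(N : ℝ) / 2) *
        (Real.exp (-(1 / 4) * ‖z‖ ^ 2) * Real.exp (1 / 8 * ‖z‖ ^ 2)) := by ring
    _ = _ := by rw [h2]

theorem integrable_inner_gaussGrad (e : E N) : Integrable fun z => inner ℝ (gaussGrad z) e := by
  have h1 : Integrable (gaussGrad : E N → E N) :=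
    ((integrable_exp_neg_mul_sq (by norm_num)).const_mul _).mono'
      continuous_gaussGrad.aestronglyMeasurable (.of_forall norm_gaussGrad_le)
  exact h1.inner_const e

/-- The scalar Gaussian kernel. -/
def gaussKer (N : ℕ) (V : Type*) [NormedAddCommGroup V] [NormedSpace ℝ V] (z : E N) : V →L[ℝ] V :=
  gauss z • ContinuousLinearMap.id ℝ V

/-- The gradient kernel. -/
def gaussGradKer (N : ℕ) (z : E N) : ℝ →L[ℝ] E N :=
  ContinuousLinearMap.toSpanSingleton ℝ (gaussGrad z)

theorem isGaussianKernel_gaussKer (V : Type*) [NormedAddCommGroup V] [NormedSpace ℝ V] :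
    IsGaussianKernel (gaussKer N V) ((4 * Real.pi) ^ (-(N : ℝ) / 2)) where
  continuous := continuous_gauss.smul continuous_const
  bound z := by
    rw [gaussKer, norm_smul]
    refine le_trans ?_ (norm_gauss_le z)
    exact mul_le_of_le_one_right (norm_nonneg _) ContinuousLinearMap.norm_id_le

theorem isGaussianKernel_gaussGradKer :
    IsGaussianKernel (gaussGradKer N) (2 * (4 * Real.pi) ^ (-(N : ℝ) / 2)) where
  continuous :=
    (ContinuousLinearMap.toSpanSingletonCLE (𝕜 := ℝ) (E := E N)).continuous.comp
      continuous_gaussGrad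
  bound z := by
    rw [gaussGradKer, ContinuousLinearMap.norm_toSpanSingleton]
    exact norm_gaussGrad_le z

theorem rescaledConv_gaussKer_real (b c : ℝ) (f : E N → ℝ) (ξ : E N) :
    rescaledConv (gaussKer N ℝ) b c f ξ = ∫ z, gauss z * f (b • (ξ - c • z)) := rfl

/-- The gradient of the rescaled Gaussian convolution. -/
theorem isWeakGradient_rescaledConv {f : E N → ℝ} {p b c : ℝ} (hp : 1 ≤ p) (hb : 0 < b)
    (hc : 0 < c) (hf : StronglyMeasurable f) (hfp : ∫⁻ x, ‖f x‖ₑ ^ p ≠ ⊤)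
    (hi : ∀ᵐ ξ : E N, Integrable fun z => gaussGradKer N z (f (b • (ξ - c • z)))) :
    IsWeakGradient (rescaledConv (gaussKer N ℝ) b c f)
      (fun ξ => c⁻¹ • rescaledConv (gaussGradKer N) b c f ξ) := by
  intro ψ hψ hψc e
  have hdc : Continuous fun ξ => fderiv ℝ ψ ξ e :=
    (hψ.continuous_fderiv (by simp)).clm_apply continuous_const
  have hds : HasCompactSupport fun ξ => fderiv ℝ ψ ξ e := hψc.fderiv_apply (𝕜 := ℝ) e
  have hge : Continuous fun z : E N => inner ℝ (gaussGrad z) e :=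
    continuous_gaussGrad.inner continuous_const
  obtain ⟨B₁, hB₁⟩ := hψ.continuous.bounded_above_of_compact_support hψc
  obtain ⟨B₂, hB₂⟩ := hdc.bounded_above_of_compact_support hds
  -- The derivative of `ψ` at `x + c z` is `c⁻¹` times the `z`-derivative of `ψ(x + c z)`;
  -- integrating by parts puts it on the Gaussian, so `f` needs no derivative and the price is
  -- `c⁻¹`.
  have hibp : ∀ x : E N, ∫ z, gauss z * fderiv ℝ ψ (x + c • z) e =
      -(c⁻¹ * ∫ z, inner ℝ (gaussGrad z) e * ψ (x + c • z)) := by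
    intro x
    have hd : ∀ z, fderiv ℝ (fun z => ψ (x + c • z)) z e = c * fderiv ℝ ψ (x + c • z) e := by
      intro z
      have h1 : HasFDerivAt (fun z : E N => x + c • z) (c • ContinuousLinearMap.id ℝ (E N)) z :=
        ((hasFDerivAt_id z).const_smul c).const_add x
      have h2 := ((hψ.differentiable (by simp)) (x + c • z)).hasFDerivAt.comp z h1
      have h3 : fderiv ℝ (fun z => ψ (x + c • z)) z = _ := h2.fderiv
      rw [h3]
      simp
    have hcont : Continuous fun z => ψ (x + c • z) := hψ.continuous.comp (by fun_prop)
    have hcont' : Continuous fun z => fderiv ℝ ψ (x + c • z) e := hdc.comp (by fun_prop)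
    have hbp := integral_mul_fderiv_eq_neg_fderiv_mul_of_integrable (μ := (volume : Measure (E N)))
      (f := gauss) (g := fun z => ψ (x + c • z)) (v := e)
      (by
        simp only [fderiv_gauss]
        exact (integrable_inner_gaussGrad e).mul_bdd hcont.aestronglyMeasurable
          (.of_forall fun z => hB₁ _))
      (by
        simp only [hd]
        exact integrable_gauss.mul_bdd (c := c * B₂) (by fun_prop)
          (.of_forall fun z => by
            rw [norm_mul, Real.norm_of_nonneg hc.le]; gcongr; exact hB₂ _))
      (integrable_gauss.mul_bdd hcont.aestronglyMeasurable (.of_forall fun z => hB₁ _))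
      (fun z _ => (contDiff_gauss.differentiable (by simp)) z)
      (fun z _ => ((hψ.differentiable (by simp)).comp
        (by fun_prop : Differentiable ℝ fun z : E N => x + c • z)) z)
    simp only [hd, fderiv_gauss] at hbp
    have h4 : ∫ z, gauss z * (c * fderiv ℝ ψ (x + c • z) e) =
        c * ∫ z, gauss z * fderiv ℝ ψ (x + c • z) e := by
      rw [← integral_const_mul]
      refine integral_congr_ae (.of_forall fun z => ?_)
      simp only
      ring
    rw [h4] at hbp
    rw [← mul_neg, ← hbp, ← mul_assoc, inv_mul_cancel₀ hc.ne', one_mul]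
  have hR : ∫ ξ, inner ℝ (c⁻¹ • rescaledConv (gaussGradKer N) b c f ξ) e * ψ ξ =
      c⁻¹ * ∫ ξ, (∫ z, inner ℝ (gaussGrad z) e * f (b • (ξ - c • z))) * ψ ξ := by
    rw [← integral_const_mul]
    refine integral_congr_ae ?_
    filter_upwards [hi] with ξ hξ
    rw [real_inner_smul_left, mul_assoc]
    congr 2
    rw [rescaledConv, real_inner_comm, ← integral_inner hξ]
    refine integral_congr_ae (.of_forall fun z => ?_)
    simp only [gaussGradKer, ContinuousLinearMap.toSpanSingleton_apply, inner_smul_right]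
    rw [real_inner_comm, mul_comm]
  simp only [rescaledConv_gaussKer_real]
  rw [hR, integral_conv_mul_eq_swap hp hb integrable_gauss continuous_gauss hf hfp hdc hds,
    integral_conv_mul_eq_swap hp hb (integrable_inner_gaussGrad e) hge hf hfp hψ.continuous hψc,
    ← integral_const_mul, ← integral_neg]
  refine integral_congr_ae (.of_forall fun x => ?_)
  simp only [hibp]
  ring

/-- The Gaussian convolution commutes with the weak gradient, up to the scaling factor. -/
theorem IsWeakGradient.rescaledConv {v : E N → ℝ} {g : E N → E N} (h : IsWeakGradient v g)
    {b c : ℝ} (hb : 0 < b) (hv : StronglyMeasurable v) (hg : StronglyMeasurable g)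
    (hv2 : ∫⁻ x, ‖v x‖ₑ ^ (2 : ℝ) ≠ ⊤) (hg2 : ∫⁻ x, ‖g x‖ₑ ^ (2 : ℝ) ≠ ⊤)
    (hi : ∀ᵐ ξ : E N, Integrable fun z => gaussKer N (E N) z (g (b • (ξ - c • z)))) :
    IsWeakGradient (ViscousHJ.rescaledConv (gaussKer N ℝ) b c v)
      (fun ξ => b • ViscousHJ.rescaledConv (gaussKer N (E N)) b c g ξ) := by
  intro ψ hψ hψc e
  have hdc : Continuous fun ξ => fderiv ℝ ψ ξ e :=
    (hψ.continuous_fderiv (by simp)).clm_apply continuous_const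
  have hds : HasCompactSupport fun ξ => fderiv ℝ ψ ξ e := hψc.fderiv_apply (𝕜 := ℝ) e
  have hge : StronglyMeasurable fun x => inner ℝ (g x) e := hg.inner stronglyMeasurable_const
  have hge2 : ∫⁻ x, ‖inner ℝ (g x) e‖ₑ ^ (2 : ℝ) ≠ ⊤ := by
    have : ∀ x, ‖inner ℝ (g x) e‖ₑ ^ (2 : ℝ) ≤ ‖g x‖ₑ ^ (2 : ℝ) * ‖e‖ₑ ^ (2 : ℝ) := by
      intro x
      rw [← ENNReal.mul_rpow_of_nonneg _ _ (by norm_num), ← enorm_norm (g x), ← enorm_norm e,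
        ← enorm_mul]
      gcongr
      rw [← ofReal_norm, ← ofReal_norm]
      refine ENNReal.ofReal_le_ofReal ((norm_inner_le_norm _ _).trans ?_)
      rw [Real.norm_of_nonneg (by positivity)]
    refine ne_top_of_le_ne_top ?_ (lintegral_mono this)
    rw [lintegral_mul_const' _ _ (by simp)]
    exact ENNReal.mul_ne_top hg2 (by simp)
  have hR : ∫ ξ, inner ℝ (b • ViscousHJ.rescaledConv (gaussKer N (E N)) b c g ξ) e * ψ ξ =
      b * ∫ ξ, (∫ z, gauss z * inner ℝ (g (b • (ξ - c • z))) e) * ψ ξ := by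
    rw [← integral_const_mul]
    refine integral_congr_ae ?_
    filter_upwards [hi] with ξ hξ
    rw [real_inner_smul_left, mul_assoc]
    congr 2
    rw [ViscousHJ.rescaledConv, real_inner_comm, ← integral_inner hξ]
    refine integral_congr_ae (.of_forall fun z => ?_)
    simp only [gaussKer, FunLike.coe_smul, Pi.smul_apply, ContinuousLinearMap.id_apply,
      inner_smul_right]
    rw [real_inner_comm]
  have hz : ∀ z : E N, ∫ x, v (b • x) * fderiv ℝ ψ (x + c • z) e =
      -(b * ∫ x, inner ℝ (g (b • x)) e * ψ (x + c • z)) := by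
    intro z
    -- Undoes the dilation: this is an admissible test function for the weak gradient of `v`, and
    -- its chain-rule factor `b⁻¹` is the source of the factor `b` on the gradient.
    let ψt : E N → ℝ := fun y => ψ (b⁻¹ • y + c • z)
    have hψt : ContDiff ℝ ∞ ψt := hψ.comp (by fun_prop)
    have hψtc : HasCompactSupport ψt :=
      hψc.comp_homeomorph ((Homeomorph.smulOfNeZero b⁻¹ (inv_ne_zero hb.ne')).trans
        (Homeomorph.addRight (c • z)))
    have hd : ∀ y, fderiv ℝ ψt y e = b⁻¹ * fderiv ℝ ψ (b⁻¹ • y + c • z) e := by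
      intro y
      have h1 : HasFDerivAt (fun y : E N => b⁻¹ • y + c • z)
          (b⁻¹ • ContinuousLinearMap.id ℝ (E N)) y :=
        ((hasFDerivAt_id y).const_smul b⁻¹).add_const _
      have h2 := ((hψ.differentiable (by simp)) (b⁻¹ • y + c • z)).hasFDerivAt.comp y h1
      have h3 : fderiv ℝ ψt y = _ := h2.fderiv
      rw [h3]
      simp
    have h4 := h ψt hψt hψtc e
    have h5 := Measure.integral_comp_smul (volume : Measure (E N))
      (fun y => v y * fderiv ℝ ψ (b⁻¹ • y + c • z) e) b
    have h6 := Measure.integral_comp_smul (volume : Measure (E N))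
      (fun y => inner ℝ (g y) e * ψ (b⁻¹ • y + c • z)) b
    simp only [smul_smul, inv_mul_cancel₀ hb.ne', one_smul] at h5 h6
    rw [h5, h6]
    have h7 : ∫ y, v y * fderiv ℝ ψ (b⁻¹ • y + c • z) e = b * ∫ y, v y * fderiv ℝ ψt y e := by
      rw [← integral_const_mul]
      refine integral_congr_ae (.of_forall fun y => ?_)
      simp only [hd]
      field_simp
    rw [h7, h4]
    simp only [smul_eq_mul, ψt]
    ring
  simp only [rescaledConv_gaussKer_real]
  rw [hR, integral_conv_mul_eq one_le_two hb integrable_gauss continuous_gauss hv hv2 hdc hds,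
    integral_conv_mul_eq one_le_two hb integrable_gauss continuous_gauss hge hge2 hψ.continuous
      hψc, ← integral_const_mul, ← integral_neg]
  refine integral_congr_ae (.of_forall fun z => ?_)
  simp only [hz]
  ring

end Gaussian

/-! ### The semigroup `e^{t𝓛}` on `H¹_m` -/

section Semigroup

variable {N : ℕ} {m : ℝ}

/-- The dilation parameters of `e^{τ𝓛}`. -/
def semigroupParams (t : ℝ) : ℝ × ℝ := (Real.exp (t / 2), Real.sqrt (1 - Real.exp (-t)))

theorem one_sub_exp_neg_pos {t : ℝ} (ht : 0 < t) : 0 < 1 - Real.exp (-t) := by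
  have : Real.exp (-t) < 1 := Real.exp_lt_one_iff.mpr (by linarith)
  linarith

theorem semigroupParams_mem {s t : ℝ} (ht : 0 ≤ t) (h : 0 < t ∨ s = 0) :
    semigroupParams t ∈ convParams s := by
  refine ⟨Real.one_le_exp (by positivity), Real.sqrt_nonneg _, ?_, ?_⟩
  · refine Real.sqrt_le_one.2 ?_
    have := Real.exp_pos (-t)
    linarith
  · rcases h with h | h
    · exact Or.inl (Real.sqrt_pos.2 (one_sub_exp_neg_pos h))
    · exact Or.inr h

theorem continuous_semigroupParams : Continuous semigroupParams := by
  unfold semigroupParams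
  fun_prop

/-- The semigroup `e^{t𝓛}` as a rescaled convolution with a fixed Gaussian. -/
theorem expL_eq_rescaledConv {t : ℝ} (ht : 0 ≤ t) (f : E N → ℝ) (ξ : E N) :
    expL t f ξ = Real.exp (t * N / 2) * rescaledConv (gaussKer N ℝ) (semigroupParams t).1
      (semigroupParams t).2 f ξ := by
  rw [rescaledConv_gaussKer_real]
  rcases ht.eq_or_lt with rfl | ht
  -- At `t = 0` the parameters are `b = 1`, `c = 0`, and the unit mass of the Gaussian gives the
  -- identity.
  · simp only [expL, le_refl, if_true, semigroupParams, zero_div, Real.exp_zero, neg_zero, sub_self,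
      Real.sqrt_zero, zero_smul, sub_zero, one_smul, zero_mul, one_mul]
    rw [integral_mul_const, integral_gauss, one_mul]
  rw [expL, if_neg ht.not_ge]
  have ha := one_sub_exp_neg_pos ht
  set a : ℝ := 1 - Real.exp (-t) with hadef
  have hpi := Real.pi_pos
  set b : ℝ := Real.exp (t / 2) with hb
  set c : ℝ := Real.sqrt a with hc
  have hb0 : 0 < b := Real.exp_pos _
  have hc0 : 0 < c := Real.sqrt_pos.2 ha
  change _ = _ * ∫ z, gauss z * f (b • (ξ - c • z))
  -- Substitution `η = b(ξ - c z)`: then `ξ - e^{-t/2} η = c z` and the kernel becomes `c^{-N}`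
  -- times the fixed Gaussian. Against the Jacobian `(bc)^N` this leaves `b^N = e^{tN/2}`.
  have h1 := Measure.integral_comp_smul (volume : Measure (E N))
    (fun y => kernelL t ξ (b • (ξ - y)) * f (b • (ξ - y))) c
  have h2 := integral_sub_left_eq_self (fun y : E N => kernelL t ξ (b • y) * f (b • y)) volume ξ
  have h3 := Measure.integral_comp_smul (volume : Measure (E N))
    (fun y => kernelL t ξ y * f y) b
  simp only [finrank_euclideanSpace, Fintype.card_fin, smul_eq_mul] at h1 h3
  rw [h2, h3] at h1
  have h4 : ∀ z, kernelL t ξ (b • (ξ - c • z)) = a ^ (-(N : ℝ) / 2) * gauss z := by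
    intro z
    have e1 : ξ - Real.exp (-t / 2) • b • (ξ - c • z) = c • z := by
      rw [smul_smul, hb, ← Real.exp_add, show -t / 2 + t / 2 = 0 by ring, Real.exp_zero, one_smul,
        sub_sub_cancel]
    rw [kernelL, e1, ← hadef, norm_smul, mul_pow, Real.norm_of_nonneg hc0.le, hc, Real.sq_sqrt ha.le,
      Real.mul_rpow (by positivity) ha.le, gauss]
    have e2 : -(a * ‖z‖ ^ 2) / (4 * a) = -(1 / 4) * ‖z‖ ^ 2 := by field_simp
    rw [e2]
    ring
  simp only [h4, mul_assoc] at h1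
  rw [integral_const_mul] at h1
  have h5 : a ^ (-(N : ℝ) / 2) = (c ^ N)⁻¹ := by
    rw [hc, Real.sqrt_eq_rpow, ← Real.rpow_natCast, ← Real.rpow_mul ha.le, ← Real.rpow_neg ha.le]
    congr 1
    ring
  have h6 : Real.exp (t * N / 2) = b ^ N := by
    rw [hb, ← Real.exp_nat_mul]
    congr 1
    ring
  rw [h5, abs_of_pos (by positivity), abs_of_pos (by positivity)] at h1
  have hcN : (c ^ N)⁻¹ ≠ 0 := by positivity
  rw [mul_right_inj' hcN] at h1
  rw [h6, h1, ← mul_assoc, mul_inv_cancel₀ (by positivity), one_mul]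

/-- An operator into `H¹_m` given by its two components. -/
def pairMap {A : Type*} [NormedAddCommGroup A] [NormedSpace ℝ A]
    (f : A →L[ℝ] Lp ℝ 2 (weightMeasure N m)) (g : A →L[ℝ] Lp (E N) 2 (weightMeasure N m))
    (h : ∀ a, IsWeakGradient (f a) (g a)) : A →L[ℝ] H1m N m :=
  ((WithLp.prodContinuousLinearEquiv 2 ℝ (Lp ℝ 2 (weightMeasure N m))
    (Lp (E N) 2 (weightMeasure N m))).symm.toContinuousLinearMap.comp (f.prod g)).codRestrict
    (H1m N m) h

theorem norm_pairMap_le {A : Type*} [NormedAddCommGroup A] [NormedSpace ℝ A]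
    (f : A →L[ℝ] Lp ℝ 2 (weightMeasure N m)) (g : A →L[ℝ] Lp (E N) 2 (weightMeasure N m))
    (h : ∀ a, IsWeakGradient (f a) (g a)) : ‖pairMap f g h‖ ≤ ‖f‖ + ‖g‖ := by
  refine ContinuousLinearMap.opNorm_le_bound _ (by positivity) fun a => ?_
  have h1 : ‖pairMap f g h a‖ = Real.sqrt (‖f a‖ ^ 2 + ‖g a‖ ^ 2) :=
    WithLp.prod_norm_eq_of_L2 (pairMap f g h a).1
  rw [h1, add_mul]
  refine (Real.sqrt_le_left (by positivity)).2 ?_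
  have h2 := f.le_opNorm a
  have h3 := g.le_opNorm a
  nlinarith [norm_nonneg (f a), norm_nonneg (g a)]

theorem continuousOn_H1m {P : Type*} [TopologicalSpace P] {D : Set P} {u : P → H1m N m}
    (h1 : ContinuousOn (fun x => (u x).1.fst) D) (h2 : ContinuousOn (fun x => (u x).1.snd) D) :
    ContinuousOn u D := by
  have h3 := (WithLp.prod_continuous_toLp 2 (Lp ℝ 2 (weightMeasure N m))
    (Lp (E N) 2 (weightMeasure N m))).comp_continuousOn (h1.prodMk h2)
  exact Topology.IsInducing.subtypeVal.continuousOn_iff.2 h3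

theorem norm_fst_le (u : H1m N m) : ‖u.1.fst‖ ≤ ‖u‖ := by
  have h1 : ‖u‖ = Real.sqrt (‖u.1.fst‖ ^ 2 + ‖u.1.snd‖ ^ 2) := WithLp.prod_norm_eq_of_L2 u.1
  rw [h1]
  exact Real.le_sqrt_of_sq_le (by nlinarith [sq_nonneg ‖u.1.snd‖])

theorem norm_snd_le (u : H1m N m) : ‖u.1.snd‖ ≤ ‖u‖ := by
  have h1 : ‖u‖ = Real.sqrt (‖u.1.fst‖ ^ 2 + ‖u.1.snd‖ ^ 2) := WithLp.prod_norm_eq_of_L2 u.1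
  rw [h1]
  exact Real.le_sqrt_of_sq_le (by nlinarith [sq_nonneg ‖u.1.fst‖])

/-- The function component of `H¹_m`. -/
def fstCLM (N : ℕ) (m : ℝ) : H1m N m →L[ℝ] Lp ℝ 2 (weightMeasure N m) :=
  LinearMap.mkContinuous
    { toFun := fun u => u.1.fst
      map_add' := fun _ _ => rfl
      map_smul' := fun _ _ => rfl } 1 (fun u => by rw [one_mul]; exact norm_fst_le u)

/-- The gradient component of `H¹_m`. -/
def gradCLM (N : ℕ) (m : ℝ) : H1m N m →L[ℝ] Lp (E N) 2 (weightMeasure N m) :=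
  LinearMap.mkContinuous
    { toFun := fun u => u.1.snd
      map_add' := fun _ _ => rfl
      map_smul' := fun _ _ => rfl } 1 (fun u => by rw [one_mul]; exact norm_snd_le u)

theorem norm_fstCLM_le : ‖fstCLM N m‖ ≤ 1 := LinearMap.mkContinuous_norm_le _ zero_le_one _

theorem norm_gradCLM_le : ‖gradCLM N m‖ ≤ 1 := LinearMap.mkContinuous_norm_le _ zero_le_one _

theorem lintegral_enorm_rpow_ne_top {V : Type*} [NormedAddCommGroup V] {p : ℝ≥0∞}
    (hp : p ≠ ⊤) (hp0 : p ≠ 0) (f : Lp V p (weightMeasure N m)) :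
    ∫⁻ x, ‖f x‖ₑ ^ p.toReal ≠ ⊤ :=
  (lintegral_rpow_enorm_lt_top_of_eLpNorm_lt_top hp0 hp
    ((Lp.memLp f).mono_measure (volume_le_weightMeasure N m)).2).ne

theorem two_eq_ofReal_conv : (2 : ℝ≥0∞) = ENNReal.ofReal (1 / (1 / 2 + 0)) := by norm_num

/-- The semigroup `e^{t𝓛}` on `H¹_m`. -/
theorem exists_semigroup (hm : 0 < m) :
    ∃ (S : ℝ → H1m N m →L[ℝ] H1m N m) (M : ℝ → ℝ),
      (∀ t, 0 ≤ t → ∀ u, Represents (S t u) (expL t (fn u))) ∧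
      (∀ u, ContinuousOn (fun t => S t u) (Ici 0)) ∧
      ∀ a, 0 < a → ∀ t ∈ Icc 0 a, ‖S t‖ ≤ M a := by
  obtain ⟨C₁, hC₁, Op₁, hOp₁⟩ := (isGaussianKernel_gaussKer (N := N) ℝ).exists_operator hm le_rfl
    (by norm_num) two_eq_ofReal_conv
  obtain ⟨C₂, hC₂, Op₂, hOp₂⟩ := (isGaussianKernel_gaussKer (N := N) (E N)).exists_operator hm
    le_rfl (by norm_num) two_eq_ofReal_conv
  obtain ⟨_, _, hInt⟩ := (isGaussianKernel_gaussKer (N := N) (E N)).memLp_and_integrable hm le_rfl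
    (s := 0) (by norm_num)
  rw [← two_eq_ofReal_conv] at hInt
  let f : ℝ → H1m N m →L[ℝ] Lp ℝ 2 (weightMeasure N m) := fun t =>
    (Real.exp (t * N / 2) • Op₁ (semigroupParams t)).comp (fstCLM N m)
  -- The gradient falls on the datum here, so it only brings the dilation factor `e^{t/2}` and no
  -- singularity at `t = 0`.
  let g : ℝ → H1m N m →L[ℝ] Lp (E N) 2 (weightMeasure N m) := fun t =>
    (Real.exp (t * N / 2) • Real.exp (t / 2) • Op₂ (semigroupParams t)).comp (gradCLM N m)
  have hmem : ∀ t, 0 ≤ t → semigroupParams t ∈ convParams 0 := fun t ht =>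
    semigroupParams_mem ht (Or.inr rfl)
  have hf : ∀ t, 0 ≤ t → ∀ u, f t u =ᵐ[volume] fun ξ => Real.exp (t * N / 2) *
      rescaledConv (gaussKer N ℝ) (semigroupParams t).1 (semigroupParams t).2 (fn u) ξ := by
    intro t ht u
    have h1 := (hOp₁ _ (hmem t ht)).2 u.1.fst (fn u) (Lp.stronglyMeasurable _) (.refl _ _)
    have h2 := Lp.coeFn_smul (Real.exp (t * N / 2)) (Op₁ (semigroupParams t) u.1.fst)
    filter_upwards [ae_volume_of_ae_weight h1, ae_volume_of_ae_weight h2] with ξ h3 h4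
    change (Real.exp (t * N / 2) • Op₁ (semigroupParams t) u.1.fst) ξ = _
    rw [h4, Pi.smul_apply, h3, smul_eq_mul]
  have hg : ∀ t, 0 ≤ t → ∀ u, g t u =ᵐ[volume] fun ξ => Real.exp (t * N / 2) •
      (semigroupParams t).1 • rescaledConv (gaussKer N (E N)) (semigroupParams t).1
        (semigroupParams t).2 (grad u) ξ := by
    intro t ht u
    have h1 := (hOp₂ _ (hmem t ht)).2 u.1.snd (grad u) (Lp.stronglyMeasurable _) (.refl _ _)
    have h2 := Lp.coeFn_smul (Real.exp (t * N / 2))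
      (Real.exp (t / 2) • Op₂ (semigroupParams t) u.1.snd)
    have h2' := Lp.coeFn_smul (Real.exp (t / 2)) (Op₂ (semigroupParams t) u.1.snd)
    filter_upwards [ae_volume_of_ae_weight h1, ae_volume_of_ae_weight h2,
      ae_volume_of_ae_weight h2'] with ξ h3 h4 h5
    change (Real.exp (t * N / 2) • Real.exp (t / 2) • Op₂ (semigroupParams t) u.1.snd) ξ = _
    rw [h4, Pi.smul_apply, h5, Pi.smul_apply, h3]
    rfl
  have hweak : ∀ t, 0 ≤ t → ∀ u, IsWeakGradient (f t u) (g t u) := by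
    intro t ht u
    have h1 : IsWeakGradient (fn u) (grad u) := u.2
    have hv2 := lintegral_enorm_rpow_ne_top (by norm_num) (by norm_num) u.1.fst
    have hg2 := lintegral_enorm_rpow_ne_top (by norm_num) (by norm_num) u.1.snd
    have h2 := ((h1.rescaledConv (b := (semigroupParams t).1) (c := (semigroupParams t).2)
      (Real.exp_pos _) (Lp.stronglyMeasurable _)
      (Lp.stronglyMeasurable _) (by simpa [fn] using hv2) (by simpa [grad] using hg2)
      (hInt _ (hmem t ht) _ (Lp.stronglyMeasurable _) (Lp.memLp _)).2.2).const_mul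
      (Real.exp (t * N / 2)))
    exact h2.congr_ae (hf t ht u).symm (hg t ht u).symm
  have hex : ∀ t, ∃ St : H1m N m →L[ℝ] H1m N m, 0 ≤ t →
      ((∀ u, (St u).1.fst = f t u) ∧ (∀ u, (St u).1.snd = g t u) ∧ ‖St‖ ≤ ‖f t‖ + ‖g t‖) := by
    intro t
    by_cases ht : 0 ≤ t
    · exact ⟨pairMap (f t) (g t) (hweak t ht), fun _ => ⟨fun _ => rfl, fun _ => rfl,
        norm_pairMap_le _ _ _⟩⟩
    · exact ⟨0, fun h => absurd h ht⟩
  choose S hS using hex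
  have hmaps : MapsTo semigroupParams (Ici 0) (convParams 0) := fun t ht => hmem t ht
  refine ⟨S, fun a => Real.exp (a * N / 2) * C₁ + Real.exp (a * N / 2) * (Real.exp (a / 2) * C₂),
    ?_, ?_, ?_⟩
  · intro t ht u
    have h1 := hf t ht u
    rw [← (hS t ht).1 u] at h1
    filter_upwards [h1] with ξ h2
    rw [expL_eq_rescaledConv ht]
    exact h2
  · intro u
    refine continuousOn_H1m ?_ ?_
    · refine ContinuousOn.congr (f := fun t => f t u) ?_ fun t ht => (hS t ht).1 u
      have h1 := ((isGaussianKernel_gaussKer (N := N) ℝ).continuousOn_operator hm (by norm_num) hOp₁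
        u.1.fst).comp continuous_semigroupParams.continuousOn hmaps
      have h2 : Continuous fun t : ℝ => Real.exp (t * N / 2) := by fun_prop
      exact h2.continuousOn.smul h1
    · refine ContinuousOn.congr (f := fun t => g t u) ?_ fun t ht => (hS t ht).2.1 u
      have h1 := ((isGaussianKernel_gaussKer (N := N) (E N)).continuousOn_operator hm (by norm_num)
        hOp₂ u.1.snd).comp continuous_semigroupParams.continuousOn hmaps
      have h2 : Continuous fun t : ℝ => Real.exp (t * N / 2) := by fun_prop
      have h3 : Continuous fun t : ℝ => Real.exp (t / 2) := by fun_prop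
      exact h2.continuousOn.smul (h3.continuousOn.smul h1)
  · intro a ha t ht
    have e1 : ‖Op₁ (semigroupParams t)‖ ≤ C₁ := by
      have := (hOp₁ _ (hmem t ht.1)).1
      simpa using this
    have e2 : ‖Op₂ (semigroupParams t)‖ ≤ C₂ := by
      have := (hOp₂ _ (hmem t ht.1)).1
      simpa using this
    have hexp : Real.exp (t * N / 2) ≤ Real.exp (a * N / 2) := by
      gcongr; exact ht.2
    have hexp2 : Real.exp (t / 2) ≤ Real.exp (a / 2) := by
      gcongr; exact ht.2
    refine (hS t ht.1).2.2.trans (add_le_add ?_ ?_)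
    · calc ‖f t‖ ≤ ‖Real.exp (t * N / 2) • Op₁ (semigroupParams t)‖ * ‖fstCLM N m‖ :=
            ContinuousLinearMap.opNorm_comp_le _ _
        _ ≤ (Real.exp (a * N / 2) * C₁) * 1 := by
            rw [norm_smul, Real.norm_of_nonneg (Real.exp_pos _).le]
            gcongr
            exact norm_fstCLM_le
        _ = _ := mul_one _
    · calc ‖g t‖ ≤ ‖Real.exp (t * N / 2) • Real.exp (t / 2) • Op₂ (semigroupParams t)‖ *
            ‖gradCLM N m‖ := ContinuousLinearMap.opNorm_comp_le _ _
        _ ≤ (Real.exp (a * N / 2) * (Real.exp (a / 2) * C₂)) * 1 := by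
            rw [norm_smul, norm_smul, Real.norm_of_nonneg (Real.exp_pos _).le,
              Real.norm_of_nonneg (Real.exp_pos _).le]
            gcongr
            exact norm_gradCLM_le
        _ = _ := mul_one _

end Semigroup

/-! ### Smoothing of `e^{t𝓛}` from `L^p` to `H¹_m` -/

section Smoothing

variable {N : ℕ} {m : ℝ}

/-- `1 - e^{-t} = (e^t - 1) e^{-t} ≥ t e^{-t}`; it converts negative powers of `1 - e^{-t}` into
negative powers of `t` on bounded intervals. -/
theorem mul_exp_neg_le_one_sub_exp_neg {a t : ℝ} (ht : t ∈ Ioc 0 a) :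
    t * Real.exp (-a) ≤ 1 - Real.exp (-t) := by
  have h1 := Real.add_one_le_exp t
  have h2 : Real.exp (-a) ≤ Real.exp (-t) := Real.exp_le_exp.2 (by linarith [ht.2])
  have h3 : Real.exp t * Real.exp (-t) = 1 := by rw [← Real.exp_add]; simp
  calc t * Real.exp (-a) ≤ t * Real.exp (-t) := by
        have := ht.1
        gcongr
    _ ≤ (Real.exp t - 1) * Real.exp (-t) := by gcongr; linarith
    _ = _ := by rw [sub_mul, h3, one_mul]

theorem semigroupParams_snd_rpow_le {a t κ : ℝ} (hκ : 0 ≤ κ) (ht : t ∈ Ioc 0 a) :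
    (semigroupParams t).2 ^ (-κ) ≤ Real.exp (a * (κ / 2)) * t ^ (-(κ / 2)) := by
  have ha := one_sub_exp_neg_pos ht.1
  have ht0 := ht.1
  calc (semigroupParams t).2 ^ (-κ) = (1 - Real.exp (-t)) ^ (-(κ / 2)) := by
        rw [semigroupParams, Real.sqrt_eq_rpow, ← Real.rpow_mul ha.le]
        congr 1
        ring
    _ ≤ (t * Real.exp (-a)) ^ (-(κ / 2)) :=
        Real.rpow_le_rpow_of_nonpos (by positivity) (mul_exp_neg_le_one_sub_exp_neg ht)
          (by linarith)
    _ = _ := by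
        rw [Real.mul_rpow ht0.le (Real.exp_pos _).le, ← Real.exp_mul, mul_comm]
        congr 2
        ring

/-- The smoothing action of `e^{t𝓛}` from `L^p(μ)` to `H¹_m`, `1/p = 1/2 + s`. -/
theorem exists_smoothing (hm : 0 < m) {s : ℝ} (hs : 0 ≤ s) (hs2 : s ≤ 1 / 2) {p : ℝ≥0∞}
    [Fact (1 ≤ p)] (hp : p = ENNReal.ofReal (1 / (1 / 2 + s))) :
    ∃ (T : ℝ → Lp ℝ p (weightMeasure N m) →L[ℝ] H1m N m) (M : ℝ → ℝ),
      (∀ t, 0 < t → ∀ y, Represents (T t y) (expL t y)) ∧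
      (∀ y, ContinuousOn (fun t => T t y) (Ioi 0)) ∧
      ∀ a, 0 < a → ∀ t ∈ Ioc 0 a, ‖T t‖ ≤ M a * t ^ (-((N * s + 1) / 2)) := by
  have hpr : 0 < 1 / (1 / 2 + s) := by positivity
  have hptop : p ≠ ⊤ := hp ▸ ENNReal.ofReal_ne_top
  have hp0 : p ≠ 0 := by rw [hp]; simpa using hpr
  have hp1 : 1 ≤ p.toReal := by
    have : (1 : ℝ≥0∞) ≤ p := Fact.out
    simpa using ENNReal.toReal_mono hptop this
  obtain ⟨C₁, hC₁, Op₁, hOp₁⟩ := (isGaussianKernel_gaussKer (N := N) ℝ).exists_operator hm hs hs2 hp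
  obtain ⟨C₂, hC₂, Op₂, hOp₂⟩ := (isGaussianKernel_gaussGradKer (N := N)).exists_operator hm hs hs2
    hp
  obtain ⟨_, _, hInt⟩ := (isGaussianKernel_gaussGradKer (N := N)).memLp_and_integrable hm hs hs2
  rw [← hp] at hInt
  let f : ℝ → Lp ℝ p (weightMeasure N m) →L[ℝ] Lp ℝ 2 (weightMeasure N m) := fun t =>
    Real.exp (t * N / 2) • Op₁ (semigroupParams t)
  -- The datum has no gradient, so the derivative falls on the Gaussian and the factor `c⁻¹`
  -- appears.
  let g : ℝ → Lp ℝ p (weightMeasure N m) →L[ℝ] Lp (E N) 2 (weightMeasure N m) := fun t =>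
    Real.exp (t * N / 2) • (semigroupParams t).2⁻¹ • Op₂ (semigroupParams t)
  have hmem : ∀ t, 0 < t → semigroupParams t ∈ convParams s := fun t ht =>
    semigroupParams_mem ht.le (Or.inl ht)
  have hc0 : ∀ t, 0 < t → 0 < (semigroupParams t).2 := fun t ht =>
    Real.sqrt_pos.2 (one_sub_exp_neg_pos ht)
  have hf : ∀ t, 0 < t → ∀ y, f t y =ᵐ[volume] fun ξ => Real.exp (t * N / 2) *
      rescaledConv (gaussKer N ℝ) (semigroupParams t).1 (semigroupParams t).2 y ξ := by
    intro t ht y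
    have h1 := (hOp₁ _ (hmem t ht)).2 y y (Lp.stronglyMeasurable _) (.refl _ _)
    have h2 := Lp.coeFn_smul (Real.exp (t * N / 2)) (Op₁ (semigroupParams t) y)
    filter_upwards [ae_volume_of_ae_weight h1, ae_volume_of_ae_weight h2] with ξ h3 h4
    change (Real.exp (t * N / 2) • Op₁ (semigroupParams t) y) ξ = _
    rw [h4, Pi.smul_apply, h3, smul_eq_mul]
  have hg : ∀ t, 0 < t → ∀ y, g t y =ᵐ[volume] fun ξ => Real.exp (t * N / 2) •
      (semigroupParams t).2⁻¹ • rescaledConv (gaussGradKer N) (semigroupParams t).1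
        (semigroupParams t).2 y ξ := by
    intro t ht y
    have h1 := (hOp₂ _ (hmem t ht)).2 y y (Lp.stronglyMeasurable _) (.refl _ _)
    have h2 := Lp.coeFn_smul (Real.exp (t * N / 2))
      ((semigroupParams t).2⁻¹ • Op₂ (semigroupParams t) y)
    have h2' := Lp.coeFn_smul ((semigroupParams t).2⁻¹) (Op₂ (semigroupParams t) y)
    filter_upwards [ae_volume_of_ae_weight h1, ae_volume_of_ae_weight h2,
      ae_volume_of_ae_weight h2'] with ξ h3 h4 h5
    change (Real.exp (t * N / 2) • (semigroupParams t).2⁻¹ • Op₂ (semigroupParams t) y) ξ = _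
    rw [h4, Pi.smul_apply, h5, Pi.smul_apply, h3]
  have hweak : ∀ t, 0 < t → ∀ y, IsWeakGradient (f t y) (g t y) := by
    intro t ht y
    have h2 := ((isWeakGradient_rescaledConv (b := (semigroupParams t).1) hp1 (Real.exp_pos _)
      (hc0 t ht) (Lp.stronglyMeasurable y) (lintegral_enorm_rpow_ne_top hptop hp0 y)
      (hInt _ (hmem t ht) _ (Lp.stronglyMeasurable y) (Lp.memLp y)).2.2).const_mul
      (Real.exp (t * N / 2)))
    exact h2.congr_ae (hf t ht y).symm (hg t ht y).symm
  have hex : ∀ t, ∃ Tt : Lp ℝ p (weightMeasure N m) →L[ℝ] H1m N m, 0 < t →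
      ((∀ y, (Tt y).1.fst = f t y) ∧ (∀ y, (Tt y).1.snd = g t y) ∧ ‖Tt‖ ≤ ‖f t‖ + ‖g t‖) := by
    intro t
    by_cases ht : 0 < t
    · exact ⟨pairMap (f t) (g t) (hweak t ht), fun _ => ⟨fun _ => rfl, fun _ => rfl,
        norm_pairMap_le _ _ _⟩⟩
    · exact ⟨0, fun h => absurd h ht⟩
  choose T hT using hex
  have hmaps : MapsTo semigroupParams (Ioi 0) (convParams s) := fun t ht => hmem t ht
  refine ⟨T, fun a => Real.exp (a * N / 2) * (C₁ + C₂) * Real.exp (a * ((N * s + 1) / 2)),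
    ?_, ?_, ?_⟩
  · intro t ht y
    have h1 := hf t ht y
    rw [← (hT t ht).1 y] at h1
    filter_upwards [h1] with ξ h2
    rw [expL_eq_rescaledConv ht.le]
    exact h2
  · intro y
    have h2 : Continuous fun t : ℝ => Real.exp (t * N / 2) := by fun_prop
    refine continuousOn_H1m ?_ ?_
    · refine ContinuousOn.congr (f := fun t => f t y) ?_ fun t ht => (hT t ht).1 y
      have h1 := ((isGaussianKernel_gaussKer (N := N) ℝ).continuousOn_operator hm hptop hOp₁
        y).comp continuous_semigroupParams.continuousOn hmaps
      exact h2.continuousOn.smul h1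
    · refine ContinuousOn.congr (f := fun t => g t y) ?_ fun t ht => (hT t ht).2.1 y
      have h1 := ((isGaussianKernel_gaussGradKer (N := N)).continuousOn_operator hm hptop
        hOp₂ y).comp continuous_semigroupParams.continuousOn hmaps
      have h3 : ContinuousOn (fun t : ℝ => (semigroupParams t).2⁻¹) (Ioi 0) :=
        continuous_semigroupParams.snd.continuousOn.inv₀ fun t ht => (hc0 t ht).ne'
      exact h2.continuousOn.smul (h3.smul h1)
  · intro a ha t ht
    have hNs : 0 ≤ N * s := by positivity
    set c := (semigroupParams t).2 with hc
    have hcp : 0 < c := hc0 t ht.1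
    have hc1 : c ≤ 1 := (hmem t ht.1).2.2.1
    have e1 : ‖Op₁ (semigroupParams t)‖ ≤ C₁ * c ^ (-(N * s)) := (hOp₁ _ (hmem t ht.1)).1
    have e2 : ‖Op₂ (semigroupParams t)‖ ≤ C₂ * c ^ (-(N * s)) := (hOp₂ _ (hmem t ht.1)).1
    have hexp : Real.exp (t * N / 2) ≤ Real.exp (a * N / 2) := by
      gcongr; exact ht.2
    have e3 : c⁻¹ * c ^ (-(N * s)) = c ^ (-(N * s + 1)) := by
      rw [neg_add, Real.rpow_add hcp, Real.rpow_neg_one, mul_comm]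
    -- As `c ≤ 1`, the milder singularity of the function component is absorbed in that of the
    -- gradient.
    have e4 : c ^ (-(N * s)) ≤ c ^ (-(N * s + 1)) :=
      Real.rpow_le_rpow_of_exponent_ge hcp hc1 (by linarith)
    have e5 := semigroupParams_snd_rpow_le (κ := N * s + 1) (by positivity) ht
    rw [← hc] at e5
    calc ‖T t‖ ≤ ‖f t‖ + ‖g t‖ := (hT t ht.1).2.2
      _ ≤ Real.exp (a * N / 2) * (C₁ * c ^ (-(N * s))) +
          Real.exp (a * N / 2) * (c⁻¹ * (C₂ * c ^ (-(N * s)))) := by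
          simp only [f, g]
          rw [norm_smul, norm_smul, norm_smul, Real.norm_of_nonneg (Real.exp_pos _).le,
            Real.norm_of_nonneg (inv_pos.2 hcp).le]
          gcongr
      _ = Real.exp (a * N / 2) * (C₁ * c ^ (-(N * s)) + C₂ * (c⁻¹ * c ^ (-(N * s)))) := by ring
      _ ≤ Real.exp (a * N / 2) * (C₁ * c ^ (-(N * s + 1)) + C₂ * c ^ (-(N * s + 1))) := by
          rw [e3]
          gcongr
      _ = Real.exp (a * N / 2) * (C₁ + C₂) * c ^ (-(N * s + 1)) := by ring
      _ ≤ Real.exp (a * N / 2) * (C₁ + C₂) *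
          (Real.exp (a * ((N * s + 1) / 2)) * t ^ (-((N * s + 1) / 2))) := by gcongr
      _ = _ := by ring

end Smoothing

/-! ### From the abstract Volterra theory to the truncated equation -/

section MainTheorem

variable {N : ℕ} {m : ℝ}

theorem isSingularKernel_rpow {X Y : Type*} [NormedAddCommGroup X] [NormedSpace ℝ X]
    [NormedAddCommGroup Y] [NormedSpace ℝ Y] {T : ℝ → Y →L[ℝ] X} {a M θ : ℝ} (ha : 0 < a)
    (hθ : θ < 1) (hc : ∀ y, ContinuousOn (fun t => T t y) (Ioi 0))
    (hb : ∀ t ∈ Ioc 0 a, ‖T t‖ ≤ M * t ^ (-θ)) :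
    IsSingularKernel T a (fun t => M * t ^ (-θ)) where
  cont y := (hc y).mono Ioc_subset_Ioi_self
  bound := hb
  contBound := fun t ht =>
    (continuousAt_const.mul (Real.continuousAt_rpow_const t (-θ) (Or.inl ht.1.ne'))).continuousWithinAt
  integrable := by
    have h := (intervalIntegral.intervalIntegrable_rpow' (a := 0) (b := a)
      (r := -θ) (by linarith)).const_mul M
    rwa [intervalIntegrable_iff_integrableOn_Ioc_of_le ha.le] at h

theorem IsMildSolution.intervalIntegrable {X Y : Type*} [NormedAddCommGroup X] [NormedSpace ℝ X]
    [NormedAddCommGroup Y] [NormedSpace ℝ Y] {S : ℝ → X →L[ℝ] X} {T : ℝ → Y →L[ℝ] X} {F : X → Y}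
    {a : ℝ} {β : ℝ → ℝ} {x : X} {v : ℝ → X} (h : IsMildSolution S T F a x v) (hF : Continuous F)
    (hT : IsSingularKernel T a β) {τ : ℝ} (hτ : τ ∈ Icc 0 a) :
    IntervalIntegrable (fun s => T (τ - s) (F (v s))) volume 0 τ := by
  have ha : 0 ≤ a := hτ.1.trans hτ.2
  let u : C(Icc 0 a, Y) := ⟨fun s => F (v s), hF.comp h.continuousOn.domRestrict⟩
  have h1 := hT.intervalIntegrable (u.continuous.Icc_extend' (h := ha)) (B := ‖u‖)
    (fun s => u.norm_coe_le_norm _) hτ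
  refine h1.congr fun s hs => ?_
  rw [uIoc_of_le hτ.1] at hs
  have hs' : s ∈ Icc 0 a := ⟨hs.1.le, hs.2.trans hτ.2⟩
  simp only [IccExtend_of_mem ha _ hs']
  rfl

/-- Equality at every point holds only for `t > 0`, where a kernel is integrated; at `t = 0` the
definition evaluates the function itself. -/
theorem expL_congr_ae {t : ℝ} (ht : 0 < t) {f g : E N → ℝ} (h : f =ᵐ[volume] g) :
    expL t f = expL t g := by
  ext ξ
  rw [expL, expL, if_neg ht.not_ge, if_neg ht.not_ge]
  exact integral_congr_ae (h.mono fun η hη => by simp only [hη])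

/-- The notion of global solution in terms of the operators `S(τ) = e^{τ𝓛}` on `H¹_m` and
`T(τ) = e^{τ𝓛}` from `L^p` to `H¹_m`. -/
theorem isGlobalSolution_iff {χ : ℝ → ℝ} {ϱ : ℝ} {p : ℝ≥0∞} [Fact (1 ≤ p)]
    {S : ℝ → H1m N m →L[ℝ] H1m N m} {T : ℝ → Lp ℝ p (weightMeasure N m) →L[ℝ] H1m N m}
    {β : ℝ → ℝ → ℝ} {F : H1m N m → Lp ℝ p (weightMeasure N m)} (hF : Continuous F)
    (hFr : ∀ v, F v =ᵐ[volume] truncF χ ϱ v)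
    (hS : ∀ t, 0 ≤ t → ∀ u, Represents (S t u) (expL t (fn u)))
    (hT : ∀ t, 0 < t → ∀ y, Represents (T t y) (expL t y))
    (hk : ∀ a, 0 < a → IsSingularKernel T a (β a)) (v₀ : H1m N m) (v : ℝ → H1m N m) :
    IsGlobalSolution χ ϱ v₀ v ↔ ∀ a, 0 < a → IsMildSolution S T F a v₀ v := by
  have hTF : ∀ t, 0 < t → ∀ u, Represents (T t (F u)) (expL t (truncF χ ϱ u)) := by
    intro t ht u
    rw [← expL_congr_ae ht (hFr u)]
    exact hT t ht (F u)
  constructor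
  · intro h a ha
    refine ⟨h.continuousOn.mono Icc_subset_Ici_self, fun τ hτ => ?_⟩
    obtain ⟨w, g, hw, hg, -, heq⟩ := h.duhamel τ hτ.1
    -- The integrals are reduced to the open interval because the integrands are identified only for
    -- `s < τ`: at `s = τ` there is no smoothing.
    rw [heq, hw.unique (hS τ hτ.1 v₀), volterra, intervalIntegral.integral_of_le hτ.1,
      intervalIntegral.integral_of_le hτ.1, integral_Ioc_eq_integral_Ioo,
      integral_Ioc_eq_integral_Ioo]
    congr 1
    refine setIntegral_congr_fun measurableSet_Ioo fun s hs => ?_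
    exact (hg s ⟨hs.1.le, hs.2⟩).unique (hTF _ (sub_pos.2 hs.2) _)
  · intro h
    refine ⟨fun τ hτ => ?_, fun τ hτ => ?_⟩
    · have hτ0 : 0 ≤ τ := hτ
      have h1 := (h (τ + 1) (by linarith)).continuousOn τ ⟨hτ, by linarith⟩
      refine h1.mono_of_mem_nhdsWithin ?_
      rw [← Ici_inter_Iic]
      exact inter_mem_nhdsWithin _ (Iic_mem_nhds (by linarith))
    · have hτ' : τ ∈ Icc 0 (τ + 1) := ⟨hτ, by linarith⟩
      have h1 := h (τ + 1) (by linarith)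
      exact ⟨S τ v₀, fun s => T (τ - s) (F (v s)), hS τ hτ v₀,
        fun s hs => hTF _ (sub_pos.2 hs.2) _,
        h1.intervalIntegrable hF (hk (τ + 1) (by linarith)) hτ', h1.eq τ hτ'⟩

theorem one_lt_qStar (N : ℕ) : 1 < qStar N := by
  rw [qStar, one_lt_div (by positivity)]
  linarith

theorem qStar_le_two (N : ℕ) : qStar N ≤ 2 := by
  have : (0 : ℝ) ≤ N := N.cast_nonneg
  rw [qStar, div_le_iff₀ (by positivity)]
  linarith

/-- The truncated nonlinearity as a map from `H¹_m` to `L^{2/q⋆}(μ)`. -/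
theorem exists_nonlinearity {χ : ℝ → ℝ} (hχ : IsCutoff χ)
    [Fact (1 ≤ ENNReal.ofReal (2 / qStar N))] :
    ∃ C : ℝ, 0 < C ∧ ∀ ϱ : ℝ, 0 < ϱ →
      ∃ F : H1m N m → Lp ℝ (ENNReal.ofReal (2 / qStar N)) (weightMeasure N m),
        (∀ v, F v =ᵐ[volume] truncF χ ϱ v) ∧ ContDiff ℝ 1 F ∧ F 0 = 0 ∧ fderiv ℝ F 0 = 0 ∧
        LipschitzWith (Real.toNNReal (C * ϱ ^ (qStar N - 1))) F := by
  have hq := one_lt_qStar N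
  have hq0 : 0 < qStar N := one_pos.trans hq
  obtain ⟨D, hDc, hD, hDb⟩ := exists_hasFDerivAt_normPowLp (V := E N) (μ := weightMeasure N m)
    hq (qStar_le_two N)
  obtain ⟨C, hC, htr⟩ := exists_truncation_bound (X := H1m N m) hχ hq (c := 2 * qStar N)
    (by positivity) (G := fun v => normPowLp hq0 (gradCLM N m v))
    (D := fun v => (D (gradCLM N m v)).comp (gradCLM N m))
    ((hDc.comp (gradCLM N m).continuous).clm_comp continuous_const)
    (fun v => (hD _).comp v (gradCLM N m).hasFDerivAt)
    (fun v => by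
      refine (ContinuousLinearMap.opNorm_comp_le _ _).trans ?_
      refine (mul_le_of_le_one_right (norm_nonneg _) norm_gradCLM_le).trans ((hDb _).trans ?_)
      gcongr
      exact norm_snd_le v)
    (fun v => (norm_normPowLp_le hq0 _).trans (by gcongr; exact norm_snd_le v))
  refine ⟨C, hC, fun ϱ hϱ => ⟨fun v => χ (‖v‖ ^ 2 / ϱ ^ 2) • normPowLp hq0 (gradCLM N m v),
    fun v => ?_, htr ϱ hϱ⟩⟩
  filter_upwards [ae_volume_of_ae_weight (Lp.coeFn_smul (χ (‖v‖ ^ 2 / ϱ ^ 2))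
    (normPowLp hq0 (gradCLM N m v))), ae_volume_of_ae_weight
    (coeFn_normPowLp hq0 (gradCLM N m v))] with ξ h1 h2
  rw [h1, Pi.smul_apply, h2]
  rfl

end MainTheorem

end ViscousHJ

end

/-! ### The theorem: exponents and constants -/

set_option maxHeartbeats 400000 in
open ViscousHJ in
theorem mainTheorem5 (N : ℕ) (hN : 1 ≤ N) (m : ℝ) (hm : (N : ℝ) / 2 < m)
    (χ : ℝ → ℝ) (hχ : ViscousHJ.IsCutoff χ) :
    ∃ S : ViscousHJ.H1m N m →L[ℝ] ViscousHJ.H1m N m,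
      (∀ w, ViscousHJ.Represents (S w) (ViscousHJ.expL 1 (ViscousHJ.fn w))) ∧
      ∃ C : ℝ, 0 < C ∧ ∀ ϱ : ℝ, 0 < ϱ → ϱ < 1 →
        ∃ φ : ℝ → ViscousHJ.H1m N m → ViscousHJ.H1m N m,
          ViscousHJ.IsSemiflow χ ϱ φ ∧
          ∃ R : ViscousHJ.H1m N m → ViscousHJ.H1m N m,
            (∀ w, R w = φ 1 w - S w) ∧
            ContDiff ℝ 1 R ∧
            R 0 = 0 ∧
            fderiv ℝ R 0 = 0 ∧
            LipschitzWith (Real.toNNReal (C * ϱ ^ (ViscousHJ.qStar N - 1))) R := by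
  have hm0 : 0 < m := lt_of_le_of_lt (by positivity) hm
  have hN1 : (1 : ℝ) ≤ N := by exact_mod_cast hN
  have hq1 : qStar N - 1 = 1 / ((N : ℝ) + 1) := by rw [qStar]; field_simp; ring
  have hqpos : 0 < qStar N - 1 := by rw [hq1]; positivity
  have hqle : qStar N - 1 ≤ 1 / 2 := by
    rw [hq1, div_le_div_iff₀ (by positivity) (by norm_num)]
    linarith
  have hq0 : 0 < qStar N := by linarith
  have : Fact (1 ≤ ENNReal.ofReal (2 / qStar N)) := ⟨by
    rw [ENNReal.one_le_ofReal, le_div_iff₀ hq0]; linarith⟩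
  -- Chosen so that `1/p = 1/2 + s` with `p = 2/q⋆`, the space where `|∇v|^{q⋆}` lives.
  obtain ⟨s, hs⟩ : ∃ s : ℝ, s = (qStar N - 1) / 2 := ⟨_, rfl⟩
  have hp : ENNReal.ofReal (2 / qStar N) = ENNReal.ofReal (1 / (1 / 2 + s)) := by
    congr 1
    rw [hs, show 1 / 2 + (qStar N - 1) / 2 = qStar N / 2 by ring, one_div_div]
  -- Here the critical exponent enters: `N s = N/(2(N+1)) < 1/2`, so the singularity is weaker than
  -- `t^{-3/4}`.
  have hθ : ((N : ℝ) * s + 1) / 2 < 1 := by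
    have h1 : (N : ℝ) * s = N / (N + 1) / 2 := by rw [hs, hq1]; ring
    have h2 : (N : ℝ) / (N + 1) < 1 := by rw [div_lt_one (by positivity)]; linarith
    rw [h1]
    linarith
  obtain ⟨S, M, hSr, hSc, hSb⟩ := exists_semigroup (N := N) hm0
  obtain ⟨T, M', hTr, hTc, hTb⟩ := exists_smoothing (N := N) (m := m) hm0 (by rw [hs]; positivity)
    (by linarith) hp
  have hk := fun a (ha : 0 < a) => isSingularKernel_rpow ha hθ hTc (hTb a ha)
  obtain ⟨C₁, hC₁, hnl⟩ := exists_nonlinearity (N := N) (m := m) hχ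
  -- For `ϱ < 1` every truncated nonlinearity has Lipschitz constant at most `C₁`, so fixing `L₀ =
  -- C₁` before `ϱ` makes `C₂` independent of `ϱ`.
  obtain ⟨C₂, hflow⟩ := exists_semiflow hSc hSb hk C₁.toNNReal
  -- `C₂` may be zero, hence `C₂ + 1` in the constant.
  refine ⟨S 1, fun w => hSr 1 zero_le_one w, (C₂ + 1) * C₁, by positivity, fun ϱ hϱ hϱ1 => ?_⟩
  obtain ⟨F, hFr, hFC, hF0, hF0', hFL⟩ := hnl ϱ hϱ
  have hϱle : ϱ ^ (qStar N - 1) ≤ 1 := Real.rpow_le_one hϱ.le hϱ1.le hqpos.le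
  obtain ⟨φ, hφ, huniq, hRC, hR0, hR0', hRL⟩ := hflow F _
    (Real.toNNReal_le_toNNReal (mul_le_of_le_one_right hC₁.le hϱle)) hFL hFC hF0 hF0'
  have hiff := fun v₀ v => isGlobalSolution_iff hFC.continuous hFr hSr hTr hk v₀ v
  refine ⟨φ, fun v₀ => ⟨(hiff v₀ _).2 (hφ v₀), fun v hv τ hτ => ?_⟩,
    fun w => φ 1 w - S 1 w, fun _ => rfl, hRC, hR0, hR0', hRL.weaken ?_⟩
  · exact huniq v₀ (τ + 1) v (by linarith) ((hiff v₀ v).1 hv _ (by linarith)) τ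
      ⟨hτ, by linarith⟩
  · rw [← NNReal.coe_le_coe]
    push_cast
    rw [Real.coe_toNNReal _ (by positivity), Real.coe_toNNReal _ (by positivity), ← mul_assoc]
    gcongr
    linarith
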